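/- **Setting.** Let $n\ge 2$. *Mumford system.* $M'_{n-1}$ is the complex affine space of triples of polynomials $(u,v,w)$ with $u$ monic of degree $n-1$, $\deg v<n-1$, $w$ monic of degree $n+1$; its coordinates are the non-leading coefficients $u_i,v_i,w_i$. Put $H=uw+v^2$ and $\alpha(x)=x+w_n-u_{n-2}$. There are unique polynomials $p$, monic of degree $n$, and $r$, of degree $<n$, with $uw+v^2=p^2+r$; their coefficients are regular functions on $M'_{n-1}$. For a polynomial $\psi$ (whose coefficients may be regular functions on $M'_{n-1}$) define the expressions $$\{u(x),v(x')\}_M^{\psi}=\tfrac{u(x)\psi(x')-u(x')\psi(x)}{x-x'},\qquad \{u(x),w(x')\}_M^{\psi}=-2\,\tfrac{v(x)\psi(x')-v(x')\psi(x)}{x-x'},$$ $$\{v(x),w(x')\}_M^{\psi}=\tfrac{w(x)\psi(x')-w(x')\psi(x)}{x-x'}-\alpha(x+x')u(x)\psi(x'),\qquad \{w(x),w(x')\}_M^{\psi}=2\alpha(x+x')\bigl(v(x)\psi(x')-v(x')\psi(x)\bigr).$$ For $\varphi\in\mathbb C[x]$ with $\deg\varphi\le1$ let $\alpha^\varphi(x)=\varphi(\alpha(2x)/2)$,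 and let $\{\cdot,\cdot\}_{M,q}^\varphi$ be the skew-symmetric biderivation of the regular functions on $M'_{n-1}$ given by $\{u(x),u(x')\}=\{v(x),v(x')\}=0$ and $$\{u(x),v(x')\}_{M,q}^\varphi=\{u(x),v(x')\}_M^{p\varphi}+\alpha^\varphi(x+x')u(x)u(x'),\quad \{u(x),w(x')\}_{M,q}^\varphi=\{u(x),w(x')\}_M^{p\varphi}-2\alpha^\varphi(x+x')u(x)v(x'),$$ $$\{v(x),w(x')\}_{M,q}^\varphi=\{v(x),w(x')\}_M^{p\varphi}+\alpha^\varphi(x+x')u(x)w(x'),$$ $$\{w(x),w(x')\}_{M,q}^\varphi=\{w(x),w(x')\}_M^{p\varphi}+2\alpha^\varphi(x+x')\bigl(w(x)v(x')-w(x')v(x)\bigr).$$ With $L=\begin{pmatrix}v&w\\u&-v\end{pmatrix}$ the Mumford vector fields $X_y$ on $M'_{n-1}$ are $$X_yL(x)=\tfrac1{x-y}\Bigl[L(x),\,L(y)+(x-y)\begin{pmatrix}0&\alpha(x+y)u(y)\\0&0\end{pmatrix}\Bigr];$$ they are polynomial in $y$, and we write $X_y=\sum_j Y_jy^j$. *Toda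 lattice.* $T_n$ is the affine variety with coordinates $a_i,b_i$ ($i\in\mathbb Z/n$) and equation $\prod_i a_i=1$. Its Lax operator $L(h)$ has entries $b_i$ at $(i,i)$, $a_i$ at $(i,i+1)$ and $1$ at $(i+1,i)$ for $1\le i<n$ (resp. $i\le n$ for $b_i$), and $ha_n$ at $(n,1)$, $h^{-1}$ at $(1,n)$ (entries at the same place are added when $n=2$). $T_n$ carries the bracket $\{\cdot,\cdot\}_T^\varphi=\varphi_1\{\cdot,\cdot\}_T^x+\varphi_0\{\cdot,\cdot\}_T^1$, $\varphi=\varphi_1x+\varphi_0$, where $$\{a_i,a_j\}^1=\{b_i,b_j\}^1=0,\quad \{a_i,b_j\}^1=a_i(\delta_{i,j}-\delta_{i+1,j}),$$ $$\{a_i,a_j\}^x=a_ia_j(\delta_{i,j+1}-\delta_{i+1,j}),\quad \{b_i,b_j\}^x=a_j\delta_{i,j+1}-a_i\delta_{i+1,j},\quad \{a_i,b_j\}^x=a_ib_j(\delta_{i,j}-\delta_{i+1,j}).$$ $K$ is defined by $\det(x-L(h))=-h-h^{-1}+K(x)/2$; moreover $I_i=\frac1{i+1}\operatorname{tr}L(h)^{i+1}$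 for $0\le i\le n-2$ and $I_{n-1}=\frac1n\operatorname{tr}L(h)^n-h-h^{-1}$. The Toda vector fields are $X_i=\{\cdot,I_i\}_T^1$. *The maps.* For $m\in\mathbb Z/n$ let $\Delta_{i_1,\dots,i_k}$ be the minor obtained by removing rows and columns $i_1,\dots,i_k$ from the matrix $x-L(h)$ stripped of the terms that contain $h$ (for $m=n$), resp. stripped of the two terms that link the indices $m$ and $m+1$, as transported by the cyclic $\mathbb Z/n$-action (for general $m$); put $\Delta_{m-1,m,m+1}=0$ when $n=2$. The map $\Phi_m:T_n\to M'_{n-1}$ is $$u=\Delta_m,\qquad v=a_m\Delta_{m,m+1}-a_{m-1}\Delta_{m-1,m},$$ $$w=(x-b_m)^2\Delta_m-2(x-b_m)\bigl(a_{m-1}\Delta_{m-1,m}+a_m\Delta_{m,m+1}\bigr)+4a_ma_{m-1}\Delta_{m-1,m,m+1}.$$ *KM and Prym systems.* $K_n\subset T_n$ is the subspace $b=0$, with bracket $\{a_i,a_j\}_K=a_ia_j(\delta_{i,j+1}-\delta_{i+1,j})$; the KM vector fields are $\{\cdot,I_i|_{K_n}\}_K$ (for $i=1$ and $n\geq 3$: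 $\dot a_j=a_j(a_{j-1}-a_{j+1})$). The Prym phase space $P\subset M'_{n-1}$ is $P_{(n-1)/2}$ ($n$ odd; $u,w$ even, $v$ odd), resp. $P'_{n/2-1}$ ($n$ even; $u,w$ odd, $v$ even). It is the fixed point set of the involution $(u,v,w)(x)\mapsto(-1)^{n-1}(u(-x),-v(-x),w(-x))$ of $M'_{n-1}$. The Prym vector fields $X_y=\sum_j Y_jy^j$ on $P$ are $$X_yL(x)=\tfrac1{x^2-y^2}\Bigl[L(x),\begin{pmatrix}yv(y)&xw(y)+x(x^2-y^2)u(y)\\xu(y)&-yv(y)\end{pmatrix}\Bigr].$$ **Proposition.** Let $\varphi\in\mathbb C[x]$ with $\deg\varphi\le1$. (i) The formulas above define a Poisson bracket $\{\cdot,\cdot\}_{M,q}^\varphi$ on $M'_{n-1}$. For every $m\in\mathbb Z/n$ the formulas above define a map $\Phi_m:T_n\to M'_{n-1}$, and $\Phi_m:(T_n,\{\cdot,\cdot\}_T^\varphi)\to(M'_{n-1},\{\cdot,\cdot\}_{M,q}^\varphi)$ is Poisson. It maps the Toda flows to the Mumford flows: for all regular $f$ on $M'_{n-1}$, $$\{f\circ\Phi_m,K(y)\}_T^\varphi=\varphi(y)\,(X_yf)\circ\Phi_m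 ,$$ and for every $0\le i\le n-1$ there are functions $c_0,\dots,c_{n-1}$ in the algebra generated by the coefficients of $H$, not depending on $m$, such that the Toda vector field $X_i$ is $\Phi_m$-related to $\sum_jc_jY_j$. (ii) If $\varphi$ is odd, there is a unique bracket on $P$ such that $\{F,G\}_{M,q}^\varphi|_P=\{F|_P,G|_P\}$ for all regular functions $F,G$ on $M'_{n-1}$ that are invariant under the involution; it is a Poisson bracket, and $\Phi_m:(K_n,\varphi_1\{\cdot,\cdot\}_K)\to P$ is Poisson with respect to it for every $m$ (so for $\varphi=x$ it is Poisson from $\{\cdot,\cdot\}_K$). The restriction of $\Phi_m$ to $K_n$ takes values in $P$ and maps the KM flows to the Prym flows: $\{f\circ\Phi_m,K(y)|_{K_n}\}_K=y\,(X_yf)\circ\Phi_m$ for all regular $f$ on $P$, and for every $0\le i\le n-1$ there are $c_0,\dots,c_{n-1}$ in the algebra generated by the coefficients of $H|_P$, not depending on $m$, such that $\{\cdot,I_i|_{K_n}\}_K$ is $\Phi_m$-related to $\sum_jc_jY_j$. -/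

import Mathlib

open scoped Polynomial

namespace PrymToda

noncomputable section

/-! ## Poisson brackets -/

/-- `B` is a Poisson bracket on the commutative `ℂ`-algebra `A` (a skew-symmetric `ℂ`-bilinear
biderivation that satisfies the Jacobi identity). -/
structure IsPoissonBracket {A : Type*} [CommRing A] [Algebra ℂ A] (B : A → A → A) : Prop where
  add_left : ∀ f g h, B (f + g) h = B f h + B g h
  smul_left : ∀ (c : ℂ) f g, B (c • f) g = c • B f g
  skew : ∀ f g, B f g = -B g f
  leibniz : ∀ f g h, B (f * g) h = f * B g h + g * B f h
  jacobi : ∀ f g h, B f (B g h) + B g (B h f) + B h (B f g) = 0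

/-- The map of affine varieties with comorphism `Ψ : 𝒪(N) → 𝒪(M)` is a Poisson map
from `(M, BM)` to `(N, BN)`. -/
def IsPoissonMap {A B : Type*} [CommRing A] [Algebra ℂ A] [CommRing B] [Algebra ℂ B]
    (BM : A → A → A) (BN : B → B → B) (Ψ : B →ₐ[ℂ] A) : Prop :=
  ∀ f g, Ψ (BN f g) = BM (Ψ f) (Ψ g)

/-- The biderivation of a polynomial ring whose value on the coordinates `i`, `j` is `π i j`
(for skew-symmetric `π`). -/
def polyBracket {σ : Type*} [Fintype σ] (π : σ → σ → MvPolynomial σ ℂ)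
    (f g : MvPolynomial σ ℂ) : MvPolynomial σ ℂ :=
  ∑ i, ∑ j, π i j * MvPolynomial.pderiv i f * MvPolynomial.pderiv j g

/-- The coordinate ring of the hypersurface `c = 1` in affine space. -/
abbrev LevelRing {σ : Type*} (c : MvPolynomial σ ℂ) : Type _ :=
  MvPolynomial σ ℂ ⧸ Ideal.span {c - 1}

/-- The bracket induced on the hypersurface `c = 1` when `c` is a Casimir; it is computed on
representatives, see `levelBracket_mk` for the independence of the choice. -/
def levelBracket {σ : Type*} [Fintype σ] (c : MvPolynomial σ ℂ)
    (π : σ → σ → MvPolynomial σ ℂ) (f g : LevelRing c) : LevelRing c :=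
  Ideal.Quotient.mk _ (polyBracket π (Quotient.out f) (Quotient.out g))

theorem polyBracket_sub_left {σ : Type*} [Fintype σ] (π : σ → σ → MvPolynomial σ ℂ)
    (f f' g : MvPolynomial σ ℂ) :
    polyBracket π (f - f') g = polyBracket π f g - polyBracket π f' g := by
  simp only [polyBracket, map_sub, mul_sub, sub_mul, Finset.sum_sub_distrib]

theorem polyBracket_skew {σ : Type*} [Fintype σ] (π : σ → σ → MvPolynomial σ ℂ)
    (hπ : ∀ i j, π i j = -π j i) (f g : MvPolynomial σ ℂ) :
    polyBracket π f g = -polyBracket π g f := by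
  unfold polyBracket
  rw [Finset.sum_comm, ← Finset.sum_neg_distrib]
  refine Finset.sum_congr rfl fun i _ => ?_
  rw [← Finset.sum_neg_distrib]
  refine Finset.sum_congr rfl fun j _ => ?_
  rw [hπ j i]
  ring

theorem polyBracket_mul_left {σ : Type*} [Fintype σ] (π : σ → σ → MvPolynomial σ ℂ)
    (f g h : MvPolynomial σ ℂ) :
    polyBracket π (f * g) h = f * polyBracket π g h + g * polyBracket π f h := by
  simp only [polyBracket, Derivation.leibniz, smul_eq_mul, Finset.mul_sum,
    ← Finset.sum_add_distrib]
  refine Finset.sum_congr rfl fun i _ => Finset.sum_congr rfl fun j _ => ?_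
  ring

theorem levelBracket_mk {σ : Type*} [Fintype σ] (c : MvPolynomial σ ℂ)
    (π : σ → σ → MvPolynomial σ ℂ) (hπ : ∀ i j, π i j = -π j i)
    (hc : ∀ f, polyBracket π c f = 0) (f g : MvPolynomial σ ℂ) :
    levelBracket c π (Ideal.Quotient.mk _ f) (Ideal.Quotient.mk _ g) =
      Ideal.Quotient.mk _ (polyBracket π f g) := by
  have key : ∀ f f' g : MvPolynomial σ ℂ, f - f' ∈ Ideal.span {c - 1} →
      polyBracket π f g - polyBracket π f' g ∈ Ideal.span {c - 1} := by
    intro f f' g hf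
    obtain ⟨k, hk⟩ := Ideal.mem_span_singleton'.1 hf
    have h1 : polyBracket π (c - 1) g = 0 := by
      rw [polyBracket_sub_left, hc]
      simp [polyBracket]
    rw [← polyBracket_sub_left, ← hk, polyBracket_mul_left, h1, mul_zero, zero_add]
    exact Ideal.mul_mem_right _ _ (Ideal.subset_span rfl)
  have hout : ∀ f : MvPolynomial σ ℂ,
      Quotient.out (Ideal.Quotient.mk (Ideal.span {c - 1}) f) - f ∈ Ideal.span {c - 1} := by
    intro f
    rw [← Ideal.Quotient.eq]
    exact Quotient.out_eq _
  unfold levelBracket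
  rw [Ideal.Quotient.eq]
  have h1 := key _ _ (Quotient.out (Ideal.Quotient.mk (Ideal.span {c - 1}) g)) (hout f)
  have h2 := key _ _ f (hout g)
  rw [polyBracket_skew π hπ _ f, polyBracket_skew π hπ g f] at h2
  have h3 := Ideal.sub_mem _ h1 h2
  convert h3 using 1
  ring

/-! ## Generating functions in two variables

A polynomial `F(x, x')` with coefficients in `A` is an element of `A[X][X]`: the outer variable is
`x`, the inner one is `x'`, so `(F.coeff i).coeff j` is the coefficient of `x ^ i * x' ^ j`. -/

section Bivariate

variable {A : Type*} [CommRing A]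

/-- `P ↦ P(x)`. -/
def atX (P : A[X]) : A[X][X] := P.map Polynomial.C

/-- `P ↦ P(x')`. -/
def atX' (P : A[X]) : A[X][X] := Polynomial.C P

/-- `x`. -/
def varX : A[X][X] := Polynomial.X

/-- `x'`. -/
def varX' : A[X][X] := Polynomial.C Polynomial.X

/-- The quotient `F(x, x') / (x - x')`, used only for `F` that are divisible by `x - x'`. -/
def divDiff (F : A[X][X]) : A[X][X] := F /ₘ (Polynomial.X - Polynomial.C Polynomial.X)

/-- The quotient `F(x, x') / (x² - x'²)`, used only for `F` that are divisible by `x² - x'²`. -/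
def divDiffSq (F : A[X][X]) : A[X][X] :=
  F /ₘ (Polynomial.X ^ 2 - Polynomial.C (Polynomial.X ^ 2))

/-- `{P(x), Q(x')} = G(x, x')`, where the bracket is taken coefficientwise. -/
def HasGenFun (B : A → A → A) (P Q : A[X]) (G : A[X][X]) : Prop :=
  ∀ i j : ℕ, B (P.coeff i) (Q.coeff j) = (G.coeff i).coeff j

end Bivariate

/-! ## The polynomials `p` and `r` -/

theorem exists_sqrt {A : Type*} [CommRing A] [Algebra ℂ A] [Nontrivial A] (n : ℕ) (F : A[X])
    (hF : F.Monic) (hd : F.natDegree = 2 * n) :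
    ∃ p : A[X], p.Monic ∧ p.natDegree = n ∧ (F - p ^ 2).degree < n := by
  have step : ∀ k ≤ n, ∃ p : A[X], p.Monic ∧ p.natDegree = n ∧
      (F - p ^ 2).degree < (2 * n - k : ℕ) := by
    intro k
    induction k with
    | zero =>
      intro _
      refine ⟨Polynomial.X ^ n, Polynomial.monic_X_pow n, Polynomial.natDegree_X_pow n, ?_⟩
      have hF0 : F.degree = ((2 * n : ℕ) : WithBot ℕ) := by
        rw [Polynomial.degree_eq_natDegree hF.ne_zero, hd]
      have hX : ((Polynomial.X ^ n) ^ 2 : A[X]) = Polynomial.X ^ (2 * n) := by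
        rw [← pow_mul, mul_comm]
      rw [hX, Nat.sub_zero, ← hF0]
      refine Polynomial.degree_sub_lt_left ?_ hF.ne_zero ?_
      · rw [hF0, Polynomial.degree_X_pow]
      · rw [hF.leadingCoeff, (Polynomial.monic_X_pow _).leadingCoeff]
    | succ k ih =>
      intro hk
      obtain ⟨p, hp, hpn, hlt⟩ := ih (by omega)
      obtain ⟨d, hd'⟩ : ∃ d, n = k + 1 + d := ⟨n - (k + 1), by omega⟩
      set c := (F - p ^ 2).coeff (2 * n - (k + 1)) with hc
      set b : A := algebraMap ℂ A (1 / 2) * c with hb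
      have hb2 : b + b = c := by
        rw [hb, ← add_mul, ← map_add]
        norm_num
      have hqd : (Polynomial.C b * Polynomial.X ^ d).degree < p.degree := by
        rw [Polynomial.degree_eq_natDegree hp.ne_zero, hpn]
        refine lt_of_le_of_lt (Polynomial.degree_C_mul_X_pow_le d b) ?_
        exact_mod_cast (by omega : d < n)
      refine ⟨p + Polynomial.C b * Polynomial.X ^ d, hp.add_of_left hqd, ?_, ?_⟩
      · rw [Polynomial.natDegree_add_eq_left_of_degree_lt hqd, hpn]
      · rw [Polynomial.degree_lt_iff_coeff_zero] at hlt ⊢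
        intro N hN
        have e : F - (p + Polynomial.C b * Polynomial.X ^ d) ^ 2 =
            (F - p ^ 2) - (Polynomial.C c * (p * Polynomial.X ^ d)) -
              Polynomial.C (b ^ 2) * Polynomial.X ^ (2 * d) := by
          rw [← hb2]
          simp only [map_add, map_pow]
          ring
        obtain ⟨M, hM⟩ : ∃ M, N = M + d := ⟨N - d, by omega⟩
        rw [e, Polynomial.coeff_sub, Polynomial.coeff_sub, Polynomial.coeff_C_mul_X_pow,
          if_neg (by omega), Polynomial.coeff_C_mul, hM, Polynomial.coeff_mul_X_pow, ← hM]
        rcases Nat.lt_or_ge N (2 * n - k) with h | h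
        · have hN' : N = 2 * n - (k + 1) := by omega
          have hM' : M = n := by omega
          rw [hM', ← hpn, hp.coeff_natDegree, hN', ← hc]
          ring
        · rw [hlt N h, Polynomial.coeff_eq_zero_of_natDegree_lt (by omega)]
          ring
  obtain ⟨p, h1, h2, h3⟩ := step n le_rfl
  refine ⟨p, h1, h2, ?_⟩
  rwa [show 2 * n - n = n by omega] at h3

theorem sqrt_unique {A : Type*} [CommRing A] [Algebra ℂ A] [Nontrivial A] (n : ℕ) (F p q : A[X])
    (hp : p.Monic) (hpn : p.natDegree = n) (hpF : (F - p ^ 2).degree < n)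
    (hq : q.Monic) (hqn : q.natDegree = n) (hqF : (F - q ^ 2).degree < n) : p = q := by
  by_contra hne
  have h2 : IsUnit (2 : A) := by
    have h := (IsUnit.mk0 (2 : ℂ) two_ne_zero).map (algebraMap ℂ A)
    rwa [map_ofNat] at h
  have hco : (p + q).coeff n = 2 := by
    rw [Polynomial.coeff_add]
    conv_lhs => rw [← hpn, hp.coeff_natDegree, hpn, ← hqn, hq.coeff_natDegree]
    norm_num
  have hs : (p + q).natDegree = n := by
    refine le_antisymm ?_ (Polynomial.le_natDegree_of_ne_zero (by rw [hco]; exact h2.ne_zero))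
    exact (Polynomial.natDegree_add_le _ _).trans (by rw [hpn, hqn, max_self])
  have hl : (p + q).leadingCoeff = 2 := by rw [Polynomial.leadingCoeff, hs, hco]
  have hpq : p - q ≠ 0 := sub_ne_zero.2 hne
  have hdeg : ((p - q) * (p + q)).degree = (p - q).degree + (p + q).degree := by
    refine Polynomial.degree_mul' ?_
    rw [hl]
    intro h0
    exact hpq (Polynomial.leadingCoeff_eq_zero.1 (h2.mul_left_eq_zero.1 h0))
  have hlt : ((p - q) * (p + q)).degree < n := by
    have e : (p - q) * (p + q) = (F - q ^ 2) - (F - p ^ 2) := by ring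
    rw [e]
    exact lt_of_le_of_lt (Polynomial.degree_sub_le _ _) (max_lt hqF hpF)
  have hs0 : p + q ≠ 0 := by
    intro h0
    rw [h0, Polynomial.coeff_zero] at hco
    exact h2.ne_zero hco.symm
  rw [hdeg, Polynomial.degree_eq_natDegree hs0, hs, Polynomial.degree_eq_natDegree hpq] at hlt
  have : (p - q).natDegree + n < n := by exact_mod_cast hlt
  omega

/-! ## The even Mumford system

The phase space `M'_g` (`n = g + 1`) is the affine space of triples
`u = x^g + ∑ u_i x^i`, `v = ∑ v_i x^i`, `w = x^(g+2) + ∑ w_i x^i`. -/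

/-- The coordinates `u_i`, `v_i` (`i < g`) and `w_i` (`i < g + 2`) on `M'_g`. -/
abbrev MVar (g : ℕ) : Type := Fin g ⊕ Fin g ⊕ Fin (g + 2)

/-- The ring of regular functions on `M'_g`. -/
abbrev OM (g : ℕ) : Type := MvPolynomial (MVar g) ℂ

def uM (g : ℕ) : (OM g)[X] :=
  Polynomial.X ^ g +
    ∑ i : Fin g, Polynomial.C (MvPolynomial.X (Sum.inl i)) * Polynomial.X ^ (i : ℕ)

def vM (g : ℕ) : (OM g)[X] :=
  ∑ i : Fin g, Polynomial.C (MvPolynomial.X (Sum.inr (Sum.inl i))) * Polynomial.X ^ (i : ℕ)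

def wM (g : ℕ) : (OM g)[X] :=
  Polynomial.X ^ (g + 2) +
    ∑ i : Fin (g + 2),
      Polynomial.C (MvPolynomial.X (Sum.inr (Sum.inr i))) * Polynomial.X ^ (i : ℕ)

/-- The momentum map `H = u w + v²`. -/
def momentumM (g : ℕ) : (OM g)[X] := uM g * wM g + vM g ^ 2

theorem sum_degree_lt {A : Type*} [CommRing A] (k : ℕ) (a : Fin k → A) :
    (∑ i : Fin k, Polynomial.C (a i) * Polynomial.X ^ (i : ℕ)).degree < (k : WithBot ℕ) := by
  refine lt_of_le_of_lt (Polynomial.degree_sum_le _ _) ?_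
  refine (Finset.sup_lt_iff (WithBot.bot_lt_coe k)).2 ?_
  intro i _
  exact lt_of_le_of_lt (Polynomial.degree_C_mul_X_pow_le _ _) (Nat.cast_lt.2 i.2)

theorem momentumM_monic (g : ℕ) :
    (momentumM g).Monic ∧ (momentumM g).natDegree = 2 * (g + 1) := by
  have hu : (uM g).Monic := Polynomial.monic_X_pow_add (sum_degree_lt g _)
  have hw : (wM g).Monic := Polynomial.monic_X_pow_add (sum_degree_lt (g + 2) _)
  have hun : (uM g).natDegree = g := by
    unfold uM
    rw [Polynomial.natDegree_add_eq_left_of_degree_lt, Polynomial.natDegree_X_pow]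
    rw [Polynomial.degree_X_pow]
    exact sum_degree_lt g _
  have hwn : (wM g).natDegree = g + 2 := by
    unfold wM
    rw [Polynomial.natDegree_add_eq_left_of_degree_lt, Polynomial.natDegree_X_pow]
    rw [Polynomial.degree_X_pow]
    exact sum_degree_lt (g + 2) _
  have hv : (vM g).degree < (g : WithBot ℕ) := sum_degree_lt g _
  have huw : (uM g * wM g).natDegree = 2 * (g + 1) := by
    rw [hu.natDegree_mul hw, hun, hwn]
    ring
  have hlt : (vM g ^ 2).degree < (uM g * wM g).degree := by
    rw [Polynomial.degree_eq_natDegree (hu.mul hw).ne_zero, huw]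
    rcases eq_or_ne (vM g) 0 with h0 | h0
    · rw [h0, zero_pow two_ne_zero, Polynomial.degree_zero]
      exact WithBot.bot_lt_coe _
    · rw [Polynomial.degree_eq_natDegree h0] at hv
      have hv' : (vM g).natDegree < g := by exact_mod_cast hv
      refine lt_of_le_of_lt Polynomial.degree_le_natDegree ?_
      have := Polynomial.natDegree_pow_le (p := vM g) (n := 2)
      exact_mod_cast (by omega : (vM g ^ 2).natDegree < 2 * (g + 1))
  exact ⟨(hu.mul hw).add_of_left hlt,
    by rw [momentumM, Polynomial.natDegree_add_eq_left_of_degree_lt hlt, huw]⟩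

/-- There is a monic polynomial `p` of degree `n = g + 1` with `deg (u w + v² - p²) < n`
(it is unique by `sqrt_unique`). -/
theorem exists_pM (g : ℕ) : ∃ p : (OM g)[X], p.Monic ∧ p.natDegree = g + 1 ∧
    (momentumM g - p ^ 2).degree < (g + 1 : ℕ) :=
  exists_sqrt (g + 1) (momentumM g) (momentumM_monic g).1 (momentumM_monic g).2

/-- The polynomial `p` in `u w + v² = p² + r`, with `p` monic of degree `n = g + 1`
and `deg r < n`. -/
def pM (g : ℕ) : (OM g)[X] := (exists_pM g).choose

/-- The coefficient `w_{g+1} - u_{g-1}` (for `1 ≤ g`) in `α(x) = x + w_{g+1} - u_{g-1}`. -/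
def alphaConst (g : ℕ) : OM g := (wM g).coeff (g + 1) - (uM g).coeff (g - 1)

/-- A constant `a ∈ A` as a polynomial in `x, x'`. -/
def const2 {A : Type*} [CommRing A] (a : A) : A[X][X] := Polynomial.C (Polynomial.C a)

/-- `α(x + x')`. -/
def alphaSum (g : ℕ) : (OM g)[X][X] := varX + varX' + const2 (alphaConst g)

/-- `α^φ(x + x')`, where `α^φ(x) = φ(α(2 x) / 2)`. -/
def alphaPhiSum (g : ℕ) (φ : ℂ[X]) : (OM g)[X][X] :=
  Polynomial.aeval ((1 / 2 : ℂ) • (2 * (varX + varX') + const2 (alphaConst g))) φ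

/-- A polynomial `φ ∈ ℂ[x]` viewed as a polynomial over the ring of functions. -/
def liftC {A : Type*} [CommRing A] [Algebra ℂ A] (φ : ℂ[X]) : A[X] := φ.map (algebraMap ℂ A)

/-! The right-hand sides of the formulas for the linear bracket `{·,·}_M^φ`; here the coefficients
of `φ` may depend on the phase variables. -/

def linUV (g : ℕ) (φ : (OM g)[X]) : (OM g)[X][X] :=
  divDiff (atX (uM g) * atX' φ - atX' (uM g) * atX φ)

def linUW (g : ℕ) (φ : (OM g)[X]) : (OM g)[X][X] :=
  -2 * divDiff (atX (vM g) * atX' φ - atX' (vM g) * atX φ)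

def linVW (g : ℕ) (φ : (OM g)[X]) : (OM g)[X][X] :=
  divDiff (atX (wM g) * atX' φ - atX' (wM g) * atX φ) - alphaSum g * atX (uM g) * atX' φ

def linWW (g : ℕ) (φ : (OM g)[X]) : (OM g)[X][X] :=
  2 * alphaSum g * (atX (vM g) * atX' φ - atX' (vM g) * atX φ)

/-! The right-hand sides of the formulas for the quadratic bracket `{·,·}_{M,q}^φ`. -/

def quadUV (g : ℕ) (φ : ℂ[X]) : (OM g)[X][X] :=
  linUV g (pM g * liftC φ) + alphaPhiSum g φ * atX (uM g) * atX' (uM g)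

def quadUW (g : ℕ) (φ : ℂ[X]) : (OM g)[X][X] :=
  linUW g (pM g * liftC φ) - 2 * alphaPhiSum g φ * atX (uM g) * atX' (vM g)

def quadVW (g : ℕ) (φ : ℂ[X]) : (OM g)[X][X] :=
  linVW g (pM g * liftC φ) + alphaPhiSum g φ * atX (uM g) * atX' (wM g)

def quadWW (g : ℕ) (φ : ℂ[X]) : (OM g)[X][X] :=
  linWW g (pM g * liftC φ) +
    2 * alphaPhiSum g φ * (atX (wM g) * atX' (vM g) - atX' (wM g) * atX (vM g))

/-- The brackets of the coordinates under `{·,·}_{M,q}^φ`, read off from the generating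
functions. -/
def quadPi (g : ℕ) (φ : ℂ[X]) : MVar g → MVar g → OM g
  | .inl _, .inl _ => 0
  | .inl i, .inr (.inl j) => ((quadUV g φ).coeff i).coeff j
  | .inl i, .inr (.inr j) => ((quadUW g φ).coeff i).coeff j
  | .inr (.inl i), .inl j => -((quadUV g φ).coeff j).coeff i
  | .inr (.inl _), .inr (.inl _) => 0
  | .inr (.inl i), .inr (.inr j) => ((quadVW g φ).coeff i).coeff j
  | .inr (.inr i), .inl j => -((quadUW g φ).coeff j).coeff i
  | .inr (.inr i), .inr (.inl j) => -((quadVW g φ).coeff j).coeff i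
  | .inr (.inr i), .inr (.inr j) => ((quadWW g φ).coeff i).coeff j

/-- The quadratic bracket `{·,·}_{M,q}^φ` on `M'_g`. -/
def quadBracket (g : ℕ) (φ : ℂ[X]) : OM g → OM g → OM g := polyBracket (quadPi g φ)

/-- The bracket `B` satisfies the formulas that define the quadratic bracket. -/
structure SatisfiesQuadFormulas (g : ℕ) (φ : ℂ[X]) (B : OM g → OM g → OM g) : Prop where
  uu : HasGenFun B (uM g) (uM g) 0
  vv : HasGenFun B (vM g) (vM g) 0
  uv : HasGenFun B (uM g) (vM g) (quadUV g φ)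
  uw : HasGenFun B (uM g) (wM g) (quadUW g φ)
  vw : HasGenFun B (vM g) (wM g) (quadVW g φ)
  ww : HasGenFun B (wM g) (wM g) (quadWW g φ)

/-- The Lax operator `(v, w; u, -v)`. -/
def laxM {A : Type*} [CommRing A] (u v w : A[X]) : Matrix (Fin 2) (Fin 2) A[X] :=
  !![v, w; u, -v]

/-- `X_y L(x) = [L(x), L(y) + (x - y) B(x, y)] / (x - y)` with
`B(x, y) = (0, α(x + y) u(y); 0, 0)`; the second variable is `y`. -/
def mumfordLax (g : ℕ) : Matrix (Fin 2) (Fin 2) (OM g)[X][X] :=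
  let Lx := (laxM (uM g) (vM g) (wM g)).map atX
  let Ly := (laxM (uM g) (vM g) (wM g)).map atX'
  let B : Matrix (Fin 2) (Fin 2) (OM g)[X][X] := !![0, alphaSum g * atX' (uM g); 0, 0]
  let N := Ly + (varX - varX' : (OM g)[X][X]) • B
  (Lx * N - N * Lx).map divDiff

/-- The Mumford vector fields: `mumfordField g f` is `X_y f`, a polynomial in `y`. -/
def mumfordField (g : ℕ) : Derivation ℂ (OM g) (OM g)[X] :=
  MvPolynomial.mkDerivation ℂ fun
    | .inl i => (mumfordLax g 1 0).coeff i
    | .inr (.inl i) => (mumfordLax g 0 0).coeff i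
    | .inr (.inr i) => (mumfordLax g 0 1).coeff i

/-! ## The hyperelliptic Prym systems

For `n = g + 1` odd, `P_{(n-1)/2}` is the space of triples in `M'_g` with `u, w` even and `v` odd;
for `n` even, `P'_{n/2-1}` is the space of triples in `M'_g` with `u, w` odd and `v` even. In both
cases `u, w` have the parity of `g` and `v` has the opposite parity. -/

/-- The coordinates of `M'_g` that are not identically zero on the Prym phase space. -/
def IsPrymVar (g : ℕ) : MVar g → Prop
  | .inl i => (i : ℕ) % 2 = g % 2
  | .inr (.inl i) => (i : ℕ) % 2 ≠ g % 2
  | .inr (.inr i) => (i : ℕ) % 2 = g % 2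

abbrev PVar (g : ℕ) : Type := {s : MVar g // IsPrymVar g s}

/-- The ring of regular functions on `P_{(n-1)/2}` (`n = g + 1` odd),
resp. `P'_{n/2-1}` (`n` even). -/
abbrev OP (g : ℕ) : Type := MvPolynomial (PVar g) ℂ

open scoped Classical in
/-- The restriction of functions from `M'_g` to the Prym phase space. -/
def restrictP (g : ℕ) : OM g →ₐ[ℂ] OP g :=
  MvPolynomial.aeval fun s => if h : IsPrymVar g s then MvPolynomial.X ⟨s, h⟩ else 0

/-- The action on functions of the involution `(u, v, w) ↦ ±(u(-x), -v(-x), w(-x))` of `M'_g`,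
with sign `(-1)^g`; its fixed point set is the Prym phase space. -/
def involutionM (g : ℕ) : OM g →ₐ[ℂ] OM g :=
  MvPolynomial.aeval fun s => match s with
    | .inl i => (-1) ^ (g + (i : ℕ)) * MvPolynomial.X (.inl i)
    | .inr (.inl i) => (-1) ^ (g + (i : ℕ) + 1) * MvPolynomial.X (.inr (.inl i))
    | .inr (.inr i) => (-1) ^ (g + (i : ℕ)) * MvPolynomial.X (.inr (.inr i))

/-- The bracket `B` on `M'_g` induces the bracket `BP` on the Prym phase space: the two agree on
the restrictions of functions that are invariant under the involution. -/
def InducesOnPrym (g : ℕ) (B : OM g → OM g → OM g) (BP : OP g → OP g → OP g) : Prop :=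
  ∀ F G, involutionM g F = F → involutionM g G = G →
    restrictP g (B F G) = BP (restrictP g F) (restrictP g G)

def uP (g : ℕ) : (OP g)[X] := (uM g).map (restrictP g).toRingHom

def vP (g : ℕ) : (OP g)[X] := (vM g).map (restrictP g).toRingHom

def wP (g : ℕ) : (OP g)[X] := (wM g).map (restrictP g).toRingHom

/-- The momentum map `H = u w + v²` on the Prym phase space. -/
def momentumP (g : ℕ) : (OP g)[X] := uP g * wP g + vP g ^ 2

/-- `X_y L(x) = [L(x), (y v(y), x w(y) + x (x² - y²) u(y); x u(y), -y v(y))] / (x² - y²)`;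
the second variable is `y`. -/
def prymLax (g : ℕ) : Matrix (Fin 2) (Fin 2) (OP g)[X][X] :=
  let Lx := (laxM (uP g) (vP g) (wP g)).map atX
  let N : Matrix (Fin 2) (Fin 2) (OP g)[X][X] :=
    !![varX' * atX' (vP g),
        varX * atX' (wP g) + varX * (varX ^ 2 - varX' ^ 2) * atX' (uP g);
      varX * atX' (uP g), -(varX' * atX' (vP g))]
  (Lx * N - N * Lx).map divDiffSq

/-- The Prym vector fields: `prymField g f` is `X_y f`, a polynomial in `y`. -/
def prymField (g : ℕ) : Derivation ℂ (OP g) (OP g)[X] :=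
  MvPolynomial.mkDerivation ℂ fun s => match s.1 with
    | .inl i => (prymLax g 1 0).coeff i
    | .inr (.inl i) => (prymLax g 0 0).coeff i
    | .inr (.inr i) => (prymLax g 0 1).coeff i

/-! ## The periodic Toda lattice with `n = g + 1` bodies

The phase space `T_n` has coordinates `a_i, b_i` (`i ∈ ℤ/n`), with `∏ a_i = 1`. -/

/-- The coordinates `a_i` (left) and `b_i` (right). -/
abbrev TVar (g : ℕ) : Type := ZMod (g + 1) ⊕ ZMod (g + 1)

/-- `∏ a_i`. -/
def todaCasimir (g : ℕ) : MvPolynomial (TVar g) ℂ :=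
  ∏ i : ZMod (g + 1), MvPolynomial.X (Sum.inl i)

/-- The ring of regular functions on `T_n`. -/
abbrev OT (g : ℕ) : Type := LevelRing (todaCasimir g)

def aT {g : ℕ} (i : ZMod (g + 1)) : OT g := Ideal.Quotient.mk _ (MvPolynomial.X (Sum.inl i))

def bT {g : ℕ} (i : ZMod (g + 1)) : OT g := Ideal.Quotient.mk _ (MvPolynomial.X (Sum.inr i))

/-- The Kronecker delta. -/
def kron {g : ℕ} (i j : ZMod (g + 1)) : MvPolynomial (TVar g) ℂ := if i = j then 1 else 0

/-- The brackets of the coordinates under `{·,·}_T^φ = φ₁ {·,·}_T^x + φ₀ {·,·}_T^1`: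
`{a_i, a_j}^x = a_i a_j (δ_{i,j+1} - δ_{i+1,j})`, `{b_i, b_j}^x = a_j δ_{i,j+1} - a_i δ_{i+1,j}`,
`{a_i, b_j}^x = a_i b_j (δ_{i,j} - δ_{i+1,j})` and `{a_i, b_j}^1 = a_i (δ_{i,j} - δ_{i+1,j})`. -/
def todaPi (g : ℕ) (φ : ℂ[X]) : TVar g → TVar g → MvPolynomial (TVar g) ℂ
  | .inl i, .inl j => MvPolynomial.C (φ.coeff 1) *
      (MvPolynomial.X (.inl i) * MvPolynomial.X (.inl j) * (kron i (j + 1) - kron (i + 1) j))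
  | .inl i, .inr j => MvPolynomial.X (.inl i) *
      (MvPolynomial.C (φ.coeff 1) * MvPolynomial.X (.inr j) + MvPolynomial.C (φ.coeff 0)) *
        (kron i j - kron (i + 1) j)
  | .inr j, .inl i => -(MvPolynomial.X (.inl i) *
      (MvPolynomial.C (φ.coeff 1) * MvPolynomial.X (.inr j) + MvPolynomial.C (φ.coeff 0)) *
        (kron i j - kron (i + 1) j))
  | .inr i, .inr j => MvPolynomial.C (φ.coeff 1) *
      (MvPolynomial.X (.inl j) * kron i (j + 1) - MvPolynomial.X (.inl i) * kron (i + 1) j)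

/-- The bracket `{·,·}_T^φ` on `T_n`. -/
def todaBracket (g : ℕ) (φ : ℂ[X]) : OT g → OT g → OT g :=
  levelBracket (todaCasimir g) (todaPi g φ)

theorem todaPi_skew (g : ℕ) (φ : ℂ[X]) (s t : TVar g) : todaPi g φ s t = -todaPi g φ t s := by
  have hδ : ∀ i j : ZMod (g + 1), kron i j = kron j i := fun i j => by simp only [kron, eq_comm]
  rcases s with i | i <;> rcases t with j | j <;> simp only [todaPi, neg_neg]
  · rw [hδ i (j + 1), hδ (i + 1) j]
    ring
  · rw [hδ i (j + 1), hδ (i + 1) j]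
    ring

theorem X_mul_pderiv_prod {σ ι : Type*} [Fintype ι] (e : ι → σ) (he : Function.Injective e)
    (i : ι) : MvPolynomial.X (e i) *
      MvPolynomial.pderiv (e i) (∏ k, (MvPolynomial.X (e k) : MvPolynomial σ ℂ)) =
        ∏ k, MvPolynomial.X (e k) := by
  classical
  rw [← Finset.mul_prod_erase Finset.univ _ (Finset.mem_univ i), Derivation.leibniz,
    MvPolynomial.pderiv_X_self]
  have h : MvPolynomial.pderiv (e i)
      (∏ k ∈ Finset.univ.erase i, (MvPolynomial.X (e k) : MvPolynomial σ ℂ)) = 0 := by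
    refine Finset.prod_induction _ (fun q => MvPolynomial.pderiv (e i) q = 0) ?_ (by simp) ?_
    · intro a b ha hb
      rw [Derivation.leibniz, ha, hb, smul_zero, smul_zero, add_zero]
    · intro k hk
      exact MvPolynomial.pderiv_X_of_ne fun h => (Finset.ne_of_mem_erase hk) (he h)
  rw [h]
  simp

theorem pderiv_prod_eq_zero {σ ι : Type*} [Fintype ι] (e : ι → σ) (s : σ) (hs : ∀ k, e k ≠ s) :
    MvPolynomial.pderiv s (∏ k, (MvPolynomial.X (e k) : MvPolynomial σ ℂ)) = 0 := by
  refine Finset.prod_induction _ (fun q => MvPolynomial.pderiv s q = 0) ?_ (by simp) ?_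
  · intro a b ha hb
    rw [Derivation.leibniz, ha, hb, smul_zero, smul_zero, add_zero]
  · intro k _
    exact MvPolynomial.pderiv_X_of_ne (hs k)

theorem todaCasimir_bracket (g : ℕ) (φ : ℂ[X]) (f : MvPolynomial (TVar g) ℂ) :
    polyBracket (todaPi g φ) (todaCasimir g) f = 0 := by
  unfold polyBracket
  rw [Finset.sum_comm]
  refine Finset.sum_eq_zero fun t _ => ?_
  rw [← Finset.sum_mul]
  refine mul_eq_zero_of_left ?_ _
  rw [Fintype.sum_sum_type]
  have h0 : ∀ i : ZMod (g + 1),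
      MvPolynomial.pderiv (Sum.inr i : TVar g) (todaCasimir g) = 0 := fun i =>
    pderiv_prod_eq_zero (fun k : ZMod (g + 1) => (Sum.inl k : TVar g)) _ fun k => by simp
  have h1 : ∀ i : ZMod (g + 1), MvPolynomial.X (Sum.inl i) *
      MvPolynomial.pderiv (Sum.inl i : TVar g) (todaCasimir g) = todaCasimir g := fun i =>
    X_mul_pderiv_prod (fun k : ZMod (g + 1) => (Sum.inl k : TVar g)) Sum.inl_injective i
  have hs : ∀ j : ZMod (g + 1), ∑ i : ZMod (g + 1), (kron i j : MvPolynomial (TVar g) ℂ) = 1 := by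
    intro j
    simp [kron]
  have hs' : ∀ j : ZMod (g + 1),
      ∑ i : ZMod (g + 1), (kron (i + 1) j : MvPolynomial (TVar g) ℂ) = 1 := by
    intro j
    rw [← hs j]
    exact Equiv.sum_comp (Equiv.addRight (1 : ZMod (g + 1)))
      fun i => (kron i j : MvPolynomial (TVar g) ℂ)
  simp only [h0, mul_zero, Finset.sum_const_zero, add_zero]
  rcases t with j | j
  · calc _ = ∑ i : ZMod (g + 1), MvPolynomial.C (φ.coeff 1) * MvPolynomial.X (.inl j) *
          todaCasimir g * (kron i (j + 1) - kron (i + 1) j) := by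
          refine Finset.sum_congr rfl fun i _ => ?_
          simp only [todaPi]
          linear_combination (MvPolynomial.C (φ.coeff 1) * MvPolynomial.X (.inl j) * (kron i (j + 1) - kron (i + 1) j)) * h1 i
      _ = 0 := by rw [← Finset.mul_sum, Finset.sum_sub_distrib, hs, hs', sub_self, mul_zero]
  · calc _ = ∑ i : ZMod (g + 1), (MvPolynomial.C (φ.coeff 1) * MvPolynomial.X (.inr j) +
          MvPolynomial.C (φ.coeff 0)) * todaCasimir g * (kron i j - kron (i + 1) j) := by
          refine Finset.sum_congr rfl fun i _ => ?_
          simp only [todaPi]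
          linear_combination ((MvPolynomial.C (φ.coeff 1) * MvPolynomial.X (.inr j) + MvPolynomial.C (φ.coeff 0)) *
            (kron i j - kron (i + 1) j)) * h1 i
      _ = 0 := by rw [← Finset.mul_sum, Finset.sum_sub_distrib, hs, hs', sub_self, mul_zero]

/-- `todaBracket` is well defined. -/
theorem todaBracket_mk (g : ℕ) (φ : ℂ[X]) (f f' : MvPolynomial (TVar g) ℂ) :
    todaBracket g φ (Ideal.Quotient.mk _ f) (Ideal.Quotient.mk _ f') =
      Ideal.Quotient.mk _ (polyBracket (todaPi g φ) f f') :=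
  levelBracket_mk _ _ (todaPi_skew g φ) (todaCasimir_bracket g φ) f f'

/-- The Lax operator `L(h)`: its entries are `b_i` at `(i, i)`, `a_i` at `(i, i + 1)` and `1` at
`(i + 1, i)` for the non-cyclic neighbours, and `h a_n` at `(n, 1)`, `h⁻¹` at `(1, n)`
(for `n = 2` entries at the same place are added). The index `n` is `0 ∈ ℤ/n`. -/
def todaLax (g : ℕ) (h : ℂ) : Matrix (ZMod (g + 1)) (ZMod (g + 1)) (OT g) := fun i j =>
  (if i = j then bT i else 0) +
  (if j = i + 1 then (if i = 0 then h • aT i else aT i) else 0) +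
  (if i = j + 1 then (if j = 0 then algebraMap ℂ (OT g) h⁻¹ else 1) else 0)

/-- The momentum map `K`, defined by `det (x - L(h)) = - h - 1/h + K(x) / 2`
(its value does not depend on `h ≠ 0`). -/
def momentumT (g : ℕ) (h : ℂ) : (OT g)[X] :=
  2 * ((todaLax g h).charpoly + Polynomial.C (algebraMap ℂ (OT g) (h + h⁻¹)))

/-- The Hamiltonians `I_i = tr L(h)^(i+1) / (i+1)` for `0 ≤ i ≤ n - 2`, and
`I_{n-1} = tr L(h)^n / n - h - 1/h` (the values do not depend on `h ≠ 0`). -/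
def todaHam (g : ℕ) (h : ℂ) (i : ℕ) : OT g :=
  (1 / (i + 1) : ℂ) • (todaLax g h ^ (i + 1)).trace -
    (if i = g then algebraMap ℂ (OT g) (h + h⁻¹) else 0)

/-- The matrix `x - L(h)` without the two entries that link the indices `m` and `m + 1`. For
`m = n` these are the two entries that contain `h`; the general case is obtained from this one by
the cyclic action of `ℤ/n`. -/
def todaTri (g : ℕ) (m : ZMod (g + 1)) :
    Matrix (ZMod (g + 1)) (ZMod (g + 1)) (OT g)[X] := fun i j =>
  (if i = j then Polynomial.X - Polynomial.C (bT i) else 0) -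
  (if j = i + 1 ∧ i ≠ m then Polynomial.C (aT i) else 0) -
  (if i = j + 1 ∧ j ≠ m then 1 else 0)

/-- The minor `Δ` of `todaTri` obtained by removing the rows and columns in the list `l`;
it is `0` by convention when `l` has repetitions (this occurs only for `Δ_{m-1,m,m+1}` and
`n = 2`). -/
def todaMinor (g : ℕ) (m : ZMod (g + 1)) (l : List (ZMod (g + 1))) : (OT g)[X] :=
  if l.Nodup then
    ((todaTri g m).submatrix (Subtype.val : {i // i ∉ l} → ZMod (g + 1)) Subtype.val).det
  else 0

/-! The polynomials `u`, `v`, `w` that define the map `Φ_m`. -/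

def uPhi (g : ℕ) (m : ZMod (g + 1)) : (OT g)[X] := todaMinor g m [m]

def vPhi (g : ℕ) (m : ZMod (g + 1)) : (OT g)[X] :=
  Polynomial.C (aT m) * todaMinor g m [m, m + 1] -
    Polynomial.C (aT (m - 1)) * todaMinor g m [m - 1, m]

def wPhi (g : ℕ) (m : ZMod (g + 1)) : (OT g)[X] :=
  (Polynomial.X - Polynomial.C (bT m)) ^ 2 * todaMinor g m [m] -
    2 * (Polynomial.X - Polynomial.C (bT m)) *
      (Polynomial.C (aT (m - 1)) * todaMinor g m [m - 1, m] +
        Polynomial.C (aT m) * todaMinor g m [m, m + 1]) +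
    4 * Polynomial.C (aT m * aT (m - 1)) * todaMinor g m [m - 1, m, m + 1]

/-- The comorphism `f ↦ f ∘ Φ_m` of `Φ_m : T_n → M'_{n-1}`. -/
def phiT (g : ℕ) (m : ZMod (g + 1)) : OM g →ₐ[ℂ] OT g :=
  MvPolynomial.aeval fun s => match s with
    | .inl i => (uPhi g m).coeff i
    | .inr (.inl i) => (vPhi g m).coeff i
    | .inr (.inr i) => (wPhi g m).coeff i

/-! ## The periodic Kac-van Moerbeke system with `n = g + 1` bodies

The phase space `K_n` is the subspace `b = 0` of `T_n`. -/

/-- `∏ a_i`. -/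
def kmCasimir (g : ℕ) : MvPolynomial (ZMod (g + 1)) ℂ := ∏ i : ZMod (g + 1), MvPolynomial.X i

/-- The ring of regular functions on `K_n`. -/
abbrev OK (g : ℕ) : Type := LevelRing (kmCasimir g)

/-- `{a_i, a_j}_K = a_i a_j (δ_{i,j+1} - δ_{i+1,j})`. -/
def kmPi (g : ℕ) (i j : ZMod (g + 1)) : MvPolynomial (ZMod (g + 1)) ℂ :=
  MvPolynomial.X i * MvPolynomial.X j *
    ((if i = j + 1 then 1 else 0) - (if i + 1 = j then 1 else 0))

/-- The bracket `{·,·}_K` on `K_n`. -/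
def kmBracket (g : ℕ) : OK g → OK g → OK g := levelBracket (kmCasimir g) (kmPi g)

theorem kmPi_skew (g : ℕ) (i j : ZMod (g + 1)) : kmPi g i j = -kmPi g j i := by
  simp only [kmPi, eq_comm (a := j) (b := i + 1), eq_comm (a := j + 1) (b := i)]
  ring

theorem kmCasimir_bracket (g : ℕ) (f : MvPolynomial (ZMod (g + 1)) ℂ) :
    polyBracket (kmPi g) (kmCasimir g) f = 0 := by
  unfold polyBracket
  rw [Finset.sum_comm]
  refine Finset.sum_eq_zero fun j _ => ?_
  rw [← Finset.sum_mul]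
  refine mul_eq_zero_of_left ?_ _
  have h1 : ∀ i : ZMod (g + 1), MvPolynomial.X i *
      MvPolynomial.pderiv i (kmCasimir g) = kmCasimir g := fun i =>
    X_mul_pderiv_prod (fun k : ZMod (g + 1) => k) Function.injective_id i
  have hs : ∀ j : ZMod (g + 1), ∑ i : ZMod (g + 1),
      (if i = j then 1 else 0 : MvPolynomial (ZMod (g + 1)) ℂ) = 1 := by
    intro j
    simp
  have hs' : ∀ j : ZMod (g + 1), ∑ i : ZMod (g + 1),
      (if i + 1 = j then 1 else 0 : MvPolynomial (ZMod (g + 1)) ℂ) = 1 := by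
    intro j
    exact (Equiv.sum_comp (Equiv.addRight (1 : ZMod (g + 1)))
      fun i => (if i = j then 1 else 0 : MvPolynomial (ZMod (g + 1)) ℂ)).trans (hs j)
  calc _ = ∑ i : ZMod (g + 1), MvPolynomial.X j * kmCasimir g *
        ((if i = j + 1 then 1 else 0) - (if i + 1 = j then 1 else 0)) := by
        refine Finset.sum_congr rfl fun i _ => ?_
        simp only [kmPi]
        linear_combination (MvPolynomial.X j * ((if i = j + 1 then 1 else 0) - (if i + 1 = j then 1 else 0))) * h1 i
    _ = 0 := by rw [← Finset.mul_sum, Finset.sum_sub_distrib, hs, hs', sub_self, mul_zero]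

/-- `kmBracket` is well defined. -/
theorem kmBracket_mk (g : ℕ) (f f' : MvPolynomial (ZMod (g + 1)) ℂ) :
    kmBracket g (Ideal.Quotient.mk _ f) (Ideal.Quotient.mk _ f') =
      Ideal.Quotient.mk _ (polyBracket (kmPi g) f f') :=
  levelBracket_mk _ _ (kmPi_skew g) (kmCasimir_bracket g) f f'

/-- The restriction of functions from `T_n` to `K_n`: `a_i ↦ a_i`, `b_i ↦ 0`. -/
def restrictK (g : ℕ) : OT g →ₐ[ℂ] OK g :=
  Ideal.Quotient.liftₐ (Ideal.span {todaCasimir g - 1})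
    (MvPolynomial.aeval fun s : TVar g => match s with
      | .inl i => (Ideal.Quotient.mk _ (MvPolynomial.X i) : OK g)
      | .inr _ => 0) (by
    intro f hf
    obtain ⟨k, rfl⟩ := Ideal.mem_span_singleton'.1 hf
    rw [map_mul, map_sub, map_one, todaCasimir, map_prod]
    simp only [MvPolynomial.aeval_X]
    rw [← map_prod, ← map_one (Ideal.Quotient.mk (Ideal.span {kmCasimir g - 1})), ← map_sub]
    have h0 : (Ideal.Quotient.mk (Ideal.span {kmCasimir g - 1})) (kmCasimir g - 1) = 0 :=
      Ideal.Quotient.eq_zero_iff_mem.2 (Ideal.subset_span rfl)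
    rw [kmCasimir] at h0
    exact mul_eq_zero_of_right _ h0)

/-- The comorphism of the restriction of `Φ_m` to a map from `K_n` to the Prym phase space. -/
def phiK (g : ℕ) (m : ZMod (g + 1)) : OP g →ₐ[ℂ] OK g :=
  MvPolynomial.aeval fun s => restrictK g (phiT g m (MvPolynomial.X s.1))

end

end PrymToda

open PrymToda

/-! Write n = g + 1 and d = α(0)/2. The pivot of the proof is the square root p of H. For f one of
u(s), v(s), w(s) the defining formulas give (s - y){f, H(y)} = φ(y) p(y) E(y), where E is a
polynomial that vanishes at y = s; here E(y)/(s - y) is the Mumford derivative X_y f. Since H = p² +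
r, the left side is also (s - y)(2 p {f, p} + {f, r}), so p divides {f, r(y)} as a polynomial in y.
As deg r < deg p and p is monic, {f, r} = 0. Hence r consists of Casimirs, 2{f, p(y)} = φ(y) X_y f,
and the values of p commute (`sqrt_derivation`, `qad_r`, `qad_p_p`, `quadBracket_two_pM`).

Jacobi identity. The Jacobiator is a derivation in each argument. A derivation is determined by its
values on u, v and H, because u is monic and w can be recovered from H; and H may be replaced by p,
because r is Casimir. On u, v, p all brackets are explicit; those with d come from the leading
coefficients, through p_g = u_{g-1} + d. For values of u, v, p at three distinct points the Jacobi
identity becomes an identity of rational functions (`qad_jacobi_uuv` to `qad_jacobi_vpp`,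
`jacobiator_eq_zero`).

Toda side. The minors are continuants, and U = Δ_m, V = a_{m-1} Δ_{m-1,m}, W = a_m Δ_{m,m+1}, Z =
a_m a_{m-1} Δ_{m-1,m,m+1} are the entries of a product of 2 × 2 transfer matrices. Their quadratic
brackets are found by appending one site after the other (`chain_relations`). The determinant UZ -
VW = -∏ a_i = -1 yields H ∘ Φ_m = (K/2)² - 4, so that uniqueness of the square root gives p ∘ Φ_m =
K/2 (`phiT_hAt`, `map_pM`). The Poisson property then has to be compared only on u, v, p
(`isPoissonMap_phiT`), and the statement on flows follows from 2{f, p} = φ X f. Newton's identities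
write the I_i as polynomials in the coefficients of p, which in turn are polynomials in those of H
(`exists_todaHam`, `coeff_pM_mem`).

Prym side. P and K_n are the fixed loci of involutions acting on the coordinates by signs. An
invariant function has zero derivative along the anti-invariant coordinates on the fixed locus, so
the bracket of invariant functions restricts (`restrict_polyBracket`). For odd φ the involution of
M'_g is Poisson, which gives the Jacobi identity on P. Φ_m intertwines it with b ↦ -b
(`involutionT_phiT`), and the Prym fields are the restrictions of the Mumford fields
(`prymField_eq`).

Throughout, generating functions are compared through their values at distinct complex numbers,
whose differences are units in every ℂ-algebra. -/

namespace PrymToda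

open Polynomial

/-! ## Evaluation at complex scalars -/

/-- The value `P(s) ∈ A` of a polynomial with coefficients in `A` at a complex number `s`. -/
noncomputable def evalAt {A : Type*} [CommRing A] [Algebra ℂ A] (P : A[X]) (s : ℂ) : A :=
  P.eval (algebraMap ℂ A s)

/-- The value `G(s, t) ∈ A` of a polynomial in `x, x'` at complex numbers. -/
noncomputable def evalAt₂ {A : Type*} [CommRing A] [Algebra ℂ A] (G : A[X][X]) (s t : ℂ) : A :=
  evalAt (G.eval (C (algebraMap ℂ A s))) t

section Eval

variable {A A' : Type*} [CommRing A] [Algebra ℂ A] [CommRing A'] [Algebra ℂ A']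

@[simp] theorem evalAt_add (P Q : A[X]) (s : ℂ) : evalAt (P + Q) s = evalAt P s + evalAt Q s :=
  eval_add
@[simp] theorem evalAt_sub (P Q : A[X]) (s : ℂ) : evalAt (P - Q) s = evalAt P s - evalAt Q s :=
  eval_sub _ _ _
@[simp] theorem evalAt_neg (P : A[X]) (s : ℂ) : evalAt (-P) s = -evalAt P s := eval_neg _ _
@[simp] theorem evalAt_mul (P Q : A[X]) (s : ℂ) : evalAt (P * Q) s = evalAt P s * evalAt Q s :=
  eval_mul
@[simp] theorem evalAt_pow (P : A[X]) (k : ℕ) (s : ℂ) : evalAt (P ^ k) s = evalAt P s ^ k :=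
  eval_pow _
@[simp] theorem evalAt_X (s : ℂ) : evalAt (X : A[X]) s = algebraMap ℂ A s := eval_X
@[simp] theorem evalAt_C (a : A) (s : ℂ) : evalAt (C a) s = a := eval_C
@[simp] theorem evalAt_one (s : ℂ) : evalAt (1 : A[X]) s = 1 := eval_one
@[simp] theorem evalAt_zero (s : ℂ) : evalAt (0 : A[X]) s = 0 := eval_zero
@[simp] theorem evalAt_ofNat (k : ℕ) [k.AtLeastTwo] (s : ℂ) :
    evalAt (OfNat.ofNat k : A[X]) s = OfNat.ofNat k := eval_ofNat _ _
theorem evalAt_sum {ι : Type*} (S : Finset ι) (P : ι → A[X]) (s : ℂ) :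
    evalAt (∑ i ∈ S, P i) s = ∑ i ∈ S, evalAt (P i) s := eval_finsetSum _ _ _
theorem evalAt_map (ψ : A →ₐ[ℂ] A') (P : A[X]) (s : ℂ) :
    evalAt (P.map ψ.toRingHom) s = ψ (evalAt P s) := by
  have h := eval_map_apply (f := ψ.toRingHom) (p := P) (algebraMap ℂ A s)
  simpa [evalAt] using h
theorem evalAt_liftC (φ : ℂ[X]) (s : ℂ) :
    evalAt (liftC φ : A[X]) s = algebraMap ℂ A (φ.eval s) := by
  rw [evalAt, liftC, eval_map_algebraMap, aeval_algebraMap_apply_eq_algebraMap_eval]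

@[simp] theorem evalAt₂_add (P Q : A[X][X]) (s t : ℂ) :
    evalAt₂ (P + Q) s t = evalAt₂ P s t + evalAt₂ Q s t := by simp [evalAt₂]
@[simp] theorem evalAt₂_sub (P Q : A[X][X]) (s t : ℂ) :
    evalAt₂ (P - Q) s t = evalAt₂ P s t - evalAt₂ Q s t := by simp [evalAt₂]
@[simp] theorem evalAt₂_neg (P : A[X][X]) (s t : ℂ) :
    evalAt₂ (-P) s t = -evalAt₂ P s t := by simp [evalAt₂]
@[simp] theorem evalAt₂_mul (P Q : A[X][X]) (s t : ℂ) :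
    evalAt₂ (P * Q) s t = evalAt₂ P s t * evalAt₂ Q s t := by simp [evalAt₂]
@[simp] theorem evalAt₂_pow (P : A[X][X]) (k : ℕ) (s t : ℂ) :
    evalAt₂ (P ^ k) s t = evalAt₂ P s t ^ k := by simp [evalAt₂]
@[simp] theorem evalAt₂_zero (s t : ℂ) : evalAt₂ (0 : A[X][X]) s t = 0 := by simp [evalAt₂]
@[simp] theorem evalAt₂_one (s t : ℂ) : evalAt₂ (1 : A[X][X]) s t = 1 := by simp [evalAt₂]
@[simp] theorem evalAt₂_ofNat (k : ℕ) [k.AtLeastTwo] (s t : ℂ) :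
    evalAt₂ (OfNat.ofNat k : A[X][X]) s t = OfNat.ofNat k := by
  rw [evalAt₂, eval_ofNat, evalAt_ofNat]
@[simp] theorem evalAt₂_atX (P : A[X]) (s t : ℂ) : evalAt₂ (atX P) s t = evalAt P s := by
  have h := eval_map_apply (f := (C : A →+* A[X])) (p := P) (algebraMap ℂ A s)
  rw [evalAt₂, atX, h, evalAt_C, evalAt]
@[simp] theorem evalAt₂_atX' (P : A[X]) (s t : ℂ) : evalAt₂ (atX' P) s t = evalAt P t := by
  simp [evalAt₂, atX']
@[simp] theorem evalAt₂_varX (s t : ℂ) : evalAt₂ (varX : A[X][X]) s t = algebraMap ℂ A s := by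
  simp [evalAt₂, varX]
@[simp] theorem evalAt₂_varX' (s t : ℂ) : evalAt₂ (varX' : A[X][X]) s t = algebraMap ℂ A t := by
  simp [evalAt₂, varX']
@[simp] theorem evalAt₂_const2 (a : A) (s t : ℂ) : evalAt₂ (const2 a) s t = a := by
  simp [evalAt₂, const2]

/-- A polynomial that vanishes at all but finitely many complex scalars is zero. -/
theorem eq_zero_of_evalAt (F : Finset ℂ) (P : A[X]) (h : ∀ s ∉ F, evalAt P s = 0) : P = 0 := by
  ext i
  -- `A` may have zero divisors, so roots cannot be counted over `A`. Linear functionals separate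
  -- its points, and applied to the coefficients they give complex polynomials with infinitely many
  -- roots.
  rw [coeff_zero, ← Module.forall_dual_apply_eq_zero_iff ℂ]
  intro l
  set Q : ℂ[X] := ∑ i ∈ Finset.range (P.natDegree + 1), monomial i (l (P.coeff i)) with hQ
  have hQe : ∀ s, Q.eval s = l (evalAt P s) := by
    intro s
    rw [hQ, evalAt, eval_finsetSum, eval_eq_sum_range, map_sum]
    refine Finset.sum_congr rfl fun i _ => ?_
    rw [eval_monomial, ← map_pow, mul_comm (P.coeff i), ← Algebra.smul_def, map_smul, smul_eq_mul,
      mul_comm]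
  have hQ0 : Q = 0 := by
    refine eq_zero_of_infinite_isRoot Q (Set.Infinite.mono ?_ (F.finite_toSet.infinite_compl))
    intro s hs
    show Q.eval s = 0
    rw [hQe, h s (by simpa using hs), map_zero]
  have hc : Q.coeff i = l (P.coeff i) := by
    rw [hQ, finsetSum_coeff]
    simp only [coeff_monomial, Finset.sum_ite_eq', Finset.mem_range]
    split_ifs with hi
    · rfl
    · rw [coeff_eq_zero_of_natDegree_lt (by omega), map_zero]
  rw [← hc, hQ0, coeff_zero]

theorem eq_of_evalAt (F : Finset ℂ) {P Q : A[X]} (h : ∀ s ∉ F, evalAt P s = evalAt Q s) :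
    P = Q := by
  rw [← sub_eq_zero]
  refine eq_zero_of_evalAt F _ fun s hs => ?_
  rw [evalAt_sub, h s hs, sub_self]

/-- The exceptional set may depend on the first point. This allows the diagonal s = t to be left out
when denominators x - x' occur. -/
theorem eq_of_evalAt₂ (F : ℂ → Finset ℂ) {P Q : A[X][X]}
    (h : ∀ s, ∀ t ∉ F s, evalAt₂ P s t = evalAt₂ Q s t) : P = Q :=
  eq_of_evalAt ∅ fun s _ => eq_of_evalAt (F s) fun t ht => h s t ht

theorem algebraMap_sub_isUnit {s t : ℂ} (h : s ≠ t) :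
    IsUnit (algebraMap ℂ A s - algebraMap ℂ A t) := by
  rw [← map_sub]
  exact (IsUnit.mk0 _ (sub_ne_zero.2 h)).map _

theorem sub_mul_cancel {s t : ℂ} (h : s ≠ t) {a b : A}
    (hab : (algebraMap ℂ A s - algebraMap ℂ A t) * a =
      (algebraMap ℂ A s - algebraMap ℂ A t) * b) : a = b :=
  (algebraMap_sub_isUnit h).mul_left_cancel hab

/-- Vanishing on the diagonal means that x' is a root of F as a polynomial in x, so the division by
the monic x - x' is exact. -/
theorem evalAt₂_divDiff (F : A[X][X]) (hF : ∀ s, evalAt₂ F s s = 0) (s t : ℂ) :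
    (algebraMap ℂ A s - algebraMap ℂ A t) * evalAt₂ (divDiff F) s t = evalAt₂ F s t := by
  have h0 : F.eval X = 0 := by
    refine eq_zero_of_evalAt ∅ _ fun s _ => ?_
    rw [← hF s]
    have h : (evalRingHom (algebraMap ℂ A s)).comp (evalRingHom (X : A[X])) =
        (evalRingHom (algebraMap ℂ A s)).comp (evalRingHom (C (algebraMap ℂ A s))) := by
      refine ringHom_ext' ?_ ?_
      · ext <;> simp
      · simp
    exact DFunLike.congr_fun h F
  have h1 := mul_divByMonic_eq_iff_isRoot.2 (show F.IsRoot X from h0)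
  have h2 := congrArg (fun G => evalAt₂ G s t) h1
  simpa [divDiff, evalAt₂] using h2

/-- The polynomial with coefficients `D(P_i)`. -/
noncomputable def coeffMap (D : A →ₗ[ℂ] A') (P : A[X]) : A'[X] :=
  ∑ i ∈ Finset.range (P.natDegree + 1), monomial i (D (P.coeff i))

@[simp] theorem coeff_coeffMap (D : A →ₗ[ℂ] A') (P : A[X]) (i : ℕ) :
    (coeffMap D P).coeff i = D (P.coeff i) := by
  rw [coeffMap, finsetSum_coeff]
  simp only [coeff_monomial, Finset.sum_ite_eq', Finset.mem_range]
  split_ifs with hi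
  · rfl
  · rw [coeff_eq_zero_of_natDegree_lt (by omega), map_zero]

@[simp] theorem evalAt_coeffMap (D : A →ₗ[ℂ] A') (P : A[X]) (s : ℂ) :
    evalAt (coeffMap D P) s = D (evalAt P s) := by
  rw [coeffMap, evalAt, evalAt, eval_finsetSum, eval_eq_sum_range, map_sum]
  refine Finset.sum_congr rfl fun i _ => ?_
  rw [eval_monomial, ← map_pow, ← map_pow, mul_comm (P.coeff i), ← Algebra.smul_def, map_smul,
    Algebra.smul_def, mul_comm]

/-- This lets a linear map be tested on values P(s) instead of on the coefficients, which are the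
actual coordinates; finitely many s may be skipped. -/
theorem map_coeff_eq_zero (F : Finset ℂ) (D : A →ₗ[ℂ] A') (P : A[X])
    (h : ∀ s ∉ F, D (evalAt P s) = 0) (i : ℕ) : D (P.coeff i) = 0 := by
  have h0 : coeffMap D P = 0 := eq_zero_of_evalAt F _ fun s hs => by
    rw [evalAt_coeffMap, h s hs]
  rw [← coeff_coeffMap, h0, coeff_zero]

end Eval

/-! ## Biderivations -/

/-- A skew-symmetric biderivation. -/
structure IsBiderivation {A : Type*} [CommRing A] [Algebra ℂ A] (B : A → A → A) : Prop where
  add_left : ∀ f g h, B (f + g) h = B f h + B g h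
  smul_left : ∀ (c : ℂ) f g, B (c • f) g = c • B f g
  skew : ∀ f g, B f g = -B g f
  leibniz : ∀ f g h, B (f * g) h = f * B g h + g * B f h

section Bider

variable {A A' : Type*} [CommRing A] [Algebra ℂ A] [CommRing A'] [Algebra ℂ A']
  {B : A → A → A}

/-- The derivation `{f, ·}`. -/
noncomputable def IsBiderivation.ad (hB : IsBiderivation B) (f : A) : Derivation ℂ A A :=
  Derivation.mk'
    { toFun := B f
      map_add' := fun g h => by
        rw [hB.skew, hB.add_left, hB.skew f g, hB.skew f h]; ring
      map_smul' := fun c g => by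
        rw [hB.skew, hB.smul_left, hB.skew f g, RingHom.id_apply, smul_neg] }
    fun g h => by
      simp only [LinearMap.coe_mk, AddHom.coe_mk, smul_eq_mul]
      rw [hB.skew, hB.leibniz, hB.skew f g, hB.skew f h]; ring

theorem IsBiderivation.ad_apply (hB : IsBiderivation B) (f g : A) : hB.ad f g = B f g := rfl

theorem IsBiderivation.ad_skew (hB : IsBiderivation B) (f g : A) : hB.ad f g = -hB.ad g f :=
  hB.skew f g

theorem IsBiderivation.self (hB : IsBiderivation B) (f : A) : hB.ad f f = 0 := by
  have h := hB.ad_skew f f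
  have h2 : (2 : ℂ) • hB.ad f f = 0 := by
    rw [two_smul]; nth_rewrite 1 [h]; ring
  exact (smul_eq_zero_iff_right (two_ne_zero)).1 h2

theorem isBiderivation_polyBracket {σ : Type*} [Fintype σ] (π : σ → σ → MvPolynomial σ ℂ)
    (hπ : ∀ i j, π i j = -π j i) : IsBiderivation (polyBracket π) where
  add_left f g h := by
    simp only [polyBracket, map_add, mul_add, add_mul, Finset.sum_add_distrib]
  smul_left c f g := by
    have e : ∀ i, MvPolynomial.pderiv i (c • f) = c • MvPolynomial.pderiv i f := fun i =>
      Derivation.map_smul _ _ _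
    simp only [polyBracket, e, Finset.smul_sum, mul_smul_comm, smul_mul_assoc]
  skew := polyBracket_skew π hπ
  leibniz := polyBracket_mul_left π

theorem polyBracket_X {σ : Type*} [Fintype σ] (π : σ → σ → MvPolynomial σ ℂ) (i j : σ) :
    polyBracket π (MvPolynomial.X i) (MvPolynomial.X j) = π i j := by
  classical
  simp [polyBracket, MvPolynomial.pderiv_X, Pi.single_apply]

theorem isBiderivation_levelBracket {σ : Type*} [Fintype σ] (c : MvPolynomial σ ℂ)
    (π : σ → σ → MvPolynomial σ ℂ) (hπ : ∀ i j, π i j = -π j i)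
    (hc : ∀ f, polyBracket π c f = 0) : IsBiderivation (levelBracket c π) := by
  have h := isBiderivation_polyBracket π hπ
  refine ⟨fun f g k => ?_, fun z f g => ?_, fun f g => ?_, fun f g k => ?_⟩
  · obtain ⟨f, rfl⟩ := Ideal.Quotient.mk_surjective f
    obtain ⟨g, rfl⟩ := Ideal.Quotient.mk_surjective g
    obtain ⟨k, rfl⟩ := Ideal.Quotient.mk_surjective k
    rw [← map_add]
    simp only [levelBracket_mk c π hπ hc]
    rw [h.add_left, map_add]
  · obtain ⟨f, rfl⟩ := Ideal.Quotient.mk_surjective f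
    obtain ⟨g, rfl⟩ := Ideal.Quotient.mk_surjective g
    have e : ∀ a, z • (Ideal.Quotient.mk (Ideal.span {c - 1})) a =
        (Ideal.Quotient.mk (Ideal.span {c - 1})) (z • a) := fun a => rfl
    rw [e]
    simp only [levelBracket_mk c π hπ hc]
    rw [h.smul_left, e]
  · obtain ⟨f, rfl⟩ := Ideal.Quotient.mk_surjective f
    obtain ⟨g, rfl⟩ := Ideal.Quotient.mk_surjective g
    simp only [levelBracket_mk c π hπ hc]
    rw [h.skew, map_neg]
  · obtain ⟨f, rfl⟩ := Ideal.Quotient.mk_surjective f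
    obtain ⟨g, rfl⟩ := Ideal.Quotient.mk_surjective g
    obtain ⟨k, rfl⟩ := Ideal.Quotient.mk_surjective k
    rw [← map_mul]
    simp only [levelBracket_mk c π hπ hc]
    rw [h.leibniz, map_add, map_mul, map_mul]

/-- The polynomial whose coefficient at x^i is {P_i, Q(x')} takes the values {P(s), Q(t)}, so
agreement off the diagonal forces it to be G. -/
theorem IsBiderivation.hasGenFun_of_eval (hB : IsBiderivation B) (P Q : A[X]) (G : A[X][X])
    (h : ∀ s t, s ≠ t → B (evalAt P s) (evalAt Q t) = evalAt₂ G s t) : HasGenFun B P Q G := by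
  have key : G = ∑ i ∈ Finset.range (P.natDegree + 1),
      monomial i (coeffMap (hB.ad (P.coeff i)).toLinearMap Q) := by
    refine eq_of_evalAt₂ (fun s => {s}) fun s t ht => ?_
    rw [← h s t (by simpa [eq_comm] using ht), evalAt₂, eval_finsetSum]
    simp only [eval_monomial]
    rw [hB.skew]
    change -(hB.ad (evalAt Q t)) (evalAt P s) = _
    rw [show evalAt P s = _ from eval_eq_sum_range _, map_sum, ← Finset.sum_neg_distrib,
      evalAt_sum]
    refine Finset.sum_congr rfl fun i _ => ?_
    rw [evalAt_mul, evalAt_coeffMap, evalAt_pow, evalAt_C, ← map_pow,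
      mul_comm (P.coeff i), ← Algebra.smul_def, Derivation.map_smul, mul_comm, ← Algebra.smul_def,
      Derivation.coeFn_coe, hB.ad_skew (P.coeff i), smul_neg]
  intro i j
  rw [key, finsetSum_coeff]
  simp only [coeff_monomial, Finset.sum_ite_eq', Finset.mem_range]
  split_ifs with hi
  · simp [hB.ad_apply]
  · rw [coeff_eq_zero_of_natDegree_lt (n := i) (by omega), hB.skew, ← hB.ad_apply]
    simp

theorem IsBiderivation.eval_of_hasGenFun (hB : IsBiderivation B) {P Q : A[X]} {G : A[X][X]}
    (h : HasGenFun B P Q G) (s t : ℂ) : B (evalAt P s) (evalAt Q t) = evalAt₂ G s t := by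
  have h1 : coeffMap (-hB.ad (evalAt Q t)).toLinearMap P =
      G.map (evalRingHom (algebraMap ℂ A t)) := by
    ext i
    have h2 : coeffMap (hB.ad (P.coeff i)).toLinearMap Q = G.coeff i := by
      ext j
      rw [coeff_coeffMap, ← h i j]
      rfl
    rw [coeff_coeffMap, coeff_map, ← h2, coe_evalRingHom, ← evalAt, evalAt_coeffMap]
    simp [hB.ad_skew (P.coeff i)]
  have h3 := congrArg (fun G => evalAt G s) h1
  simp only [evalAt_coeffMap] at h3
  rw [hB.skew]
  refine Eq.trans ?_ (h3.trans ?_)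
  · rfl
  · rw [evalAt₂, evalAt, evalAt, ← coe_evalRingHom (algebraMap ℂ A t),
      ← eval₂_at_apply, eval₂_eq_eval_map]
    simp

end Bider

end PrymToda

namespace PrymToda

open Polynomial

/-! ## Degrees in the Mumford system -/

section

/-- Multiplication by a monic linear factor raises the degree by exactly one, even over a ring with
zero divisors. -/
theorem coeff_eq_zero_of_natDegree_X_sub_C_mul {A : Type*} [CommRing A] (a : A) (G : A[X]) (k : ℕ)
    (h : ((X - C a) * G).natDegree ≤ k) (i : ℕ) (hi : k ≤ i) : G.coeff i = 0 := by
  nontriviality A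
  by_cases hG : G = 0
  · simp [hG]
  · rw [(monic_X_sub_C a).natDegree_mul' hG, natDegree_X_sub_C] at h
    exact coeff_eq_zero_of_natDegree_lt (by omega)

variable {A : Type*} [CommRing A] [Algebra ℂ A]

theorem evalAt_map_evalRingHom (G : A[X][X]) (s t : ℂ) :
    evalAt (G.map (evalRingHom (algebraMap ℂ A t))) s = evalAt₂ G s t := by
  have h : (evalRingHom (algebraMap ℂ A s)).comp (mapRingHom (evalRingHom (algebraMap ℂ A t))) =
      (evalRingHom (algebraMap ℂ A t)).comp (evalRingHom (C (algebraMap ℂ A s))) := by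
    refine ringHom_ext' ?_ ?_
    · ext <;> simp
    · simp
  exact DFunLike.congr_fun h G

theorem coeff_coeff_swap (G G' : A[X][X]) (h : ∀ s t, evalAt₂ G s t = evalAt₂ G' t s) (i j : ℕ) :
    (G.coeff i).coeff j = (G'.coeff j).coeff i := by
  have h1 : G.coeff i = coeffMap ((lcoeff A i).restrictScalars ℂ) G' := by
    refine eq_of_evalAt ∅ fun t _ => ?_
    rw [evalAt_coeffMap]
    have h2 : G.map (evalRingHom (algebraMap ℂ A t)) = evalAt G' t := by
      refine eq_of_evalAt ∅ fun s _ => ?_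
      rw [evalAt_map_evalRingHom, h]
      rfl
    change _ = (evalAt G' t).coeff i
    rw [← h2, coeff_map]
    rfl
  rw [h1, coeff_coeffMap]
  rfl

/-- The bracket formulas are known after multiplication by x - x'. For frozen x' = t, a bound for
the degree of the numerator in x bounds the degree of the quotient by one less. -/
theorem coeff_coeff_eq_zero_of_left (G : A[X][X]) (k : ℕ)
    (h : ∀ t, ∃ R : A[X], R.natDegree ≤ k ∧ ∀ s,
      (algebraMap ℂ A s - algebraMap ℂ A t) * evalAt₂ G s t = evalAt R s) (i : ℕ) (hi : k ≤ i) :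
    G.coeff i = 0 := by
  refine eq_zero_of_evalAt ∅ _ fun t _ => ?_
  obtain ⟨R, hR, hs⟩ := h t
  set Gt := G.map (evalRingHom (algebraMap ℂ A t)) with hGt
  have h1 : (X - C (algebraMap ℂ A t)) * Gt = R := by
    refine eq_of_evalAt ∅ fun s _ => ?_
    rw [← hs s, evalAt_mul, evalAt_sub, evalAt_X, evalAt_C]
    rw [hGt, evalAt_map_evalRingHom]
  have h2 := coeff_eq_zero_of_natDegree_X_sub_C_mul _ Gt k (h1 ▸ hR) i hi
  rw [hGt, coeff_map] at h2
  exact h2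

theorem coeff_coeff_eq_zero_of_right (G : A[X][X]) (k : ℕ)
    (h : ∀ s, ∃ R : A[X], R.natDegree ≤ k ∧ ∀ t,
      (algebraMap ℂ A s - algebraMap ℂ A t) * evalAt₂ G s t = evalAt R t) (j : ℕ) (hj : k ≤ j)
    (i : ℕ) : (G.coeff i).coeff j = 0 := by
  refine map_coeff_eq_zero ∅ ((lcoeff A j).restrictScalars ℂ) G (fun s _ => ?_) i
  obtain ⟨R, hR, ht⟩ := h s
  have h1 : (X - C (algebraMap ℂ A s)) * evalAt G s = -R := by
    refine eq_of_evalAt ∅ fun t _ => ?_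
    rw [evalAt_neg, ← ht t, evalAt_mul, evalAt_sub, evalAt_X, evalAt_C]
    have : evalAt (evalAt G s) t = evalAt₂ G s t := rfl
    rw [this]
    ring
  have h2 : ((X - C (algebraMap ℂ A s)) * evalAt G s).natDegree ≤ k := by
    rw [h1, natDegree_neg]
    exact hR
  exact coeff_eq_zero_of_natDegree_X_sub_C_mul _ _ k h2 j hj

end

/-! ### Leading terms of w and p relative to u. -/

section Mumford

variable (g : ℕ)

theorem uM_monic : (uM g).Monic := monic_X_pow_add (sum_degree_lt g _)

theorem natDegree_uM : (uM g).natDegree = g := by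
  unfold uM
  rw [natDegree_add_eq_left_of_degree_lt, natDegree_X_pow]
  rw [degree_X_pow]
  exact sum_degree_lt g _

theorem natDegree_wM : (wM g).natDegree = g + 2 := by
  unfold wM
  rw [natDegree_add_eq_left_of_degree_lt, natDegree_X_pow]
  rw [degree_X_pow]
  exact sum_degree_lt (g + 2) _

theorem coeff_sum_C_mul_X_pow {A : Type*} [CommRing A] (k : ℕ) (a : Fin k → A) (i : ℕ) :
    (∑ j : Fin k, C (a j) * X ^ (j : ℕ)).coeff i = if h : i < k then a ⟨i, h⟩ else 0 := by
  rw [finsetSum_coeff]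
  simp only [coeff_C_mul, coeff_X_pow, mul_ite, mul_one, mul_zero]
  split_ifs with h
  · rw [Finset.sum_eq_single ⟨i, h⟩]
    · simp
    · intro b _ hb
      rw [if_neg]
      rintro rfl
      exact hb rfl
    · simp
  · refine Finset.sum_eq_zero fun j _ => if_neg ?_
    have := j.2
    omega

theorem coeff_uM (i : Fin g) : (uM g).coeff i = MvPolynomial.X (Sum.inl i) := by
  rw [uM, coeff_add, coeff_sum_C_mul_X_pow, coeff_X_pow, if_neg (by omega), dif_pos i.2, zero_add]

theorem coeff_vM (i : Fin g) : (vM g).coeff i = MvPolynomial.X (Sum.inr (Sum.inl i)) := by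
  rw [vM, coeff_sum_C_mul_X_pow, dif_pos i.2]

theorem coeff_wM (i : Fin (g + 2)) :
    (wM g).coeff i = MvPolynomial.X (Sum.inr (Sum.inr i)) := by
  rw [wM, coeff_add, coeff_sum_C_mul_X_pow, coeff_X_pow, if_neg (by omega), dif_pos i.2, zero_add]

theorem coeff_uM_of_le {i : ℕ} (hi : g ≤ i) :
    (uM g).coeff i = algebraMap ℂ (OM g) (if i = g then 1 else 0) := by
  rw [uM, coeff_add, coeff_sum_C_mul_X_pow, coeff_X_pow, dif_neg (by omega), add_zero]
  split_ifs <;> simp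

theorem coeff_vM_of_le {i : ℕ} (hi : g ≤ i) : (vM g).coeff i = algebraMap ℂ (OM g) 0 := by
  rw [vM, coeff_sum_C_mul_X_pow, dif_neg (by omega), map_zero]

theorem coeff_wM_of_le {i : ℕ} (hi : g + 2 ≤ i) :
    (wM g).coeff i = algebraMap ℂ (OM g) (if i = g + 2 then 1 else 0) := by
  rw [wM, coeff_add, coeff_sum_C_mul_X_pow, coeff_X_pow, dif_neg (by omega), add_zero]
  split_ifs <;> simp

theorem natDegree_vM_le : (vM g).natDegree ≤ g - 1 := by
  rw [natDegree_le_iff_coeff_eq_zero]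
  intro N hN
  rw [coeff_vM_of_le g (by omega), map_zero]

theorem pM_monic : (pM g).Monic := (exists_pM g).choose_spec.1

theorem natDegree_pM : (pM g).natDegree = g + 1 := (exists_pM g).choose_spec.2.1

/-- The remainder `r` in `u w + v² = p² + r`. -/
noncomputable def rM : (OM g)[X] := momentumM g - pM g ^ 2

theorem degree_rM : (rM g).degree < (g + 1 : ℕ) := (exists_pM g).choose_spec.2.2

theorem momentumM_eq : momentumM g = pM g ^ 2 + rM g := by rw [rM]; ring

/-- Half of the constant `w_{g+1} - u_{g-1}`. -/
noncomputable def halfAlpha : OM g := (1 / 2 : ℂ) • alphaConst g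

theorem alphaConst_eq : alphaConst g = 2 * halfAlpha g := by
  rw [halfAlpha, mul_smul_comm, two_mul, ← two_smul ℂ, smul_smul]
  norm_num

/-- The remainder of `w` with respect to `u`. -/
noncomputable def wRem : (OM g)[X] := wM g - (X ^ 2 + C (2 * halfAlpha g) * X) * uM g

/-- The remainder of `p` with respect to `u`. -/
noncomputable def pRem : (OM g)[X] := pM g - (X + C (halfAlpha g)) * uM g

theorem wM_eq : wM g = (X ^ 2 + C (2 * halfAlpha g) * X) * uM g + wRem g := by rw [wRem]; ring

theorem pM_eq : pM g = (X + C (halfAlpha g)) * uM g + pRem g := by rw [pRem]; ring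

variable {g}

/-- The terms in x^(g+2) cancel since u and w are monic, those in x^(g+1) since 2d = w_{g+1} -
u_{g-1}. -/
theorem natDegree_wRem (hg : 1 ≤ g) : (wRem g).natDegree ≤ g := by
  rw [natDegree_le_iff_coeff_eq_zero]
  intro N hN
  have e : wRem g = wM g - uM g * X ^ 2 - C (2 * halfAlpha g) * (uM g * X) := by rw [wRem]; ring
  obtain ⟨M, rfl⟩ : ∃ M, N = M + 2 := ⟨N - 2, by omega⟩
  rw [e, coeff_sub, coeff_sub, coeff_mul_X_pow, coeff_C_mul, coeff_mul_X, ← alphaConst_eq,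
    alphaConst]
  rcases Nat.lt_or_ge M g with h | h
  · obtain rfl : M = g - 1 := by omega
    rw [show g - 1 + 2 = g + 1 by omega, show g - 1 + 1 = g by omega, coeff_uM_of_le g le_rfl]
    simp
  · rw [coeff_uM_of_le g h, coeff_uM_of_le g (i := M + 1) (by omega), coeff_wM_of_le g (by omega)]
    simp [show M + 1 ≠ g by omega]

theorem natDegree_pRem_aux : (pRem g).natDegree ≤ g := by
  have h1 : (X + C (halfAlpha g)).natDegree = 1 := natDegree_X_add_C _
  have h3 : ((X + C (halfAlpha g)) * uM g).Monic := (monic_X_add_C _).mul (uM_monic g)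
  have h2 : ((X + C (halfAlpha g)) * uM g).natDegree = g + 1 := by
    rw [(monic_X_add_C _).natDegree_mul (uM_monic g), h1, natDegree_uM, add_comm]
  rw [natDegree_le_iff_coeff_eq_zero]
  intro N hN
  rw [pRem, coeff_sub]
  rcases Nat.lt_or_ge (g + 1) N with h | h
  · rw [coeff_eq_zero_of_natDegree_lt (by rw [natDegree_pM]; omega),
      coeff_eq_zero_of_natDegree_lt (by omega), sub_zero]
  · obtain rfl : N = g + 1 := by omega
    conv_lhs => rw [← natDegree_pM g, (pM_monic g).coeff_natDegree, natDegree_pM, ← h2,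
      h3.coeff_natDegree, sub_self]

/-- The multiples of u² in uw and p² nearly cancel, as (x² + 2dx) - (x + d)² = -d². What remains is
a sum of products whose leading coefficients can be compared with zero. -/
theorem rM_eq_rem : rM g = uM g * wRem g - C (halfAlpha g ^ 2) * (uM g * uM g) -
    C 2 * (((X + C (halfAlpha g)) * uM g) * pRem g) - pRem g * pRem g + vM g * vM g := by
  rw [rM, momentumM, pM_eq, wM_eq]
  simp only [map_mul, map_pow, map_ofNat]
  ring

/-- In degree 2g + 1 the only contribution to r is -2 (x + d) u · (p - (x + d) u), and r has no
coefficient there; so the coefficient of x^g in p - (x + d) u is zero. -/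
theorem natDegree_pRem (hg : 1 ≤ g) : (pRem g).natDegree ≤ g - 1 := by
  have h3 : ((X + C (halfAlpha g)) * uM g).Monic := (monic_X_add_C _).mul (uM_monic g)
  have h2 : ((X + C (halfAlpha g)) * uM g).natDegree = g + 1 := by
    rw [(monic_X_add_C _).natDegree_mul (uM_monic g), natDegree_X_add_C, natDegree_uM, add_comm]
  have hq := natDegree_pRem_aux (g := g)
  have hw := natDegree_wRem hg
  have hu := natDegree_uM g
  have hv := natDegree_vM_le g
  have hr : (rM g).coeff (g + 1 + g) = 0 :=
    coeff_eq_zero_of_degree_lt ((degree_rM g).trans_le (by exact_mod_cast (by omega)))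
  rw [rM_eq_rem, coeff_add, coeff_sub, coeff_sub, coeff_sub, coeff_C_mul, coeff_C_mul,
    coeff_mul_add_eq_of_natDegree_le h2.le hq] at hr
  have hlt : ∀ P Q : (OM g)[X], P.natDegree ≤ g → Q.natDegree ≤ g →
      (P * Q).coeff (g + 1 + g) = 0 := fun P Q hP hQ =>
    coeff_eq_zero_of_natDegree_lt (lt_of_le_of_lt natDegree_mul_le (by omega))
  rw [hlt _ _ hu.le hw, hlt _ _ hu.le hu.le, hlt _ _ hq hq, hlt _ _ (by omega) (by omega)] at hr
  rw [← h2, h3.coeff_natDegree] at hr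
  have hr' : (pRem g).coeff g = 0 := by simpa using hr
  rw [natDegree_le_iff_coeff_eq_zero]
  intro N hN
  rcases Nat.lt_or_ge g N with h | h
  · exact coeff_eq_zero_of_natDegree_lt (by omega)
  · obtain rfl : N = g := by omega
    exact hr'

/-- The next comparison, in degree 2g, where r still has no term. It eliminates the unknown
coefficient of p from the bracket of v with d. -/
theorem coeff_wRem (hg : 1 ≤ g) :
    (wRem g).coeff g = 2 * (pRem g).coeff (g - 1) + halfAlpha g ^ 2 := by
  have h3 : ((X + C (halfAlpha g)) * uM g).Monic := (monic_X_add_C _).mul (uM_monic g)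
  have h2 : ((X + C (halfAlpha g)) * uM g).natDegree = g + 1 := by
    rw [(monic_X_add_C _).natDegree_mul (uM_monic g), natDegree_X_add_C, natDegree_uM, add_comm]
  have hq := natDegree_pRem hg
  have hw := natDegree_wRem hg
  have hu := natDegree_uM g
  have hv := natDegree_vM_le g
  have hr : (rM g).coeff (g + g) = 0 :=
    coeff_eq_zero_of_degree_lt ((degree_rM g).trans_le (by exact_mod_cast (by omega)))
  rw [rM_eq_rem, coeff_add, coeff_sub, coeff_sub, coeff_sub, coeff_C_mul, coeff_C_mul,
    coeff_mul_add_eq_of_natDegree_le hu.le hw, coeff_mul_add_eq_of_natDegree_le hu.le hu.le] at hr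
  have e : ((X + C (halfAlpha g)) * uM g * pRem g).coeff (g + g) = (pRem g).coeff (g - 1) := by
    rw [show g + g = (g + 1) + (g - 1) by omega, coeff_mul_add_eq_of_natDegree_le h2.le hq]
    conv_lhs => rw [← h2, h3.coeff_natDegree, one_mul]
  have hlt : ∀ P Q : (OM g)[X], P.natDegree ≤ g - 1 → Q.natDegree ≤ g - 1 →
      (P * Q).coeff (g + g) = 0 := fun P Q hP hQ =>
    coeff_eq_zero_of_natDegree_lt (lt_of_le_of_lt natDegree_mul_le (by omega))
  rw [e, hlt _ _ hq hq, hlt _ _ hv hv] at hr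
  have hu1 : (uM g).coeff g = 1 := by
    rw [coeff_uM_of_le g le_rfl, if_pos rfl, map_one]
  rw [hu1] at hr
  linear_combination hr

end Mumford

end PrymToda

namespace PrymToda

open Polynomial

/-! ## The quadratic bracket on generating functions -/

section

variable (g : ℕ) (φ : ℂ[X])

/-- `u(s)`, `v(s)`, `w(s)`, `p(s)` as regular functions on `M'_g`. -/
noncomputable def uAt (s : ℂ) : OM g := evalAt (uM g) s
noncomputable def vAt (s : ℂ) : OM g := evalAt (vM g) s
noncomputable def wAt (s : ℂ) : OM g := evalAt (wM g) s
noncomputable def pAt (s : ℂ) : OM g := evalAt (pM g) s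

/-- `φ(s)` as an element of a `ℂ`-algebra. -/
noncomputable def phAt (A : Type*) [CommRing A] [Algebra ℂ A] (φ : ℂ[X]) (s : ℂ) : A :=
  algebraMap ℂ A (φ.eval s)

variable {φ}

theorem phAt_eq {A : Type*} [CommRing A] [Algebra ℂ A] (hφ : φ.natDegree ≤ 1) (s : ℂ) :
    phAt A φ s = algebraMap ℂ A (φ.coeff 1) * algebraMap ℂ A s + algebraMap ℂ A (φ.coeff 0) := by
  rw [phAt, ← map_mul, ← map_add]
  conv_lhs => rw [eq_X_add_C_of_natDegree_le_one hφ]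
  simp

/-- `α^φ(s + t)`. -/
noncomputable def alphaPhiAt (φ : ℂ[X]) (s t : ℂ) : OM g :=
  algebraMap ℂ (OM g) (φ.coeff 1) * (algebraMap ℂ (OM g) s + algebraMap ℂ (OM g) t + halfAlpha g) +
    algebraMap ℂ (OM g) (φ.coeff 0)

theorem evalAt₂_smul {A : Type*} [CommRing A] [Algebra ℂ A] (z : ℂ) (P : A[X][X]) (s t : ℂ) :
    evalAt₂ (z • P) s t = z • evalAt₂ P s t := by
  rw [Algebra.smul_def, Algebra.smul_def, evalAt₂_mul]
  congr 1
  exact evalAt₂_const2 _ s t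

theorem evalAt₂_two (s t : ℂ) : evalAt₂ (2 : (OM g)[X][X]) s t = 2 := evalAt₂_ofNat 2 s t

theorem evalAt₂_alphaSum (s t : ℂ) : evalAt₂ (alphaSum g) s t =
    algebraMap ℂ (OM g) s + algebraMap ℂ (OM g) t + 2 * halfAlpha g := by
  simp [alphaSum, alphaConst_eq]

theorem evalAt₂_alphaPhiSum (hφ : φ.natDegree ≤ 1) (s t : ℂ) :
    evalAt₂ (alphaPhiSum g φ) s t = alphaPhiAt g φ s t := by
  rw [alphaPhiSum, alphaPhiAt]
  conv_lhs => rw [eq_X_add_C_of_natDegree_le_one hφ]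
  have e : ∀ z : ℂ, evalAt₂ (algebraMap ℂ (OM g)[X][X] z) s t = algebraMap ℂ (OM g) z := fun z =>
    evalAt₂_const2 _ s t
  simp only [map_add, map_mul, aeval_C, aeval_X, evalAt₂_add, evalAt₂_mul, e, evalAt₂_smul,
    evalAt₂_varX, evalAt₂_varX', evalAt₂_const2, alphaConst_eq]
  have h2 : (algebraMap ℂ (OM g)) (1 / 2) * 2 = 1 := by
    rw [← map_ofNat (algebraMap ℂ (OM g)) 2, ← map_mul]
    norm_num
  rw [evalAt₂_two, Algebra.smul_def]
  linear_combination (algebraMap ℂ (OM g) (φ.coeff 1)) *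
    (algebraMap ℂ (OM g) s + algebraMap ℂ (OM g) t + halfAlpha g) * h2

theorem evalAt_mul_liftC (P : (OM g)[X]) (s : ℂ) :
    evalAt (P * liftC φ) s = evalAt P s * phAt (OM g) φ s := by
  rw [evalAt_mul, evalAt_liftC, phAt]

local notation "σ" => algebraMap ℂ (OM g)

theorem evalAt₂_linUV (s t : ℂ) : (σ s - σ t) * evalAt₂ (linUV g (pM g * liftC φ)) s t =
    uAt g s * (pAt g t * phAt _ φ t) - uAt g t * (pAt g s * phAt _ φ s) := by
  rw [linUV, evalAt₂_divDiff _ fun s => by simp]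
  simp only [evalAt₂_sub, evalAt₂_mul, evalAt₂_atX, evalAt₂_atX', evalAt_mul_liftC]
  rfl

theorem evalAt₂_quadUV (hφ : φ.natDegree ≤ 1) (s t : ℂ) :
    (σ s - σ t) * evalAt₂ (quadUV g φ) s t =
      uAt g s * (pAt g t * phAt _ φ t) - uAt g t * (pAt g s * phAt _ φ s) +
        (σ s - σ t) * alphaPhiAt g φ s t * uAt g s * uAt g t := by
  rw [quadUV, evalAt₂_add, mul_add, evalAt₂_linUV, evalAt₂_mul, evalAt₂_mul,
    evalAt₂_alphaPhiSum g hφ, evalAt₂_atX, evalAt₂_atX']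
  simp only [uAt]
  ring

theorem evalAt₂_quadUW (hφ : φ.natDegree ≤ 1) (s t : ℂ) :
    (σ s - σ t) * evalAt₂ (quadUW g φ) s t =
      -2 * (vAt g s * (pAt g t * phAt _ φ t) - vAt g t * (pAt g s * phAt _ φ s)) -
        2 * (σ s - σ t) * alphaPhiAt g φ s t * uAt g s * vAt g t := by
  have h := evalAt₂_divDiff
    (atX (vM g) * atX' (pM g * liftC φ) - atX' (vM g) * atX (pM g * liftC φ))
    (fun s => by simp) s t
  simp only [evalAt₂_sub, evalAt₂_mul, evalAt₂_atX, evalAt₂_atX', evalAt_mul_liftC] at h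
  simp only [quadUW, linUW, evalAt₂_sub, evalAt₂_mul, evalAt₂_neg, evalAt₂_two,
    evalAt₂_alphaPhiSum g hφ, evalAt₂_atX, evalAt₂_atX', uAt, vAt, pAt]
  linear_combination -2 * h

theorem evalAt₂_quadVW (hφ : φ.natDegree ≤ 1) (s t : ℂ) :
    (σ s - σ t) * evalAt₂ (quadVW g φ) s t =
      wAt g s * (pAt g t * phAt _ φ t) - wAt g t * (pAt g s * phAt _ φ s) -
        (σ s - σ t) * (σ s + σ t + 2 * halfAlpha g) * uAt g s * (pAt g t * phAt _ φ t) +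
        (σ s - σ t) * alphaPhiAt g φ s t * uAt g s * wAt g t := by
  have h := evalAt₂_divDiff
    (atX (wM g) * atX' (pM g * liftC φ) - atX' (wM g) * atX (pM g * liftC φ))
    (fun s => by simp) s t
  simp only [evalAt₂_sub, evalAt₂_mul, evalAt₂_atX, evalAt₂_atX', evalAt_mul_liftC] at h
  simp only [quadVW, linVW, evalAt₂_add, evalAt₂_sub, evalAt₂_mul, evalAt₂_alphaSum,
    evalAt₂_alphaPhiSum g hφ, evalAt₂_atX, evalAt₂_atX', evalAt_mul_liftC, uAt, wAt, pAt]
  linear_combination h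

theorem evalAt₂_quadWW (hφ : φ.natDegree ≤ 1) (s t : ℂ) :
    evalAt₂ (quadWW g φ) s t =
      2 * (σ s + σ t + 2 * halfAlpha g) *
        (vAt g s * (pAt g t * phAt _ φ t) - vAt g t * (pAt g s * phAt _ φ s)) +
        2 * alphaPhiAt g φ s t * (wAt g s * vAt g t - wAt g t * vAt g s) := by
  simp only [quadWW, linWW, evalAt₂_add, evalAt₂_sub, evalAt₂_mul, evalAt₂_alphaSum, evalAt₂_two,
    evalAt₂_alphaPhiSum g hφ, evalAt₂_atX, evalAt₂_atX', evalAt_mul_liftC, wAt, vAt, pAt]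

/-- `φ p - (x - t) α^φ(x + t) u`. -/
noncomputable def redP (φ : ℂ[X]) (t : ℂ) : (OM g)[X] :=
  C (σ (φ.coeff 1)) * (X * pRem g + C (σ t ^ 2 + σ t * halfAlpha g) * uM g) +
    C (σ (φ.coeff 0)) * (pRem g + C (halfAlpha g + σ t) * uM g)

/-- `w - (x - t) α(x + t) u`. -/
noncomputable def redW (t : ℂ) : (OM g)[X] :=
  wRem g + C (σ t ^ 2 + 2 * halfAlpha g * σ t) * uM g

/-- `α^φ(x + t) w - α(x + t) φ p`. -/
noncomputable def redPW (φ : ℂ[X]) (t : ℂ) : (OM g)[X] :=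
  C (σ (φ.coeff 1)) * ((X + C (σ t + halfAlpha g)) * wRem g +
    C (σ t * halfAlpha g) * (X * uM g) - (X + C (σ t + 2 * halfAlpha g)) * (X * pRem g)) +
  C (σ (φ.coeff 0)) * (wRem g - (C (σ t + halfAlpha g) * X +
    C ((σ t + 2 * halfAlpha g) * halfAlpha g)) * uM g - (X + C (σ t + 2 * halfAlpha g)) * pRem g)

variable {g}

theorem evalAt_redP (hφ : φ.natDegree ≤ 1) (s t : ℂ) : evalAt (redP g φ t) s =
    pAt g s * phAt _ φ s - (σ s - σ t) * alphaPhiAt g φ s t * uAt g s := by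
  simp only [redP, pAt, pM_eq, evalAt_add, evalAt_mul, evalAt_C, evalAt_X, phAt_eq hφ, alphaPhiAt,
    uAt]
  ring

theorem evalAt_redW (s t : ℂ) : evalAt (redW g t) s =
    wAt g s - (σ s - σ t) * (σ s + σ t + 2 * halfAlpha g) * uAt g s := by
  simp only [redW, wAt, wM_eq, evalAt_add, evalAt_mul, evalAt_C, evalAt_X, evalAt_pow, uAt]
  ring

theorem evalAt_redPW (hφ : φ.natDegree ≤ 1) (s t : ℂ) : evalAt (redPW g φ t) s =
    alphaPhiAt g φ s t * wAt g s -
      (σ s + σ t + 2 * halfAlpha g) * (pAt g s * phAt _ φ s) := by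
  simp only [redPW, wAt, pAt, wM_eq, pM_eq, evalAt_add, evalAt_sub, evalAt_mul, evalAt_C, evalAt_X,
    evalAt_pow, phAt_eq hφ, alphaPhiAt]
  ring

theorem natDegree_C_mul_le' {A : Type*} [CommRing A] (a : A) (P : A[X]) (k : ℕ)
    (h : P.natDegree ≤ k) : (C a * P).natDegree ≤ k := (natDegree_C_mul_le _ _).trans h

theorem natDegree_mul_le' {A : Type*} [CommRing A] {P Q : A[X]} {k l m : ℕ}
    (hP : P.natDegree ≤ k) (hQ : Q.natDegree ≤ l) (h : k + l ≤ m) : (P * Q).natDegree ≤ m :=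
  (natDegree_mul_le_of_le hP hQ).trans h

theorem natDegree_sub_le' {A : Type*} [CommRing A] {P Q : A[X]} {k : ℕ}
    (hP : P.natDegree ≤ k) (hQ : Q.natDegree ≤ k) : (P - Q).natDegree ≤ k :=
  (natDegree_sub_le _ _).trans (max_le hP hQ)

theorem natDegree_X_add_C_le {A : Type*} [CommRing A] (a : A) : (X + C a).natDegree ≤ 1 := by
  nontriviality A
  exact (natDegree_X_add_C _).le

/-- This is where the constant in α^φ matters: with p = (x + d) u + `pRem` the multiples x² u and x
u cancel against (x - t) α^φ(x + t) u, and φ times `pRem` has degree at most g. -/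
theorem natDegree_redP (hg : 1 ≤ g) (t : ℂ) : (redP g φ t).natDegree ≤ g := by
  have hu := (natDegree_uM g).le
  have hq := natDegree_pRem hg
  refine natDegree_add_le_of_degree_le (natDegree_C_mul_le' _ _ _ (natDegree_add_le_of_degree_le
    (natDegree_mul_le' natDegree_X_le hq (by omega)) (natDegree_C_mul_le' _ _ _ hu)))
    (natDegree_C_mul_le' _ _ _ (natDegree_add_le_of_degree_le (by omega)
      (natDegree_C_mul_le' _ _ _ hu)))

theorem natDegree_redW (hg : 1 ≤ g) (t : ℂ) : (redW g t).natDegree ≤ g :=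
  natDegree_add_le_of_degree_le (natDegree_wRem hg)
    (natDegree_C_mul_le' _ _ _ (natDegree_uM g).le)

theorem natDegree_redPW (hg : 1 ≤ g) (t : ℂ) : (redPW g φ t).natDegree ≤ g + 1 := by
  have hu := (natDegree_uM g).le
  have hq := natDegree_pRem hg
  have hw := natDegree_wRem hg
  have hX := fun a => natDegree_X_add_C_le (A := OM g) a
  have hX0 := natDegree_X_le (R := OM g)
  have h1 : ((X + C (σ t + halfAlpha g)) * wRem g).natDegree ≤ g + 1 :=
    natDegree_mul_le' (hX _) hw (by omega)
  have h2 : (C (σ t * halfAlpha g) * (X * uM g)).natDegree ≤ g + 1 :=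
    natDegree_C_mul_le' _ _ _ (natDegree_mul_le' hX0 hu (by omega))
  have h3 : ((X + C (σ t + 2 * halfAlpha g)) * (X * pRem g)).natDegree ≤ g + 1 :=
    natDegree_mul_le' (hX _) (natDegree_mul_le' hX0 hq le_rfl) (by omega)
  have h4 : ((C (σ t + halfAlpha g) * X + C ((σ t + 2 * halfAlpha g) * halfAlpha g)) *
      uM g).natDegree ≤ g + 1 :=
    natDegree_mul_le' (k := 1) (natDegree_add_le_of_degree_le (natDegree_C_mul_le' _ _ _ hX0)
      ((natDegree_C _).le.trans zero_le_one)) hu (by omega)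
  have h5 : ((X + C (σ t + 2 * halfAlpha g)) * pRem g).natDegree ≤ g + 1 :=
    natDegree_mul_le' (hX _) hq (by omega)
  have h6 : (wRem g).natDegree ≤ g + 1 := by omega
  exact natDegree_add_le_of_degree_le
    (natDegree_C_mul_le' _ _ _ (natDegree_sub_le' (natDegree_add_le_of_degree_le h1 h2) h3))
    (natDegree_C_mul_le' _ _ _ (natDegree_sub_le' (natDegree_sub_le' h6 h4) h5))

theorem alphaPhiAt_comm (s t : ℂ) : alphaPhiAt g φ s t = alphaPhiAt g φ t s := by
  simp only [alphaPhiAt]; ring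

/-- Only the pair (w, w) needs an argument, since the mixed entries of `quadPi` are skew by
definition; there the generating function changes sign when the variables are exchanged. -/
theorem quadPi_skew (hφ : φ.natDegree ≤ 1) (s t : MVar g) :
    quadPi g φ s t = -quadPi g φ t s := by
  rcases s with i | i | i <;> rcases t with j | j | j <;> simp only [quadPi, neg_neg, neg_zero]
  rw [← coeff_neg, ← coeff_neg]
  refine coeff_coeff_swap _ _ (fun s t => ?_) _ _
  rw [evalAt₂_neg, evalAt₂_quadWW g hφ, evalAt₂_quadWW g hφ, alphaPhiAt_comm t s]
  ring

theorem isBiderivation_quadBracket (hφ : φ.natDegree ≤ 1) : IsBiderivation (quadBracket g φ) :=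
  isBiderivation_polyBracket _ (quadPi_skew hφ)

theorem IsBiderivation.algebraMap_right {A : Type*} [CommRing A] [Algebra ℂ A] {B : A → A → A}
    (hB : IsBiderivation B) (f : A) (z : ℂ) : B f (algebraMap ℂ A z) = 0 :=
  (hB.ad f).map_algebraMap z

theorem IsBiderivation.algebraMap_left {A : Type*} [CommRing A] [Algebra ℂ A] {B : A → A → A}
    (hB : IsBiderivation B) (f : A) (z : ℂ) : B (algebraMap ℂ A z) f = 0 := by
  rw [hB.skew, hB.algebraMap_right, neg_zero]

/-- `quadPi` reads off only the coefficients that belong to coordinates. The other coefficients of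
u, v, w are constants with zero bracket, so the formulas are consistent only if G has no monomials
there. -/
theorem hasGenFun_of_coords {A : Type*} [CommRing A] [Algebra ℂ A] {B : A → A → A}
    (hB : IsBiderivation B) {P Q : A[X]} {k l : ℕ} {G : A[X][X]}
    (hP : ∀ i, k ≤ i → ∃ z : ℂ, P.coeff i = algebraMap ℂ A z)
    (hQ : ∀ i, l ≤ i → ∃ z : ℂ, Q.coeff i = algebraMap ℂ A z)
    (hl : ∀ i, k ≤ i → G.coeff i = 0) (hr : ∀ j, l ≤ j → ∀ i, (G.coeff i).coeff j = 0)
    (h : ∀ i j, i < k → j < l → B (P.coeff i) (Q.coeff j) = (G.coeff i).coeff j) :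
    HasGenFun B P Q G := by
  intro i j
  rcases Nat.lt_or_ge i k with hi | hi
  · rcases Nat.lt_or_ge j l with hj | hj
    · exact h i j hi hj
    · obtain ⟨z, hz⟩ := hQ j hj
      rw [hr j hj, hz, hB.algebraMap_right]
  · obtain ⟨z, hz⟩ := hP i hi
    rw [hl i hi, hz, hB.algebraMap_left, coeff_zero]

/-- The right-hand sides, regrouped with `redP`, `redW` and `redPW`, have numerators of sufficiently
small degree in each variable. This is the whole content of the claim that the formulas define a
bracket. -/
theorem satisfiesQuadFormulas (hg : 1 ≤ g) (hφ : φ.natDegree ≤ 1) :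
    SatisfiesQuadFormulas g φ (quadBracket g φ) := by
  have hB := isBiderivation_quadBracket (g := g) hφ
  have hu : ∀ i, g ≤ i → ∃ z : ℂ, (uM g).coeff i = algebraMap ℂ (OM g) z := fun i hi =>
    ⟨_, coeff_uM_of_le g hi⟩
  have hv : ∀ i, g ≤ i → ∃ z : ℂ, (vM g).coeff i = algebraMap ℂ (OM g) z := fun i hi =>
    ⟨_, coeff_vM_of_le g hi⟩
  have hw : ∀ i, g + 2 ≤ i → ∃ z : ℂ, (wM g).coeff i = algebraMap ℂ (OM g) z := fun i hi =>
    ⟨_, coeff_wM_of_le g hi⟩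
  have du := (natDegree_uM g).le
  have dv := natDegree_vM_le g
  have dw := (natDegree_wM g).le
  have dp : (pM g * liftC φ).natDegree ≤ g + 2 :=
    natDegree_mul_le' (natDegree_pM g).le (natDegree_map_le.trans hφ) (by omega)
  have dP := fun t => natDegree_redP (φ := φ) hg t
  have dW := fun t => natDegree_redW hg t
  have dT := fun t => natDegree_redPW (φ := φ) hg t
  have dX : ∀ s : ℂ, (X - C (σ s)).natDegree ≤ 1 := fun s => natDegree_X_sub_C_le _
  refine ⟨?_, ?_, ?_, ?_, ?_, ?_⟩
  · refine hasGenFun_of_coords hB hu hu (by simp) (by simp) fun i j hi hj => ?_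
    rw [coeff_uM g ⟨i, hi⟩, coeff_uM g ⟨j, hj⟩, quadBracket, polyBracket_X]
    simp [quadPi]
  · refine hasGenFun_of_coords hB hv hv (by simp) (by simp) fun i j hi hj => ?_
    rw [coeff_vM g ⟨i, hi⟩, coeff_vM g ⟨j, hj⟩, quadBracket, polyBracket_X]
    simp [quadPi]
  -- The correction α^φ u u is absorbed by replacing φp with its reduction `redP`, of degree at most
  -- g; the numerator keeps its form with this replacement.
  · refine hasGenFun_of_coords hB hu hv
      (coeff_coeff_eq_zero_of_left _ _ fun t =>
        ⟨C (evalAt (pM g * liftC φ) t) * uM g - C (uAt g t) * redP g φ t, ?_, fun s => ?_⟩)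
      (coeff_coeff_eq_zero_of_right _ _ fun s =>
        ⟨C (uAt g s) * redP g φ s - C (evalAt (pM g * liftC φ) s) * uM g, ?_, fun t => ?_⟩)
      fun i j hi hj => ?_
    · exact natDegree_sub_le' (natDegree_C_mul_le' _ _ _ du) (natDegree_C_mul_le' _ _ _ (dP t))
    · simp only [evalAt₂_quadUV g hφ, evalAt_sub, evalAt_mul, evalAt_C, evalAt_redP hφ,
        evalAt_liftC, uAt, pAt, phAt]
      ring
    · exact natDegree_sub_le' (natDegree_C_mul_le' _ _ _ (dP s)) (natDegree_C_mul_le' _ _ _ du)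
    · simp only [evalAt₂_quadUV g hφ, evalAt_sub, evalAt_mul, evalAt_C, evalAt_redP hφ,
        evalAt_liftC, uAt, pAt, phAt, alphaPhiAt_comm s t]
      ring
    · rw [coeff_uM g ⟨i, hi⟩, coeff_vM g ⟨j, hj⟩, quadBracket, polyBracket_X]
      simp [quadPi]
  · refine hasGenFun_of_coords hB hu hw
      (coeff_coeff_eq_zero_of_left _ _ fun t =>
        ⟨C (-2 * evalAt (pM g * liftC φ) t) * vM g + C (2 * vAt g t) * redP g φ t, ?_,
          fun s => ?_⟩)
      -- In the second variable the bound is g + 2, the number of coordinates of w, so φp itself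
      -- needs no reduction here.
      (coeff_coeff_eq_zero_of_right _ _ fun s =>
        ⟨C (-2 * vAt g s) * (pM g * liftC φ) + vM g * (C (2 * evalAt (pM g * liftC φ) s) -
          C (2 * uAt g s) * ((X - C (σ s)) * (C (-σ (φ.coeff 1)) *
          (X + C (σ s + halfAlpha g)) + C (-σ (φ.coeff 0))))), ?_, fun t => ?_⟩)
      fun i j hi hj => ?_
    · exact natDegree_add_le_of_degree_le (natDegree_C_mul_le' _ _ _ (by omega))
        (natDegree_C_mul_le' _ _ _ (dP t))
    · simp only [evalAt₂_quadUW g hφ, evalAt_add, evalAt_mul, evalAt_C, evalAt_redP hφ,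
        evalAt_liftC, uAt, vAt, pAt, phAt]
      ring
    · have h1 : (C (-σ (φ.coeff 1)) * (X + C (σ s + halfAlpha g)) +
          C (-σ (φ.coeff 0))).natDegree ≤ 1 :=
        natDegree_add_le_of_degree_le (natDegree_C_mul_le' _ _ _ (natDegree_X_add_C_le _))
          ((natDegree_C _).le.trans zero_le_one)
      refine natDegree_add_le_of_degree_le (natDegree_C_mul_le' _ _ _ dp)
        (natDegree_mul_le' (l := 2) dv (natDegree_sub_le' ((natDegree_C _).le.trans (by omega))
          (natDegree_C_mul_le' _ _ _ (natDegree_mul_le' (dX s) h1 le_rfl))) (by omega))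
    · simp only [evalAt₂_quadUW g hφ, evalAt_add, evalAt_sub, evalAt_mul, evalAt_C, evalAt_X,
        evalAt_liftC, uAt, vAt, pAt, phAt, alphaPhiAt]
      ring
    · rw [coeff_uM g ⟨i, hi⟩, coeff_wM g ⟨j, hj⟩, quadBracket, polyBracket_X]
      simp [quadPi]
  · refine hasGenFun_of_coords hB hv hw
      (coeff_coeff_eq_zero_of_left _ _ fun t =>
        ⟨C (evalAt (pM g * liftC φ) t) * redW g t - C (wAt g t) * redP g φ t, ?_, fun s => ?_⟩)
      (coeff_coeff_eq_zero_of_right _ _ fun s =>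
        ⟨C (wAt g s) * (pM g * liftC φ) - C (evalAt (pM g * liftC φ) s) * wM g -
          (X - C (σ s)) * (C (uAt g s) * redPW g φ s), ?_, fun t => ?_⟩)
      fun i j hi hj => ?_
    · exact natDegree_sub_le' (natDegree_C_mul_le' _ _ _ (dW t)) (natDegree_C_mul_le' _ _ _ (dP t))
    · simp only [evalAt₂_quadVW g hφ, evalAt_sub, evalAt_mul, evalAt_C, evalAt_redP hφ,
        evalAt_redW, evalAt_liftC, uAt, wAt, pAt, phAt]
      ring
    · exact natDegree_sub_le' (natDegree_sub_le' (natDegree_C_mul_le' _ _ _ dp)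
        (natDegree_C_mul_le' _ _ _ dw))
        (natDegree_mul_le' (dX s) (natDegree_C_mul_le' _ _ _ (dT s)) (by omega))
    · simp only [evalAt₂_quadVW g hφ, evalAt_sub, evalAt_mul, evalAt_C, evalAt_redPW hφ, evalAt_X,
        evalAt_liftC, uAt, wAt, pAt, phAt, alphaPhiAt_comm s t]
      ring
    · rw [coeff_vM g ⟨i, hi⟩, coeff_wM g ⟨j, hj⟩, quadBracket, polyBracket_X]
      simp [quadPi]
  · have hR : ∀ s, ∃ R : (OM g)[X], R.natDegree ≤ g + 1 ∧ ∀ t,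
        evalAt₂ (quadWW g φ) s t = evalAt R t := by
      refine fun s => ⟨C (-2 * vAt g s) * redPW g φ s + vM g * (C (2 * wAt g s) *
        (C (σ (φ.coeff 1)) * (X + C (σ s + halfAlpha g)) + C (σ (φ.coeff 0))) -
        C (2 * evalAt (pM g * liftC φ) s) * (X + C (σ s + 2 * halfAlpha g))), ?_, fun t => ?_⟩
      · have h1 : (C (σ (φ.coeff 1)) * (X + C (σ s + halfAlpha g)) +
            C (σ (φ.coeff 0))).natDegree ≤ 1 :=
          natDegree_add_le_of_degree_le (natDegree_C_mul_le' _ _ _ (natDegree_X_add_C_le _))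
            ((natDegree_C _).le.trans zero_le_one)
        exact natDegree_add_le_of_degree_le (natDegree_C_mul_le' _ _ _ (dT s))
          (natDegree_mul_le' (l := 1) dv (natDegree_sub_le' (natDegree_C_mul_le' _ _ _ h1)
            (natDegree_C_mul_le' _ _ _ (natDegree_X_add_C_le _))) (by omega))
      · simp only [evalAt₂_quadWW g hφ, evalAt_add, evalAt_sub, evalAt_mul, evalAt_C, evalAt_X,
          evalAt_redPW hφ, evalAt_liftC, vAt, wAt, pAt, phAt, alphaPhiAt]
        ring
    have hr : ∀ j, g + 2 ≤ j → ∀ i, ((quadWW g φ).coeff i).coeff j = 0 := by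
      refine coeff_coeff_eq_zero_of_right _ _ fun s => ?_
      obtain ⟨R, hR1, hR2⟩ := hR s
      -- The formula for {w, w} has no denominator; the factor is put in only to fit the criterion,
      -- which takes it away again.
      refine ⟨-((X - C (σ s)) * R), ?_, fun t => ?_⟩
      · rw [natDegree_neg]
        exact natDegree_mul_le' (dX s) hR1 (by omega)
      · rw [hR2, evalAt_neg, evalAt_mul, evalAt_sub, evalAt_X, evalAt_C]
        ring
    refine hasGenFun_of_coords hB hw hw (fun i hi => ?_) hr fun i j hi hj => ?_
    -- The bound in the first variable follows from the one in the second by antisymmetry.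
    · refine Polynomial.ext fun j => ?_
      rw [coeff_zero, ← neg_eq_zero, ← coeff_neg, ← coeff_neg, ← hr i hi j]
      refine coeff_coeff_swap _ _ (fun s t => ?_) _ _
      rw [evalAt₂_neg, evalAt₂_quadWW g hφ, evalAt₂_quadWW g hφ, alphaPhiAt_comm t s]
      ring
    · rw [coeff_wM g ⟨i, hi⟩, coeff_wM g ⟨j, hj⟩, quadBracket, polyBracket_X]
      simp [quadPi]

end

end PrymToda

namespace PrymToda

open Polynomial

/-! ## Derivations of the ring of regular functions on `M'_g` -/

section

variable {g : ℕ} {A : Type*} [CommRing A] [Algebra ℂ A]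

noncomputable def hAt (g : ℕ) (s : ℂ) : OM g := evalAt (momentumM g) s

theorem hAt_eq (s : ℂ) : hAt g s = uAt g s * wAt g s + vAt g s ^ 2 := by
  simp [hAt, momentumM, uAt, vAt, wAt]

theorem derivation_along_ext_coords (ψ : OM g →ₐ[ℂ] A) (D : OM g →ₗ[ℂ] A)
    (hD : ∀ f f', D (f * f') = ψ f * D f' + ψ f' * D f) (h : ∀ i, D (MvPolynomial.X i) = 0)
    (f : OM g) : D f = 0 := by
  induction f using MvPolynomial.induction_on with
  | C a =>
    have h1 : D 1 = 0 := by
      have := hD 1 1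
      simp only [mul_one, map_one, one_mul] at this
      simpa using this
    rw [← mul_one (MvPolynomial.C a), ← MvPolynomial.smul_eq_C_mul, map_smul, h1, smul_zero]
  | add p q hp hq => rw [map_add, hp, hq, add_zero]
  | mul_X p i hp => rw [hD, hp, h, mul_zero, mul_zero, add_zero]

theorem derivation_along_ext_uvw (ψ : OM g →ₐ[ℂ] A) (D : OM g →ₗ[ℂ] A)
    (hD : ∀ f f', D (f * f') = ψ f * D f' + ψ f' * D f) (F : Finset ℂ)
    (hu : ∀ s ∉ F, D (uAt g s) = 0) (hv : ∀ s ∉ F, D (vAt g s) = 0)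
    (hw : ∀ s ∉ F, D (wAt g s) = 0) (f : OM g) : D f = 0 := by
  refine derivation_along_ext_coords ψ D hD (fun i => ?_) f
  rcases i with i | i | i
  · rw [← coeff_uM]
    exact map_coeff_eq_zero F D _ hu i
  · rw [← coeff_vM]
    exact map_coeff_eq_zero F D _ hv i
  · rw [← coeff_wM]
    exact map_coeff_eq_zero F D _ hw i

/-- A derivation (with values in an algebra over `𝒪(M'_g)`) that vanishes on `u`, `v` and
`H = u w + v²` is zero. -/
theorem derivation_along_ext (ψ : OM g →ₐ[ℂ] A) (D : OM g →ₗ[ℂ] A)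
    (hD : ∀ f f', D (f * f') = ψ f * D f' + ψ f' * D f) (F : Finset ℂ)
    (hu : ∀ s ∉ F, D (uAt g s) = 0) (hv : ∀ s ∉ F, D (vAt g s) = 0)
    (hH : ∀ s ∉ F, D (hAt g s) = 0) (f : OM g) : D f = 0 := by
  -- With D u = D v = 0 the Leibniz rule for H leaves ψ(u) D(w) = 0. The image of u is monic, hence
  -- not a zero divisor, even if `A` has zero divisors.
  have h0 : (uM g).map ψ.toRingHom * coeffMap D (wM g) = 0 := by
    refine eq_zero_of_evalAt F _ fun s hs => ?_
    have h1 := hH s hs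
    rw [hAt_eq, map_add, sq, hD, hD, hu s hs, hv s hs] at h1
    rw [evalAt_mul, evalAt_map, evalAt_coeffMap]
    simpa [uAt, wAt] using h1
  have h1 : coeffMap D (wM g) = 0 := by
    by_contra h
    exact ((uM_monic g).map ψ.toRingHom).mul_right_eq_zero_iff.not.2 h h0
  refine derivation_along_ext_uvw ψ D hD F hu hv (fun s _ => ?_) f
  rw [wAt, ← evalAt_coeffMap, h1, evalAt_zero]

theorem derivation_ext (D : Derivation ℂ (OM g) (OM g)) (F : Finset ℂ)
    (hu : ∀ s ∉ F, D (uAt g s) = 0) (hv : ∀ s ∉ F, D (vAt g s) = 0)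
    (hH : ∀ s ∉ F, D (hAt g s) = 0) : D = 0 :=
  Derivation.ext <| derivation_along_ext (AlgHom.id ℂ (OM g)) D.toLinearMap
    (fun f f' => D.leibniz f f') F hu hv hH

end

/-! ## Brackets of the basic functions -/

section

variable {g : ℕ} {φ : ℂ[X]} (hφ : φ.natDegree ≤ 1)

local notation "σ" => algebraMap ℂ (OM g)
local notation "d" => halfAlpha g
local notation "u" => uAt g
local notation "v" => vAt g
local notation "w" => wAt g
local notation "p" => pAt g
local notation "ph" => phAt (OM g) φ

/-- The derivation `{f, ·}_{M,q}^φ`. -/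
noncomputable def qad (f : OM g) : Derivation ℂ (OM g) (OM g) :=
  (isBiderivation_quadBracket hφ).ad f

theorem qad_apply (f f' : OM g) : qad hφ f f' = quadBracket g φ f f' := rfl

theorem qad_skew (f f' : OM g) : qad hφ f f' = -qad hφ f' f :=
  (isBiderivation_quadBracket hφ).ad_skew f f'

theorem qad_algebraMap (f : OM g) (z : ℂ) : qad hφ f (σ z) = 0 := (qad hφ f).map_algebraMap z

variable (hg : 1 ≤ g)
include hg

theorem qad_u_u (s t : ℂ) : qad hφ (u s) (u t) = 0 :=
  ((isBiderivation_quadBracket hφ).eval_of_hasGenFun (satisfiesQuadFormulas hg hφ).uu s t).trans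
    (evalAt₂_zero s t)

theorem qad_v_v (s t : ℂ) : qad hφ (v s) (v t) = 0 :=
  ((isBiderivation_quadBracket hφ).eval_of_hasGenFun (satisfiesQuadFormulas hg hφ).vv s t).trans
    (evalAt₂_zero s t)

theorem qad_u_v (s t : ℂ) : (σ s - σ t) * qad hφ (u s) (v t) =
    u s * (p t * ph t) - u t * (p s * ph s) + (σ s - σ t) * alphaPhiAt g φ s t * u s * u t := by
  rw [← evalAt₂_quadUV g hφ]
  exact congrArg _
    ((isBiderivation_quadBracket hφ).eval_of_hasGenFun (satisfiesQuadFormulas hg hφ).uv s t)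

theorem qad_u_w (s t : ℂ) : (σ s - σ t) * qad hφ (u s) (w t) =
    -2 * (v s * (p t * ph t) - v t * (p s * ph s)) -
      2 * (σ s - σ t) * alphaPhiAt g φ s t * u s * v t := by
  rw [← evalAt₂_quadUW g hφ]
  exact congrArg _
    ((isBiderivation_quadBracket hφ).eval_of_hasGenFun (satisfiesQuadFormulas hg hφ).uw s t)

theorem qad_v_w (s t : ℂ) : (σ s - σ t) * qad hφ (v s) (w t) =
    w s * (p t * ph t) - w t * (p s * ph s) -
      (σ s - σ t) * (σ s + σ t + 2 * d) * u s * (p t * ph t) +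
      (σ s - σ t) * alphaPhiAt g φ s t * u s * w t := by
  rw [← evalAt₂_quadVW g hφ]
  exact congrArg _
    ((isBiderivation_quadBracket hφ).eval_of_hasGenFun (satisfiesQuadFormulas hg hφ).vw s t)

theorem qad_w_w (s t : ℂ) : qad hφ (w s) (w t) =
    2 * (σ s + σ t + 2 * d) * (v s * (p t * ph t) - v t * (p s * ph s)) +
      2 * alphaPhiAt g φ s t * (w s * v t - w t * v s) := by
  rw [← evalAt₂_quadWW g hφ]
  exact (isBiderivation_quadBracket hφ).eval_of_hasGenFun (satisfiesQuadFormulas hg hφ).ww s t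

/-! The Mumford vector fields, multiplied by `x - y`. -/

omit hg in
noncomputable def fieldU (s : ℂ) : (OM g)[X] := C (2 * u s) * vM g - C (2 * v s) * uM g

omit hg in
noncomputable def fieldV (s : ℂ) : (OM g)[X] := C (w s) * uM g - C (u s) * redW g s

omit hg in
noncomputable def fieldW (s : ℂ) : (OM g)[X] := C (2 * v s) * redW g s - C (2 * w s) * vM g

omit hg in
theorem evalAt_fieldU (s t : ℂ) : evalAt (fieldU (g := g) s) t = 2 * (u s * v t - v s * u t) := by
  simp only [fieldU, evalAt_sub, evalAt_mul, evalAt_C, uAt, vAt]; ring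

omit hg in
theorem evalAt_fieldV (s t : ℂ) : evalAt (fieldV (g := g) s) t =
    w s * u t - w t * u s - (σ s - σ t) * (σ s + σ t + 2 * d) * u s * u t := by
  simp only [fieldV, evalAt_sub, evalAt_mul, evalAt_C, evalAt_redW, uAt, wAt]; ring

omit hg in
theorem evalAt_fieldW (s t : ℂ) : evalAt (fieldW (g := g) s) t =
    2 * (v s * w t - w s * v t) + 2 * (σ s - σ t) * (σ s + σ t + 2 * d) * v s * u t := by
  simp only [fieldW, evalAt_sub, evalAt_mul, evalAt_C, evalAt_redW, uAt, wAt, vAt]; ring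

omit hg in
theorem derivation_hAt (D : Derivation ℂ (OM g) (OM g)) (t : ℂ) :
    D (hAt g t) = u t * D (w t) + w t * D (u t) + 2 * v t * D (v t) := by
  rw [hAt_eq, map_add, sq, D.leibniz, D.leibniz]
  simp only [smul_eq_mul]
  ring

/-- The terms with p(s) φ(s) and those with α^φ cancel in the combination uw + v². The surviving
factor p(t) is what the square root argument rests on. -/
theorem qad_u_h (s t : ℂ) : (σ s - σ t) * qad hφ (u s) (hAt g t) =
    p t * (ph t * evalAt (fieldU s) t) := by
  rw [derivation_hAt, evalAt_fieldU, qad_u_u hφ hg]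
  linear_combination u t * qad_u_w hφ hg s t + 2 * v t * qad_u_v hφ hg s t

theorem qad_v_h (s t : ℂ) : (σ s - σ t) * qad hφ (v s) (hAt g t) =
    p t * (ph t * evalAt (fieldV s) t) := by
  rw [derivation_hAt, evalAt_fieldV, qad_v_v hφ hg, qad_skew hφ (v s) (u t)]
  linear_combination u t * qad_v_w hφ hg s t + w t * qad_u_v hφ hg t s -
    (σ s - σ t) * (u s * w t * u t) * alphaPhiAt_comm (g := g) (φ := φ) t s

theorem qad_w_h (s t : ℂ) : (σ s - σ t) * qad hφ (w s) (hAt g t) =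
    p t * (ph t * evalAt (fieldW s) t) := by
  rw [derivation_hAt, evalAt_fieldW, qad_w_w hφ hg, qad_skew hφ (w s) (u t),
    qad_skew hφ (w s) (v t)]
  rw [alphaPhiAt_comm s t]
  linear_combination w t * qad_u_w hφ hg t s + 2 * v t * qad_v_w hφ hg t s

omit hg in
-- Because E(s) = 0, the factor x - s cancels and p divides the polynomial D(r). The degree of D(r)
-- is smaller than that of the monic p, so D(r) = 0 and the cofactor of p vanishes as well; the
-- latter is the formula for D(p).
theorem sqrt_derivation (D : Derivation ℂ (OM g) (OM g)) (s : ℂ) (E : (OM g)[X])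
    (hE : evalAt E s = 0)
    (h : ∀ t, (σ s - σ t) * D (hAt g t) = p t * (ph t * evalAt E t)) :
    (∀ t, D (evalAt (rM g) t) = 0) ∧
      ∀ t, (σ s - σ t) * (2 * D (p t)) = ph t * evalAt E t := by
  obtain ⟨E', hE'⟩ := dvd_iff_isRoot.2 (show E.IsRoot (σ s) from hE)
  have hX : (X - C (σ s) : (OM g)[X]) ≠ 0 := X_sub_C_ne_zero _
  have key : pM g * (-(2 * coeffMap D.toLinearMap (pM g)) - liftC φ * E') =
      coeffMap D.toLinearMap (rM g) := by
    refine mul_left_cancel₀ hX (eq_of_evalAt ∅ fun t _ => ?_)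
    have h1 := h t
    rw [hAt, momentumM_eq, evalAt_add, evalAt_pow, map_add, sq, D.leibniz, hE'] at h1
    have h2 : evalAt (2 : (OM g)[X]) t = 2 := evalAt_ofNat 2 t
    simp only [smul_eq_mul, evalAt_mul, evalAt_sub, evalAt_X, evalAt_C, evalAt_neg, evalAt_liftC,
      evalAt_coeffMap, h2, phAt, pAt, Derivation.coeFn_coe] at h1 ⊢
    linear_combination h1
  have hQ : -(2 * coeffMap D.toLinearMap (pM g)) - liftC φ * E' = 0 := by
    by_contra hne
    -- D is applied to the coefficients, so it cannot raise the degree of r.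
    have hd : (coeffMap D.toLinearMap (rM g)).degree < (g + 1 : ℕ) := by
      rw [degree_lt_iff_coeff_zero]
      intro m hm
      have := degree_lt_iff_coeff_zero _ _ |>.1 (degree_rM g) m hm
      rw [coeff_coeffMap, this, map_zero]
    rw [← key, degree_mul, degree_eq_natDegree (pM_monic g).ne_zero, natDegree_pM,
      degree_eq_natDegree hne] at hd
    generalize (-(2 * coeffMap D.toLinearMap (pM g)) - liftC φ * E').natDegree = N at hd
    have : g + 1 + N < g + 1 := by exact_mod_cast hd
    omega
  rw [hQ, mul_zero] at key
  refine ⟨fun t => ?_, fun t => ?_⟩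
  · have h1 := evalAt_coeffMap D.toLinearMap (rM g) t
    rw [← key, evalAt_zero] at h1
    exact h1.symm
  · have h1 := congrArg (fun P => evalAt P t) hQ
    have h2 : evalAt (2 : (OM g)[X]) t = 2 := evalAt_ofNat 2 t
    simp only [evalAt_mul, evalAt_sub, evalAt_neg, evalAt_liftC, evalAt_coeffMap, h2,
      Derivation.coeFn_coe, evalAt_zero] at h1
    rw [hE', evalAt_mul, evalAt_sub, evalAt_X, evalAt_C, phAt, pAt]
    linear_combination (σ t - σ s) * h1

theorem qad_u_p (s t : ℂ) : (σ s - σ t) * (2 * qad hφ (u s) (p t)) =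
    ph t * (2 * (u s * v t - v s * u t)) := by
  rw [← evalAt_fieldU]
  exact (sqrt_derivation _ s _ (by rw [evalAt_fieldU]; ring) (qad_u_h hφ hg s)).2 t

theorem qad_v_p (s t : ℂ) : (σ s - σ t) * (2 * qad hφ (v s) (p t)) =
    ph t * (w s * u t - w t * u s - (σ s - σ t) * (σ s + σ t + 2 * d) * u s * u t) := by
  rw [← evalAt_fieldV]
  exact (sqrt_derivation _ s _ (by rw [evalAt_fieldV]; ring) (qad_v_h hφ hg s)).2 t

theorem qad_w_p (s t : ℂ) : (σ s - σ t) * (2 * qad hφ (w s) (p t)) =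
    ph t * (2 * (v s * w t - w s * v t) + 2 * (σ s - σ t) * (σ s + σ t + 2 * d) * v s * u t) := by
  rw [← evalAt_fieldW]
  exact (sqrt_derivation _ s _ (by rw [evalAt_fieldW]; ring) (qad_w_h hφ hg s)).2 t

/-- The coefficients of `r` are Casimirs. -/
theorem qad_r (f : OM g) (t : ℂ) : qad hφ f (evalAt (rM g) t) = 0 := by
  rw [qad_skew, neg_eq_zero]
  refine derivation_along_ext_uvw (AlgHom.id ℂ (OM g)) (qad hφ (evalAt (rM g) t)).toLinearMap
    (fun f f' => (qad hφ _).leibniz f f') ∅ (fun s _ => ?_) (fun s _ => ?_) (fun s _ => ?_) f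
  · change qad hφ _ _ = 0
    rw [qad_skew, neg_eq_zero]
    exact (sqrt_derivation _ s _ (by rw [evalAt_fieldU]; ring) (qad_u_h hφ hg s)).1 t
  · change qad hφ _ _ = 0
    rw [qad_skew, neg_eq_zero]
    exact (sqrt_derivation _ s _ (by rw [evalAt_fieldV]; ring) (qad_v_h hφ hg s)).1 t
  · change qad hφ _ _ = 0
    rw [qad_skew, neg_eq_zero]
    exact (sqrt_derivation _ s _ (by rw [evalAt_fieldW]; ring) (qad_w_h hφ hg s)).1 t

theorem qad_h (f : OM g) (t : ℂ) : qad hφ f (hAt g t) = 2 * p t * qad hφ f (p t) := by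
  rw [hAt, momentumM_eq, evalAt_add, map_add, qad_r hφ hg, evalAt_pow, sq, Derivation.leibniz,
    smul_eq_mul, pAt]
  ring

/-- The bracket {p(s), H(t)} is 2 p(t) {p(s), p(t)} on the one hand, and zero on the other when
expanded with the known brackets of p with u, v, w. The polynomial p can be cancelled since it is
monic. -/
theorem qad_p_p (s t : ℂ) : qad hφ (p s) (p t) = 0 := by
  suffices h : pM g * coeffMap (qad hφ (p s)).toLinearMap (pM g) = 0 by
    have h1 := evalAt_coeffMap (qad hφ (p s)).toLinearMap (pM g) t
    rw [(mul_eq_zero.1 h).resolve_left (pM_monic g).ne_zero, evalAt_zero] at h1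
    exact h1.symm
  refine eq_zero_of_evalAt {s} _ fun t ht => ?_
  have hts : t ≠ s := by simpa using ht
  rw [evalAt_mul, evalAt_coeffMap, Derivation.coeFn_coe]
  refine sub_mul_cancel hts ?_
  have h4 : (2 * 2 : OM g) ≠ 0 := mul_ne_zero two_ne_zero two_ne_zero
  refine mul_left_cancel₀ h4 ?_
  have h1 := qad_h hφ hg (p s) t
  have h2 := derivation_hAt (qad hφ (p s)) t
  rw [qad_skew hφ _ (u t), qad_skew hφ _ (v t), qad_skew hφ _ (w t)] at h2
  change 2 * 2 * ((σ t - σ s) * (p t * qad hφ (p s) (p t))) = 2 * 2 * ((σ t - σ s) * 0)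
  linear_combination -2 * (σ t - σ s) * h1 + 2 * (σ t - σ s) * h2 - u t * qad_w_p hφ hg t s -
    w t * qad_u_p hφ hg t s - 2 * v t * qad_v_p hφ hg t s

/-! Brackets with the constant `α(0) / 2`. -/

/-- The remainder of p has no term in x^g. Consequently brackets with d are leading coefficients of
brackets with p and u, and H need not be differentiated. -/
theorem coeff_pM_g : (pM g).coeff g = (uM g).coeff (g - 1) + d := by
  have hq : (pRem g).coeff g = 0 :=
    coeff_eq_zero_of_natDegree_lt (by have := natDegree_pRem hg; omega)
  obtain ⟨k, rfl⟩ : ∃ k, g = k + 1 := ⟨g - 1, by omega⟩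
  have hu := coeff_uM_of_le (k + 1) le_rfl
  rw [if_pos rfl, map_one] at hu
  rw [pM_eq, coeff_add, hq, add_mul, coeff_add, coeff_X_mul, coeff_C_mul, hu]
  simp

theorem qad_d (f : OM g) : qad hφ f d = qad hφ f ((pM g).coeff g) -
    qad hφ f ((uM g).coeff (g - 1)) := by
  rw [coeff_pM_g hg, map_add]
  ring

omit hg in
include hφ in
theorem coeff_liftC_mul (E : (OM g)[X]) (k : ℕ) :
    (liftC φ * E).coeff (k + 1) = σ (φ.coeff 1) * E.coeff k + σ (φ.coeff 0) * E.coeff (k + 1) := by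
  have h : (liftC φ : (OM g)[X]) = C (σ (φ.coeff 1)) * X + C (σ (φ.coeff 0)) := by
    conv_lhs => rw [eq_X_add_C_of_natDegree_le_one hφ, liftC]
    simp
  rw [h, add_mul, mul_assoc, coeff_add, coeff_C_mul, coeff_C_mul, coeff_X_mul]

omit hg in
-- Comparison of the coefficients of t^(g+1): the leading coefficient of p is constant, so only {f,
-- p_g}, multiplied by -t, contributes on the left.
theorem qad_coeff_p (f : OM g) (s : ℂ) (E : (OM g)[X]) (hE : E.natDegree ≤ g)
    (h : ∀ t, (σ s - σ t) * (2 * qad hφ f (p t)) = ph t * evalAt E t) :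
    2 * qad hφ f ((pM g).coeff g) = -σ (φ.coeff 1) * E.coeff g := by
  have h1 : C (2 * σ s) * coeffMap (qad hφ f).toLinearMap (pM g) -
      C 2 * (X * coeffMap (qad hφ f).toLinearMap (pM g)) = liftC φ * E := by
    refine eq_of_evalAt ∅ fun t _ => ?_
    simp only [evalAt_sub, evalAt_mul, evalAt_C, evalAt_X, evalAt_coeffMap, evalAt_liftC]
    rw [← phAt, ← h t]
    change 2 * σ s * qad hφ f (p t) - 2 * (σ t * qad hφ f (p t)) = _
    ring
  have h2 := congrArg (fun P => P.coeff (g + 1)) h1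
  have h3 : (pM g).coeff (g + 1) = σ 1 := by
    have := (pM_monic g).coeff_natDegree
    rwa [natDegree_pM, ← map_one σ] at this
  simp only [coeff_sub, coeff_C_mul, coeff_X_mul, coeff_coeffMap, coeff_liftC_mul hφ,
    Derivation.coeFn_coe, h3, qad_algebraMap] at h2
  rw [coeff_eq_zero_of_natDegree_lt (show E.natDegree < g + 1 by omega)] at h2
  linear_combination -h2

omit hg in
-- Comparison of the coefficients of t^g; the one of s D(u) vanishes because u_g = 1.
theorem coeff_sub_one_of_mul (hg : 1 ≤ g) (D : Derivation ℂ (OM g) (OM g)) (s : ℂ) (E : (OM g)[X])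
    (h : ∀ t, (σ t - σ s) * D (u t) = evalAt E t) : D ((uM g).coeff (g - 1)) = E.coeff g := by
  have h1 : X * coeffMap D.toLinearMap (uM g) - C (σ s) * coeffMap D.toLinearMap (uM g) = E := by
    refine eq_of_evalAt ∅ fun t _ => ?_
    simp only [evalAt_sub, evalAt_mul, evalAt_C, evalAt_X, evalAt_coeffMap]
    rw [← h t]
    change σ t * D (u t) - σ s * D (u t) = _
    ring
  obtain ⟨k, rfl⟩ : ∃ k, g = k + 1 := ⟨g - 1, by omega⟩
  rw [← h1, coeff_sub, coeff_X_mul, coeff_C_mul, coeff_coeffMap, coeff_coeffMap,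
    Derivation.coeFn_coe, coeff_uM_of_le (k + 1) le_rfl, D.map_algebraMap]
  simp

theorem qad_u_d (s : ℂ) : qad hφ (u s) d = σ (φ.coeff 1) * v s := by
  have h1 : qad hφ (u s) ((uM g).coeff (g - 1)) = 0 :=
    map_coeff_eq_zero ∅ (qad hφ (u s)).toLinearMap (uM g) (fun t _ => qad_u_u hφ hg s t) _
  have h2 := qad_coeff_p hφ (u s) s (fieldU s)
    (natDegree_sub_le' (natDegree_C_mul_le' _ _ _ ((natDegree_vM_le g).trans (by omega)))
      (natDegree_C_mul_le' _ _ _ (natDegree_uM g).le))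
    (fun t => by rw [qad_u_p hφ hg, evalAt_fieldU])
  rw [fieldU, coeff_sub, coeff_C_mul, coeff_C_mul, coeff_vM_of_le g le_rfl,
    coeff_uM_of_le g le_rfl, if_pos rfl, map_one, map_zero] at h2
  rw [qad_d hφ hg, h1]
  have h3 : (2 : OM g) ≠ 0 := two_ne_zero
  refine mul_left_cancel₀ h3 ?_
  linear_combination h2

/-- Both leading coefficients contain the unknown coefficient of x^(g-1) in `pRem`; it drops out of
their difference by `coeff_wRem`. -/
theorem qad_v_d (s : ℂ) : 2 * qad hφ (v s) d = 2 * (p s * ph s) - σ (φ.coeff 1) * w s -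
    u s * ((σ s + d) * (σ (φ.coeff 1) * (σ s - d) + 2 * σ (φ.coeff 0))) := by
  have hu1 : (uM g).coeff g = 1 := by rw [coeff_uM_of_le g le_rfl, if_pos rfl, map_one]
  have h1 := coeff_sub_one_of_mul hg (qad hφ (v s)) s
    (C (u s) * redP g φ s - C (p s * ph s) * uM g) (fun t => by
      rw [qad_skew hφ]
      simp only [evalAt_sub, evalAt_mul, evalAt_C, evalAt_redP hφ]
      have := qad_u_v hφ hg t s
      simp only [uAt] at this ⊢
      linear_combination -this)
  have h2 := qad_coeff_p hφ (v s) s (fieldV s)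
    (natDegree_sub_le' (natDegree_C_mul_le' _ _ _ (natDegree_uM g).le)
      (natDegree_C_mul_le' _ _ _ (natDegree_redW hg s)))
    (fun t => by rw [qad_v_p hφ hg, evalAt_fieldV])
  have hX : (X * pRem g).coeff g = (pRem g).coeff (g - 1) := by
    obtain ⟨k, rfl⟩ : ∃ k, g = k + 1 := ⟨g - 1, by omega⟩
    rw [coeff_X_mul]; rfl
  have hq : (pRem g).coeff g = 0 :=
    coeff_eq_zero_of_natDegree_lt (by have := natDegree_pRem hg; omega)
  rw [fieldV, redW] at h2
  rw [redP] at h1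
  simp only [coeff_sub, coeff_add, coeff_C_mul, hu1, coeff_wRem hg] at h2
  simp only [coeff_sub, coeff_add, coeff_C_mul, hu1, hX, hq] at h1
  rw [qad_d hφ hg, mul_sub, h1, h2]
  ring

theorem qad_p_d (s : ℂ) : qad hφ (p s) d = ph s * v s := by
  have hu1 : (uM g).coeff g = 1 := by rw [coeff_uM_of_le g le_rfl, if_pos rfl, map_one]
  have h1 : qad hφ (p s) ((pM g).coeff g) = 0 :=
    map_coeff_eq_zero ∅ (qad hφ (p s)).toLinearMap (pM g) (fun t _ => qad_p_p hφ hg s t) _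
  have h2 := coeff_sub_one_of_mul hg (qad hφ (p s)) s
    (-(C (ph s) * (C (v s) * uM g - C (u s) * vM g))) (fun t => by
      rw [qad_skew hφ]
      simp only [evalAt_sub, evalAt_mul, evalAt_C, evalAt_neg]
      have h3 : (2 : OM g) ≠ 0 := two_ne_zero
      refine mul_left_cancel₀ h3 ?_
      have := qad_u_p hφ hg t s
      simp only [uAt, vAt] at this ⊢
      linear_combination -this)
  simp only [coeff_sub, coeff_neg, coeff_C_mul, hu1, coeff_vM_of_le g le_rfl, map_zero] at h2
  rw [qad_d hφ hg, h1, h2]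
  ring

end

end PrymToda

namespace PrymToda

open Polynomial

/-! ## The Jacobi identity for the quadratic bracket -/

section

set_option linter.unusedSimpArgs false

variable {g : ℕ} {φ : ℂ[X]} (hφ : φ.natDegree ≤ 1) (hg : 1 ≤ g)

local notation "σ" => algebraMap ℂ (OM g)
local notation "d" => halfAlpha g
local notation "u" => uAt g
local notation "v" => vAt g
local notation "w" => wAt g
local notation "p" => pAt g
local notation "ph" => phAt (OM g) φ
local notation "j" => algebraMap (OM g) (FractionRing (OM g))
local notation "S" => fun s : ℂ => algebraMap (OM g) (FractionRing (OM g)) (algebraMap ℂ (OM g) s)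
local notation "f₁" => algebraMap (OM g) (FractionRing (OM g)) (algebraMap ℂ (OM g) (coeff φ 1))
local notation "f₀" => algebraMap (OM g) (FractionRing (OM g)) (algebraMap ℂ (OM g) (coeff φ 0))

/-- The Jacobi identities are verified in the fraction field, where the brackets can be solved for
and substituted with their denominators. -/
theorem frac_sub_ne {s t : ℂ} (h : s ≠ t) : j (σ s) - j (σ t) ≠ 0 := by
  rw [← map_sub j]
  exact ((algebraMap_sub_isUnit h).map j).ne_zero

theorem frac_injective : Function.Injective j := IsFractionRing.injective _ _

theorem derivation_ph (D : Derivation ℂ (OM g) (OM g)) (s : ℂ) : D (ph s) = 0 :=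
  D.map_algebraMap _

theorem derivation_two (D : Derivation ℂ (OM g) (OM g)) : D 2 = 0 := by
  rw [← map_ofNat σ 2, D.map_algebraMap]

include hg

/-- An arbitrary derivation is applied to the formula for {u, v} cleared of denominators; it kills
the scalars and φ but not d. With D = {f, ·} this evaluates all iterated brackets. -/
theorem frac_D_uv (D : Derivation ℂ (OM g) (OM g)) {s t : ℂ} (h : s ≠ t) :
    j (D (qad hφ (u s) (v t))) =
      (j (D (u s)) * j (p t) * j (ph t) + j (u s) * j (D (p t)) * j (ph t) -
        j (D (u t)) * j (p s) * j (ph s) - j (u t) * j (D (p s)) * j (ph s)) / (S s - S t) +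
      f₁ * j (D d) * j (u s) * j (u t) + (f₁ * (S s + S t + j d) + f₀) *
        (j (D (u s)) * j (u t) + j (u s) * j (D (u t))) := by
  have hne := frac_sub_ne (g := g) h
  have h1 := congrArg (fun f => j (D f)) (qad_u_v hφ hg s t)
  simp only [map_add, map_sub, Derivation.leibniz, derivation_ph,
    Derivation.map_algebraMap, smul_eq_mul, mul_zero, zero_add, sub_self,
    map_mul, alphaPhiAt, map_zero] at h1
  field_simp
  linear_combination h1

theorem frac_uv {s t : ℂ} (h : s ≠ t) : j (qad hφ (u s) (v t)) =
    (j (u s) * j (p t) * j (ph t) - j (u t) * j (p s) * j (ph s)) / (S s - S t) +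
      (f₁ * (S s + S t + j d) + f₀) * j (u s) * j (u t) := by
  have hne := frac_sub_ne (g := g) h
  have h1 := congrArg (fun f => j f) (qad_u_v hφ hg s t)
  simp only [map_add, map_sub, map_mul, alphaPhiAt] at h1
  field_simp
  linear_combination h1

theorem frac_up {s t : ℂ} (h : s ≠ t) : j (qad hφ (u s) (p t)) =
    j (ph t) * (j (u s) * j (v t) - j (v s) * j (u t)) / (S s - S t) := by
  have hne := frac_sub_ne (g := g) h
  have h1 := congrArg (fun f => j f) (qad_u_p hφ hg s t)
  simp only [map_sub, map_mul, map_ofNat] at h1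
  field_simp
  linear_combination h1 / 2

theorem frac_uw {s t : ℂ} (h : s ≠ t) : j (qad hφ (u s) (w t)) =
    -2 * (j (v s) * j (p t) * j (ph t) - j (v t) * j (p s) * j (ph s)) / (S s - S t) -
      2 * (f₁ * (S s + S t + j d) + f₀) * j (u s) * j (v t) := by
  have hne := frac_sub_ne (g := g) h
  have h1 := congrArg (fun f => j f) (qad_u_w hφ hg s t)
  simp only [map_add, map_sub, map_mul, map_neg, map_ofNat, alphaPhiAt] at h1
  field_simp
  linear_combination h1

theorem frac_vw {s t : ℂ} (h : s ≠ t) : j (qad hφ (v s) (w t)) =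
    (j (w s) * j (p t) * j (ph t) - j (w t) * j (p s) * j (ph s)) / (S s - S t) -
      (S s + S t + 2 * j d) * j (u s) * j (p t) * j (ph t) +
      (f₁ * (S s + S t + j d) + f₀) * j (u s) * j (w t) := by
  have hne := frac_sub_ne (g := g) h
  have h1 := congrArg (fun f => j f) (qad_v_w hφ hg s t)
  simp only [map_add, map_sub, map_mul, map_ofNat, alphaPhiAt] at h1
  field_simp
  linear_combination h1

theorem frac_vp {s t : ℂ} (h : s ≠ t) : j (qad hφ (v s) (p t)) =
    j (ph t) / 2 * ((j (w s) * j (u t) - j (w t) * j (u s)) / (S s - S t) -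
      (S s + S t + 2 * j d) * j (u s) * j (u t)) := by
  have hne := frac_sub_ne (g := g) h
  have h1 := congrArg (fun f => j f) (qad_v_p hφ hg s t)
  simp only [map_add, map_sub, map_mul, map_ofNat] at h1
  field_simp
  linear_combination h1

theorem frac_wp {s t : ℂ} (h : s ≠ t) : j (qad hφ (w s) (p t)) =
    j (ph t) * ((j (v s) * j (w t) - j (w s) * j (v t)) / (S s - S t) +
      (S s + S t + 2 * j d) * j (v s) * j (u t)) := by
  have hne := frac_sub_ne (g := g) h
  have h1 := congrArg (fun f => j f) (qad_w_p hφ hg s t)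
  simp only [map_add, map_sub, map_mul, map_ofNat] at h1
  field_simp
  linear_combination h1 / 2

theorem frac_vu {s t : ℂ} (h : s ≠ t) : j (qad hφ (v s) (u t)) =
    -((j (u t) * j (p s) * j (ph s) - j (u s) * j (p t) * j (ph t)) / (S t - S s) +
      (f₁ * (S t + S s + j d) + f₀) * j (u t) * j (u s)) := by
  rw [qad_skew, map_neg, frac_uv hφ hg h.symm]

theorem frac_pu {s t : ℂ} (h : s ≠ t) : j (qad hφ (p s) (u t)) =
    -(j (ph s) * (j (u t) * j (v s) - j (v t) * j (u s)) / (S t - S s)) := by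
  rw [qad_skew, map_neg, frac_up hφ hg h.symm]

theorem frac_pv {s t : ℂ} (h : s ≠ t) : j (qad hφ (p s) (v t)) =
    -(j (ph s) / 2 * ((j (w t) * j (u s) - j (w s) * j (u t)) / (S t - S s) -
      (S t + S s + 2 * j d) * j (u t) * j (u s))) := by
  rw [qad_skew, map_neg, frac_vp hφ hg h.symm]

theorem frac_pw {s t : ℂ} (h : s ≠ t) : j (qad hφ (p s) (w t)) =
    -(j (ph s) * ((j (v t) * j (w s) - j (w t) * j (v s)) / (S t - S s) +
      (S t + S s + 2 * j d) * j (v t) * j (u s))) := by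
  rw [qad_skew, map_neg, frac_wp hφ hg h.symm]

theorem frac_vd (s : ℂ) : j (qad hφ (v s) d) = j (p s) * j (ph s) - f₁ * j (w s) / 2 -
    j (u s) * ((S s + j d) * (f₁ * (S s - j d) + 2 * f₀)) / 2 := by
  have h1 := congrArg (fun f => j f) (qad_v_d hφ hg s)
  simp only [map_add, map_sub, map_mul, map_ofNat] at h1
  field_simp
  linear_combination h1

theorem frac_D_up (D : Derivation ℂ (OM g) (OM g)) {s t : ℂ} (h : s ≠ t) :
    j (D (qad hφ (u s) (p t))) = j (ph t) * (j (D (u s)) * j (v t) + j (u s) * j (D (v t)) -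
      j (D (v s)) * j (u t) - j (v s) * j (D (u t))) / (S s - S t) := by
  have hne := frac_sub_ne (g := g) h
  have h1 := congrArg (fun f => j (D f)) (qad_u_p hφ hg s t)
  simp only [map_add, map_sub, Derivation.leibniz, derivation_ph,
    derivation_two, Derivation.map_algebraMap, smul_eq_mul, mul_zero, zero_add, add_zero, sub_self,
    map_mul, map_ofNat] at h1
  field_simp
  linear_combination h1 / 2

theorem frac_D_vp (D : Derivation ℂ (OM g) (OM g)) {s t : ℂ} (h : s ≠ t) :
    j (D (qad hφ (v s) (p t))) = j (ph t) / 2 *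
      ((j (D (w s)) * j (u t) + j (w s) * j (D (u t)) - j (D (w t)) * j (u s) -
        j (w t) * j (D (u s))) / (S s - S t) - 2 * j (D d) * j (u s) * j (u t) -
      (S s + S t + 2 * j d) * (j (D (u s)) * j (u t) + j (u s) * j (D (u t)))) := by
  have hne := frac_sub_ne (g := g) h
  have h1 := congrArg (fun f => j (D f)) (qad_v_p hφ hg s t)
  simp only [map_add, map_sub, Derivation.leibniz, derivation_ph,
    derivation_two, Derivation.map_algebraMap, smul_eq_mul, mul_zero, zero_add, add_zero, sub_self,
    map_mul, map_ofNat] at h1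
  field_simp
  linear_combination h1

/-- Since {u, u} = 0, the Jacobi identity has only two terms. The same happens for every triple from
u, v, p in which one letter is repeated; only (u, v, p) has three. -/
theorem qad_jacobi_uuv {x y z : ℂ} (hxy : x ≠ y) (hyz : y ≠ z) (hxz : x ≠ z) :
    qad hφ (u x) (qad hφ (u y) (v z)) = qad hφ (u y) (qad hφ (u x) (v z)) := by
  refine frac_injective ?_
  have h1 := frac_sub_ne (g := g) hxy
  have h2 := frac_sub_ne (g := g) hyz
  have h3 := frac_sub_ne (g := g) hxz
  -- All denominators are brought to the same orientation, so that three nonzero differences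
  -- suffice.
  have e1 : j (σ y) - j (σ x) = -(j (σ x) - j (σ y)) := (neg_sub _ _).symm
  have e2 : j (σ z) - j (σ y) = -(j (σ y) - j (σ z)) := (neg_sub _ _).symm
  have e3 : j (σ z) - j (σ x) = -(j (σ x) - j (σ z)) := (neg_sub _ _).symm
  rw [frac_D_uv hφ hg _ hyz, frac_D_uv hφ hg _ hxz, frac_up hφ hg hxy, 
    frac_up hφ hg hxy.symm, frac_up hφ hg hyz, frac_up hφ hg hxz]
  simp only [qad_u_u hφ hg, qad_u_d hφ hg, phAt_eq hφ, map_add, map_mul, map_zero, zero_mul, mul_zero, e1, e2, e3, div_neg]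
  clear e1 e2 e3
  -- From here on the values are independent variables: the identity is one of rational functions
  -- and uses no relation such as H = p² + r.
  generalize j (σ x) = ξ₁ at *
  generalize j (σ y) = ξ₂ at *
  generalize j (σ z) = ξ₃ at *
  generalize f₁ = c₁, f₀ = c₀, j d = c
  generalize j (u x) = u₁, j (u y) = u₂, j (u z) = u₃, j (v x) = v₁, j (v y) = v₂, j (v z) = v₃,
    j (w x) = w₁, j (w y) = w₂, j (w z) = w₃, j (p x) = p₁, j (p y) = p₂, j (p z) = p₃
  field_simp
  ring

theorem qad_jacobi_vvu {x y z : ℂ} (hxy : x ≠ y) (hyz : y ≠ z) (hxz : x ≠ z) :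
    qad hφ (v y) (qad hφ (u x) (v z)) = qad hφ (v z) (qad hφ (u x) (v y)) := by
  refine frac_injective ?_
  have h1 := frac_sub_ne (g := g) hxy
  have h2 := frac_sub_ne (g := g) hyz
  have h3 := frac_sub_ne (g := g) hxz
  have e1 : j (σ y) - j (σ x) = -(j (σ x) - j (σ y)) := (neg_sub _ _).symm
  have e2 : j (σ z) - j (σ y) = -(j (σ y) - j (σ z)) := (neg_sub _ _).symm
  have e3 : j (σ z) - j (σ x) = -(j (σ x) - j (σ z)) := (neg_sub _ _).symm
  rw [frac_D_uv hφ hg _ hxz, frac_D_uv hφ hg _ hxy, frac_vu hφ hg hxy.symm, 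
    frac_vu hφ hg hyz, frac_vu hφ hg hxz.symm, frac_vu hφ hg hyz.symm, 
    frac_vp hφ hg hxy.symm, frac_vp hφ hg hyz, frac_vp hφ hg hxz.symm, 
    frac_vp hφ hg hyz.symm, frac_vd hφ hg y, frac_vd hφ hg z]
  simp only [phAt_eq hφ, map_add, map_mul, map_zero, zero_mul, mul_zero, e1, e2, e3, div_neg]
  clear e1 e2 e3
  generalize j (σ x) = ξ₁ at *
  generalize j (σ y) = ξ₂ at *
  generalize j (σ z) = ξ₃ at *
  generalize f₁ = c₁, f₀ = c₀, j d = c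
  generalize j (u x) = u₁, j (u y) = u₂, j (u z) = u₃, j (v x) = v₁, j (v y) = v₂, j (v z) = v₃,
    j (w x) = w₁, j (w y) = w₂, j (w z) = w₃, j (p x) = p₁, j (p y) = p₂, j (p z) = p₃
  field_simp
  ring

theorem qad_jacobi_uup {x y z : ℂ} (hxy : x ≠ y) (hyz : y ≠ z) (hxz : x ≠ z) :
    qad hφ (u x) (qad hφ (u y) (p z)) = qad hφ (u y) (qad hφ (u x) (p z)) := by
  refine frac_injective ?_
  have h1 := frac_sub_ne (g := g) hxy
  have h2 := frac_sub_ne (g := g) hyz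
  have h3 := frac_sub_ne (g := g) hxz
  have e1 : j (σ y) - j (σ x) = -(j (σ x) - j (σ y)) := (neg_sub _ _).symm
  have e2 : j (σ z) - j (σ y) = -(j (σ y) - j (σ z)) := (neg_sub _ _).symm
  have e3 : j (σ z) - j (σ x) = -(j (σ x) - j (σ z)) := (neg_sub _ _).symm
  rw [frac_D_up hφ hg _ hyz, frac_D_up hφ hg _ hxz, frac_uv hφ hg hxy, 
    frac_uv hφ hg hxz, frac_uv hφ hg hxy.symm, frac_uv hφ hg hyz]
  simp only [qad_u_u hφ hg, phAt_eq hφ, map_add, map_mul, map_zero, zero_mul, mul_zero, e1, e2, e3, div_neg]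
  clear e1 e2 e3
  generalize j (σ x) = ξ₁ at *
  generalize j (σ y) = ξ₂ at *
  generalize j (σ z) = ξ₃ at *
  generalize f₁ = c₁, f₀ = c₀, j d = c
  generalize j (u x) = u₁, j (u y) = u₂, j (u z) = u₃, j (v x) = v₁, j (v y) = v₂, j (v z) = v₃,
    j (w x) = w₁, j (w y) = w₂, j (w z) = w₃, j (p x) = p₁, j (p y) = p₂, j (p z) = p₃
  field_simp
  ring

theorem qad_jacobi_uvp {x y z : ℂ} (hxy : x ≠ y) (hyz : y ≠ z) (hxz : x ≠ z) :
    qad hφ (u x) (qad hφ (v y) (p z)) =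
      qad hφ (v y) (qad hφ (u x) (p z)) - qad hφ (p z) (qad hφ (u x) (v y)) := by
  refine frac_injective ?_
  have h1 := frac_sub_ne (g := g) hxy
  have h2 := frac_sub_ne (g := g) hyz
  have h3 := frac_sub_ne (g := g) hxz
  have e1 : j (σ y) - j (σ x) = -(j (σ x) - j (σ y)) := (neg_sub _ _).symm
  have e2 : j (σ z) - j (σ y) = -(j (σ y) - j (σ z)) := (neg_sub _ _).symm
  have e3 : j (σ z) - j (σ x) = -(j (σ x) - j (σ z)) := (neg_sub _ _).symm
  rw [map_sub j]
  rw [frac_D_vp hφ hg _ hyz, frac_D_up hφ hg _ hxz, frac_D_uv hφ hg _ hxy, 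
    frac_uw hφ hg hxy, frac_uw hφ hg hxz, frac_vu hφ hg hxy.symm, frac_vu hφ hg hyz, 
    frac_pu hφ hg hxz.symm, frac_pu hφ hg hyz.symm]
  simp only [qad_u_u hφ hg, qad_v_v hφ hg, qad_p_p hφ hg, qad_u_d hφ hg, qad_p_d hφ hg, phAt_eq hφ, map_add, map_mul, map_zero, zero_mul, mul_zero, e1, e2, e3, div_neg]
  clear e1 e2 e3
  generalize j (σ x) = ξ₁ at *
  generalize j (σ y) = ξ₂ at *
  generalize j (σ z) = ξ₃ at *
  generalize f₁ = c₁, f₀ = c₀, j d = c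
  generalize j (u x) = u₁, j (u y) = u₂, j (u z) = u₃, j (v x) = v₁, j (v y) = v₂, j (v z) = v₃,
    j (w x) = w₁, j (w y) = w₂, j (w z) = w₃, j (p x) = p₁, j (p y) = p₂, j (p z) = p₃
  field_simp
  ring

theorem qad_jacobi_vvp {x y z : ℂ} (hxy : x ≠ y) (hyz : y ≠ z) (hxz : x ≠ z) :
    qad hφ (v x) (qad hφ (v y) (p z)) = qad hφ (v y) (qad hφ (v x) (p z)) := by
  refine frac_injective ?_
  have h1 := frac_sub_ne (g := g) hxy
  have h2 := frac_sub_ne (g := g) hyz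
  have h3 := frac_sub_ne (g := g) hxz
  have e1 : j (σ y) - j (σ x) = -(j (σ x) - j (σ y)) := (neg_sub _ _).symm
  have e2 : j (σ z) - j (σ y) = -(j (σ y) - j (σ z)) := (neg_sub _ _).symm
  have e3 : j (σ z) - j (σ x) = -(j (σ x) - j (σ z)) := (neg_sub _ _).symm
  rw [frac_D_vp hφ hg _ hyz, frac_D_vp hφ hg _ hxz, frac_vw hφ hg hxy, 
    frac_vw hφ hg hxz, frac_vw hφ hg hxy.symm, frac_vw hφ hg hyz, frac_vu hφ hg hxy, 
    frac_vu hφ hg hxz, frac_vu hφ hg hxy.symm, frac_vu hφ hg hyz, frac_vd hφ hg x, 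
    frac_vd hφ hg y]
  simp only [phAt_eq hφ, map_add, map_mul, map_zero, zero_mul, mul_zero, e1, e2, e3, div_neg]
  clear e1 e2 e3
  generalize j (σ x) = ξ₁ at *
  generalize j (σ y) = ξ₂ at *
  generalize j (σ z) = ξ₃ at *
  generalize f₁ = c₁, f₀ = c₀, j d = c
  generalize j (u x) = u₁, j (u y) = u₂, j (u z) = u₃, j (v x) = v₁, j (v y) = v₂, j (v z) = v₃,
    j (w x) = w₁, j (w y) = w₂, j (w z) = w₃, j (p x) = p₁, j (p y) = p₂, j (p z) = p₃
  field_simp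
  ring

theorem qad_jacobi_upp {x y z : ℂ} (hxy : x ≠ y) (hyz : y ≠ z) (hxz : x ≠ z) :
    qad hφ (p y) (qad hφ (u x) (p z)) = qad hφ (p z) (qad hφ (u x) (p y)) := by
  refine frac_injective ?_
  have h1 := frac_sub_ne (g := g) hxy
  have h2 := frac_sub_ne (g := g) hyz
  have h3 := frac_sub_ne (g := g) hxz
  have e1 : j (σ y) - j (σ x) = -(j (σ x) - j (σ y)) := (neg_sub _ _).symm
  have e2 : j (σ z) - j (σ y) = -(j (σ y) - j (σ z)) := (neg_sub _ _).symm
  have e3 : j (σ z) - j (σ x) = -(j (σ x) - j (σ z)) := (neg_sub _ _).symm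
  rw [frac_D_up hφ hg _ hxz, frac_D_up hφ hg _ hxy, frac_pu hφ hg hxy.symm, 
    frac_pu hφ hg hyz, frac_pu hφ hg hxz.symm, frac_pu hφ hg hyz.symm, 
    frac_pv hφ hg hxy.symm, frac_pv hφ hg hyz, frac_pv hφ hg hxz.symm, 
    frac_pv hφ hg hyz.symm]
  simp only [phAt_eq hφ, map_add, map_mul, map_zero, zero_mul, mul_zero, e1, e2, e3, div_neg]
  clear e1 e2 e3
  generalize j (σ x) = ξ₁ at *
  generalize j (σ y) = ξ₂ at *
  generalize j (σ z) = ξ₃ at *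
  generalize f₁ = c₁, f₀ = c₀, j d = c
  generalize j (u x) = u₁, j (u y) = u₂, j (u z) = u₃, j (v x) = v₁, j (v y) = v₂, j (v z) = v₃,
    j (w x) = w₁, j (w y) = w₂, j (w z) = w₃, j (p x) = p₁, j (p y) = p₂, j (p z) = p₃
  field_simp
  ring

theorem qad_jacobi_vpp {x y z : ℂ} (hxy : x ≠ y) (hyz : y ≠ z) (hxz : x ≠ z) :
    qad hφ (p y) (qad hφ (v x) (p z)) = qad hφ (p z) (qad hφ (v x) (p y)) := by
  refine frac_injective ?_
  have h1 := frac_sub_ne (g := g) hxy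
  have h2 := frac_sub_ne (g := g) hyz
  have h3 := frac_sub_ne (g := g) hxz
  have e1 : j (σ y) - j (σ x) = -(j (σ x) - j (σ y)) := (neg_sub _ _).symm
  have e2 : j (σ z) - j (σ y) = -(j (σ y) - j (σ z)) := (neg_sub _ _).symm
  have e3 : j (σ z) - j (σ x) = -(j (σ x) - j (σ z)) := (neg_sub _ _).symm
  rw [frac_D_vp hφ hg _ hxz, frac_D_vp hφ hg _ hxy, frac_pu hφ hg hxy.symm, 
    frac_pu hφ hg hyz, frac_pu hφ hg hxz.symm, frac_pu hφ hg hyz.symm, 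
    frac_pw hφ hg hxy.symm, frac_pw hφ hg hyz, frac_pw hφ hg hxz.symm, 
    frac_pw hφ hg hyz.symm]
  simp only [qad_p_d hφ hg, phAt_eq hφ, map_add, map_mul, map_zero, zero_mul, mul_zero, e1, e2, e3, div_neg]
  clear e1 e2 e3
  generalize j (σ x) = ξ₁ at *
  generalize j (σ y) = ξ₂ at *
  generalize j (σ z) = ξ₃ at *
  generalize f₁ = c₁, f₀ = c₀, j d = c
  generalize j (u x) = u₁, j (u y) = u₂, j (u z) = u₃, j (v x) = v₁, j (v y) = v₂, j (v z) = v₃,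
    j (w x) = w₁, j (w y) = w₂, j (w z) = w₃, j (p x) = p₁, j (p y) = p₂, j (p z) = p₃
  field_simp
  ring

end

end PrymToda

/-! ### The Jacobiator, tested on u, v and p. -/

namespace PrymToda

open Polynomial

section

variable {g : ℕ} {φ : ℂ[X]} (hφ : φ.natDegree ≤ 1) (hg : 1 ≤ g)

/-- The Jacobiator `{f, {f', ·}} - {f', {f, ·}} - {{f, f'}, ·}`. -/
noncomputable def jacobiator (f f' : OM g) : Derivation ℂ (OM g) (OM g) :=
  ⁅qad hφ f, qad hφ f'⁆ - qad hφ (qad hφ f f')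

theorem jacobiator_apply (f f' f'' : OM g) : jacobiator hφ f f' f'' =
    qad hφ f (qad hφ f' f'') - qad hφ f' (qad hφ f f'') - qad hφ (qad hφ f f') f'' := by
  simp [jacobiator, Derivation.commutator_apply]

theorem jacobiator_skew (f f' f'' : OM g) :
    jacobiator hφ f f' f'' = -jacobiator hφ f' f f'' := by
  rw [jacobiator_apply, jacobiator_apply, qad_skew hφ (qad hφ f f'), qad_skew hφ f f', map_neg,
    qad_skew hφ (qad hφ f' f)]
  ring

/-- With skewness this moves any argument into the last place, where the Jacobiator is visibly a
derivation. -/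
theorem jacobiator_cycle (f f' f'' : OM g) :
    jacobiator hφ f f' f'' = jacobiator hφ f'' f f' := by
  rw [jacobiator_apply, jacobiator_apply, qad_skew hφ (qad hφ f f'), qad_skew hφ (qad hφ f'' f),
    qad_skew hφ f'' f', qad_skew hφ f'' f, map_neg, map_neg]
  ring

include hg

/-- As r is Casimir, only p² contributes. This replaces H by p in the test functions. -/
theorem jacobiator_hAt (f f' : OM g) (t : ℂ) :
    jacobiator hφ f f' (hAt g t) = 2 * pAt g t * jacobiator hφ f f' (pAt g t) := by
  have hr : jacobiator hφ f f' (evalAt (rM g) t) = 0 := by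
    rw [jacobiator_apply, qad_r hφ hg, qad_r hφ hg, qad_r hφ hg]
    simp
  rw [hAt, momentumM_eq, evalAt_add, map_add, hr, evalAt_pow, sq, Derivation.leibniz,
    smul_eq_mul, pAt]
  ring

theorem jacobiator_ext (f f' : OM g) (F : Finset ℂ)
    (hu : ∀ s ∉ F, jacobiator hφ f f' (uAt g s) = 0)
    (hv : ∀ s ∉ F, jacobiator hφ f f' (vAt g s) = 0)
    (hp : ∀ s ∉ F, jacobiator hφ f f' (pAt g s) = 0) : jacobiator hφ f f' = 0 :=
  derivation_ext _ F hu hv fun s hs => by rw [jacobiator_hAt hφ hg, hp s hs, mul_zero]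

/-- The test point z only has to avoid x and y, since finitely many exceptions are harmless;
therefore the identities at three distinct points are enough. -/
theorem jacobiator_uu {x y : ℂ} (hxy : x ≠ y) :
    jacobiator hφ (uAt g x) (uAt g y) = 0 := by
  refine jacobiator_ext hφ hg _ _ {x, y} (fun z hz => ?_) (fun z hz => ?_) fun z hz => ?_ <;>
  · simp only [Finset.mem_insert, Finset.mem_singleton, not_or] at hz
    rw [jacobiator_apply, qad_u_u hφ hg x y, qad_skew hφ 0]
    first
      | rw [qad_u_u hφ hg, qad_u_u hφ hg]; simp
      | rw [qad_jacobi_uuv hφ hg hxy (Ne.symm hz.2) (Ne.symm hz.1)]; simp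
      | rw [qad_jacobi_uup hφ hg hxy (Ne.symm hz.2) (Ne.symm hz.1)]; simp

theorem jacobiator_uv {x y : ℂ} (hxy : x ≠ y) :
    jacobiator hφ (uAt g x) (vAt g y) = 0 := by
  refine jacobiator_ext hφ hg _ _ {x, y} (fun z hz => ?_) (fun z hz => ?_) fun z hz => ?_ <;>
    simp only [Finset.mem_insert, Finset.mem_singleton, not_or] at hz
  · rw [jacobiator_cycle, jacobiator_uu hφ hg hz.1]; rfl
  · rw [jacobiator_apply, qad_v_v hφ hg, map_zero,
      qad_jacobi_vvu hφ hg hxy (Ne.symm hz.2) (Ne.symm hz.1), qad_skew hφ (qad hφ _ _)]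
    ring
  · rw [jacobiator_apply, qad_jacobi_uvp hφ hg hxy (Ne.symm hz.2) (Ne.symm hz.1),
      qad_skew hφ (qad hφ _ _)]
    ring

theorem jacobiator_vv {x y : ℂ} (hxy : x ≠ y) :
    jacobiator hφ (vAt g x) (vAt g y) = 0 := by
  refine jacobiator_ext hφ hg _ _ {x, y} (fun z hz => ?_) (fun z hz => ?_) fun z hz => ?_ <;>
    simp only [Finset.mem_insert, Finset.mem_singleton, not_or] at hz
  · rw [jacobiator_cycle, jacobiator_uv hφ hg hz.1]; rfl
  · rw [jacobiator_apply, qad_v_v hφ hg, qad_v_v hφ hg, qad_v_v hφ hg, qad_skew hφ 0]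
    simp
  · rw [jacobiator_apply, qad_jacobi_vvp hφ hg hxy (Ne.symm hz.2) (Ne.symm hz.1), qad_v_v hφ hg,
      qad_skew hφ 0]
    simp

theorem jacobiator_up {x y : ℂ} (hxy : x ≠ y) :
    jacobiator hφ (uAt g x) (pAt g y) = 0 := by
  refine jacobiator_ext hφ hg _ _ {x, y} (fun z hz => ?_) (fun z hz => ?_) fun z hz => ?_ <;>
    simp only [Finset.mem_insert, Finset.mem_singleton, not_or] at hz
  · rw [jacobiator_cycle, jacobiator_uu hφ hg hz.1]; rfl
  · rw [jacobiator_cycle, jacobiator_skew, jacobiator_uv hφ hg (Ne.symm hz.1)]; simp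
  · rw [jacobiator_apply, qad_p_p hφ hg, map_zero,
      qad_jacobi_upp hφ hg hxy (Ne.symm hz.2) (Ne.symm hz.1), qad_skew hφ (qad hφ _ _)]
    ring

theorem jacobiator_vp {x y : ℂ} (hxy : x ≠ y) :
    jacobiator hφ (vAt g x) (pAt g y) = 0 := by
  refine jacobiator_ext hφ hg _ _ {x, y} (fun z hz => ?_) (fun z hz => ?_) fun z hz => ?_ <;>
    simp only [Finset.mem_insert, Finset.mem_singleton, not_or] at hz
  · rw [jacobiator_cycle, jacobiator_uv hφ hg hz.1]; rfl
  · rw [jacobiator_cycle, jacobiator_vv hφ hg hz.1]; rfl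
  · rw [jacobiator_apply, qad_p_p hφ hg, map_zero,
      qad_jacobi_vpp hφ hg hxy (Ne.symm hz.2) (Ne.symm hz.1), qad_skew hφ (qad hφ _ _)]
    ring

theorem jacobiator_pp {x y : ℂ} : jacobiator hφ (pAt g x) (pAt g y) = 0 := by
  refine jacobiator_ext hφ hg _ _ {x, y} (fun z hz => ?_) (fun z hz => ?_) fun z hz => ?_ <;>
    simp only [Finset.mem_insert, Finset.mem_singleton, not_or] at hz
  · rw [jacobiator_cycle, jacobiator_up hφ hg hz.1]; rfl
  · rw [jacobiator_cycle, jacobiator_vp hφ hg hz.1]; rfl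
  · rw [jacobiator_apply, qad_p_p hφ hg, qad_p_p hφ hg, qad_p_p hφ hg, qad_skew hφ 0]
    simp

/-- With f moved out of the last place, the remaining argument is tested on generators at points
other than x. This removes both the special form of f and the distinctness of the points. -/
theorem jacobiator_u (x : ℂ) (f : OM g) : jacobiator hφ (uAt g x) f = 0 := by
  refine jacobiator_ext hφ hg _ _ {x} (fun z hz => ?_) (fun z hz => ?_) fun z hz => ?_ <;>
    simp only [Finset.mem_singleton] at hz <;> rw [jacobiator_cycle, jacobiator_skew]
  · rw [jacobiator_uu hφ hg (Ne.symm hz)]; simp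
  · rw [jacobiator_uv hφ hg (Ne.symm hz)]; simp
  · rw [jacobiator_up hφ hg (Ne.symm hz)]; simp

theorem jacobiator_v (x : ℂ) (f : OM g) : jacobiator hφ (vAt g x) f = 0 := by
  refine jacobiator_ext hφ hg _ _ {x} (fun z hz => ?_) (fun z hz => ?_) fun z hz => ?_ <;>
    simp only [Finset.mem_singleton] at hz
  · rw [jacobiator_cycle, jacobiator_u]; rfl; exact hg
  · rw [jacobiator_cycle, jacobiator_vv hφ hg hz]; rfl
  · rw [jacobiator_cycle, jacobiator_skew, jacobiator_vp hφ hg (Ne.symm hz)]; simp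

theorem jacobiator_p (x : ℂ) (f : OM g) : jacobiator hφ (pAt g x) f = 0 := by
  refine jacobiator_ext hφ hg _ _ ∅ (fun z _ => ?_) (fun z _ => ?_) fun z _ => ?_ <;>
    rw [jacobiator_cycle]
  · rw [jacobiator_u hφ hg]; rfl
  · rw [jacobiator_v hφ hg]; rfl
  · rw [jacobiator_pp hφ hg]; rfl

theorem jacobiator_eq_zero (f f' : OM g) : jacobiator hφ f f' = 0 := by
  refine jacobiator_ext hφ hg _ _ ∅ (fun z _ => ?_) (fun z _ => ?_) fun z _ => ?_ <;>
    rw [jacobiator_cycle]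
  · rw [jacobiator_u hφ hg]; rfl
  · rw [jacobiator_v hφ hg]; rfl
  · rw [jacobiator_p hφ hg]; rfl

include hφ in
theorem isPoissonBracket_quadBracket : IsPoissonBracket (quadBracket g φ) where
  add_left := (isBiderivation_quadBracket hφ).add_left
  smul_left := (isBiderivation_quadBracket hφ).smul_left
  skew := (isBiderivation_quadBracket hφ).skew
  leibniz := (isBiderivation_quadBracket hφ).leibniz
  jacobi f f' f'' := by
    have h := congrArg (fun D => D f'') (jacobiator_eq_zero hφ hg f f')
    simp only [jacobiator_apply, Derivation.coe_zero, Pi.zero_apply] at h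
    rw [qad_skew hφ f f'', map_neg, qad_skew hφ (qad hφ f f')] at h
    simp only [← qad_apply hφ]
    linear_combination h

end

end PrymToda

namespace PrymToda

open Polynomial

/-! ## Determinants of tridiagonal and cyclic tridiagonal matrices -/

section Continuant

variable {R : Type*} [CommRing R]

/-- The continuant of the positions `c, …, c + k - 1`: the determinant of the tridiagonal matrix
with diagonal entries `b i` in which `a i` is the product of the two entries that link `i` and
`i + 1`. -/
def continuant (b a : ℕ → R) (c : ℕ) : ℕ → R
  | 0 => 1
  | 1 => b c
  | k + 2 => b (c + k + 1) * continuant b a c (k + 1) - a (c + k) * continuant b a c k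

/-- The mirror image of the defining recursion. Determinants are expanded at the front, whereas the
Poisson brackets are computed by appending sites at the end. -/
theorem continuant_front (b a : ℕ → R) (c k : ℕ) : continuant b a c (k + 2) =
    b c * continuant b a (c + 1) (k + 1) - a c * continuant b a (c + 2) k := by
  induction k using Nat.twoStepInduction with
  | zero => simp [continuant]; ring
  | one =>
    simp only [continuant, add_zero]
    rw [show c + 1 + 0 = c + 1 from rfl]
    ring_nf
  | more k h1 h2 =>
    have e1 : continuant b a c (k + 2 + 2) = b (c + (k + 2) + 1) * continuant b a c (k + 1 + 2) -
      a (c + (k + 2)) * continuant b a c (k + 2) := rfl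
    have e2 : continuant b a (c + 1) (k + 2 + 1) =
      b (c + 1 + (k + 1) + 1) * continuant b a (c + 1) (k + 1 + 1) -
        a (c + 1 + (k + 1)) * continuant b a (c + 1) (k + 1) := rfl
    have e3 : continuant b a (c + 2) (k + 2) = b (c + 2 + k + 1) * continuant b a (c + 2) (k + 1) -
      a (c + 2 + k) * continuant b a (c + 2) k := rfl
    rw [show c + 1 + (k + 1) = c + (k + 2) by ring] at e2
    rw [show c + 2 + k = c + (k + 2) by ring] at e3
    rw [e1, e2, e3]
    linear_combination b (c + (k + 2) + 1) * h2 - a (c + (k + 2)) * h1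

/-- The tridiagonal matrix on the positions `c, …, c + k - 1`. -/
def triMat (b e f : ℕ → R) (c k : ℕ) : Matrix (Fin k) (Fin k) R := fun i j =>
  (if (i : ℕ) = j then b (c + i) else 0) + (if (j : ℕ) = i + 1 then e (c + i) else 0) +
    (if (i : ℕ) = j + 1 then f (c + j) else 0)

theorem triMat_submatrix_succ (b e f : ℕ → R) (c k : ℕ) :
    (triMat b e f c (k + 1)).submatrix Fin.succ Fin.succ = triMat b e f (c + 1) k := by
  ext i j
  simp only [triMat, Matrix.submatrix_apply, Fin.val_succ, add_left_inj]
  rw [show c + ((i : ℕ) + 1) = c + 1 + i by ring, show c + ((j : ℕ) + 1) = c + 1 + j by ring]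

/-- Expansion along the first row; in the second minor the first column has the single entry f c,
which leaves a tridiagonal matrix that is shorter by two. -/
theorem det_triMat (b e f : ℕ → R) (k : ℕ) :
    ∀ c, (triMat b e f c k).det = continuant b (fun i => e i * f i) c k := by
  induction k using Nat.twoStepInduction with
  | zero => intro c; simp [continuant]
  | one => intro c; simp [continuant, triMat]
  | more k h1 h2 =>
    intro c
    rw [continuant_front, Matrix.det_succ_row_zero, Fin.sum_univ_succ, Fin.sum_univ_succ,
      Finset.sum_eq_zero]
    · have e1 : (triMat b e f c (k + 2)).submatrix Fin.succ (Fin.succAbove 0) =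
          triMat b e f (c + 1) (k + 1) := by
        rw [Fin.succAbove_zero]; exact triMat_submatrix_succ _ _ _ _ _
      have e2 : ((triMat b e f c (k + 2)).submatrix Fin.succ
          (Fin.succAbove (Fin.succ 0))).det = f c * continuant b (fun i => e i * f i) (c + 2) k := by
        rw [Matrix.det_succ_column_zero, Fin.sum_univ_succ, Finset.sum_eq_zero]
        · rw [← h1, ← triMat_submatrix_succ, ← triMat_submatrix_succ, Matrix.submatrix_submatrix,
            Matrix.submatrix_submatrix]
          have hs : Fin.succAbove (1 : Fin (k + 2)) ∘ Fin.succ = Fin.succ ∘ Fin.succ :=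
            funext fun i => by simp
          simp [triMat, hs]
        · intro i _
          simp [triMat]
      rw [e1, e2, h2]
      simp [triMat]
      ring
    · intro i _
      simp [triMat]

/-- A determinant is affine in a single entry, and its slope is the cofactor. -/
theorem det_add_corner {n : ℕ} (M : Matrix (Fin n) (Fin n) R) (i j : Fin n) (z : R) :
    (M.updateRow i (M i + z • Pi.single j 1)).det = M.det + z * M.adjugate j i := by
  rw [Matrix.det_updateRow_add, Matrix.updateRow_eq_self, Matrix.det_updateRow_smul,
    Matrix.adjugate_apply]

/-- The tridiagonal matrix on the positions `0, …, k + 1` with additional entries `y` and `z` in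
the upper right and lower left corner. -/
def cyclicMat (b e f : ℕ → R) (y z : R) (k : ℕ) : Matrix (Fin (k + 2)) (Fin (k + 2)) R :=
  fun i j => triMat b e f 0 (k + 2) i j + (if i = 0 ∧ j = Fin.last _ then y else 0) +
    (if i = Fin.last _ ∧ j = 0 then z else 0)

/-- The corners are inserted one at a time. Each alone is multiplied by a triangular minor, a
product of the f or of the e; both together are multiplied by the inner tridiagonal block. -/
theorem det_cyclicMat (b e f : ℕ → R) (y z : R) (k : ℕ) : (cyclicMat b e f y z k).det =
    continuant b (fun i => e i * f i) 0 (k + 2) +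
      (-1) ^ (k + 1) * (y * ∏ i ∈ Finset.range (k + 1), f i) +
      (-1) ^ (k + 1) * (z * ∏ i ∈ Finset.range (k + 1), e i) -
      y * z * continuant b (fun i => e i * f i) 1 k := by
  set T := triMat b e f 0 (k + 2) with hT
  set T' := T.updateRow (Fin.last _) (T (Fin.last _) + z • Pi.single 0 1) with hT'
  have h1 : cyclicMat b e f y z k = T'.updateRow 0 (T' 0 + y • Pi.single (Fin.last _) 1) := by
    ext i j
    have h0 : (0 : Fin (k + 2)) ≠ Fin.last (k + 1) := by simp [Fin.ext_iff]
    by_cases hi : i = 0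
    · subst hi
      simp [cyclicMat, hT', hT, Pi.single_apply, Matrix.updateRow_apply, h0]
    · by_cases hi' : i = Fin.last (k + 1)
      · subst hi'
        simp [cyclicMat, hT', hT, Pi.single_apply, Matrix.updateRow_apply, h0.symm]
      · simp [cyclicMat, hT', hT, Matrix.updateRow_apply, hi, hi']
  have hlow : (T.submatrix Fin.castSucc Fin.succ).det = ∏ i ∈ Finset.range (k + 1), e i := by
    rw [Matrix.det_of_isLowerTriangular, Finset.prod_range]
    · refine Finset.prod_congr rfl fun i _ => ?_
      simp [hT, triMat]
      omega
    · intro i j hij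
      have hij' : (i : ℕ) < j := hij
      simp only [hT, triMat, Matrix.submatrix_apply, Fin.val_castSucc, Fin.val_succ]
      rw [if_neg (by omega), if_neg (by omega), if_neg (by omega)]
      simp
  set N := T.submatrix Fin.succ Fin.castSucc with hN
  have hup : N.det = ∏ i ∈ Finset.range (k + 1), f i := by
    rw [Matrix.det_of_isUpperTriangular, Finset.prod_range]
    · refine Finset.prod_congr rfl fun i _ => ?_
      simp [hN, hT, triMat]
      omega
    · intro i j hij
      have hij' : (j : ℕ) < i := hij
      simp only [hN, hT, triMat, Matrix.submatrix_apply, Fin.val_castSucc, Fin.val_succ]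
      rw [if_neg (by omega), if_neg (by omega), if_neg (by omega)]
      simp
  have hmid : (N.submatrix (Fin.succAbove (Fin.last k)) (Fin.succAbove 0)).det =
      continuant b (fun i => e i * f i) 1 k := by
    rw [← det_triMat]
    congr 1
    ext i j
    simp only [hN, hT, triMat, Matrix.submatrix_apply, Fin.succAbove_last, Fin.succAbove_zero,
      Fin.val_castSucc, Fin.val_succ, add_left_inj]
    simp only [zero_add, add_comm]
  -- The minor belonging to y still contains z in its own lower left corner, which is the source of
  -- the term in yz.
  have h2 : T'.submatrix (Fin.succAbove 0) (Fin.succAbove (Fin.last _)) =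
      N.updateRow (Fin.last k) (N (Fin.last k) + z • Pi.single 0 1) := by
    ext i j
    rw [Fin.succAbove_last, Fin.succAbove_zero]
    by_cases hi : i = Fin.last k
    · subst hi
      simp [hT', hN, Matrix.updateRow_apply, Pi.single_apply]
    · have hi' : i.succ ≠ Fin.last (k + 1) := by
        rw [← Fin.succ_last]
        exact fun h => hi (Fin.succ_injective _ h)
      simp [hT', hN, Matrix.updateRow_apply, hi, hi']
  have hs : ((-1 : R) ^ (k + 1)) * (-1) ^ k = -1 := by
    rw [← pow_add, show k + 1 + k = 2 * k + 1 by ring, pow_succ, pow_mul]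
    simp
  rw [h1, det_add_corner, hT', det_add_corner, ← hT', Matrix.adjugate_fin_succ_eq_det_submatrix,
    Matrix.adjugate_fin_succ_eq_det_submatrix, h2, det_add_corner,
    Matrix.adjugate_fin_succ_eq_det_submatrix, hup, hmid, Fin.succAbove_last, Fin.succAbove_zero,
    hlow, hT, det_triMat]
  simp only [Fin.val_last, Fin.val_zero, add_zero, zero_add]
  linear_combination (y * z * continuant b (fun i => e i * f i) 1 k) * hs

end Continuant

end PrymToda

namespace PrymToda

open Polynomial

/-! ## The minors and the characteristic polynomial of the Toda Lax operator -/

section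

variable {g : ℕ} (m : ZMod (g + 1))

/-- The characteristic polynomial of the part of the Lax operator with indices
`m + c, …, m + c + k - 1`. -/
noncomputable def chain (c k : ℕ) : (OT g)[X] :=
  continuant (fun i => X - C (bT (m + (i : ZMod (g + 1))))) (fun i => C (aT (m + (i : ZMod (g + 1))))) c k

theorem natCast_inj_of_le {r r' : ℕ} (hr : r ≤ g) (hr' : r' ≤ g) :
    ((r : ZMod (g + 1)) = (r' : ZMod (g + 1))) ↔ r = r' := by
  rw [ZMod.natCast_eq_natCast_iff', Nat.mod_eq_of_lt (by omega), Nat.mod_eq_of_lt (by omega)]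

theorem natCast_succ_eq_zero : ((g + 1 : ℕ) : ZMod (g + 1)) = 0 := ZMod.natCast_self _

theorem sub_one_eq : m - 1 = m + (g : ZMod (g + 1)) := by
  have h := natCast_succ_eq_zero (g := g)
  push_cast at h
  linear_combination -h

theorem exists_natCast_add (x : ZMod (g + 1)) : ∃ r ≤ g, x = m + (r : ZMod (g + 1)) :=
  ⟨(x - m).val, Nat.lt_succ_iff.1 (ZMod.val_lt _), by simp⟩

theorem natCast_add_eq_succ {i j : ℕ} (hi : i ≤ g) (hj : j ≤ g) :
    (m + (j : ZMod (g + 1)) = m + (i : ZMod (g + 1)) + 1) ↔ (j = i + 1 ∨ i = g ∧ j = 0) := by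
  rw [add_assoc, add_right_inj, ← Nat.cast_succ]
  rcases Nat.lt_or_ge g i.succ with h4 | h4
  · have h5 : ((i.succ : ℕ) : ZMod (g + 1)) = ((0 : ℕ) : ZMod (g + 1)) := by
      rw [Nat.cast_zero]
      exact (ZMod.natCast_eq_zero_iff _ _).2 ⟨1, by omega⟩
    rw [h5, natCast_inj_of_le hj (by omega)]
    omega
  · rw [natCast_inj_of_le hj h4]
    omega

/-- Counted from m, the remaining indices form an interval that avoids the position 0, so no link
wraps around. The off-diagonal entries -a and -1 enter only through their product a. -/
theorem todaMinor_eq (l : List (ZMod (g + 1))) (hnd : l.Nodup) (c k : ℕ) (hc : 1 ≤ c)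
    (hck : c + k ≤ g + 1) (hl : ∀ r ≤ g, m + (r : ZMod (g + 1)) ∉ l ↔ c ≤ r ∧ r < c + k) :
    todaMinor g m l = chain m c k := by
  have hmem : ∀ i : Fin k, m + ((c + i : ℕ) : ZMod (g + 1)) ∉ l := fun i =>
    (hl _ (by omega)).2 ⟨by omega, by omega⟩
  let e : Fin k → {i // i ∉ l} := fun i => ⟨m + ((c + i : ℕ) : ZMod (g + 1)), hmem i⟩
  have he : Function.Bijective e := by
    constructor
    · intro i i' h
      have h1 : m + ((c + i : ℕ) : ZMod (g + 1)) = m + ((c + i' : ℕ) : ZMod (g + 1)) :=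
        congrArg Subtype.val h
      have h2 := (natCast_inj_of_le (g := g) (by omega) (by omega)).1 (add_left_cancel h1)
      exact Fin.ext (by omega)
    · rintro ⟨x, hx⟩
      obtain ⟨r, hr, rfl⟩ := exists_natCast_add m x
      obtain ⟨h1, h2⟩ := (hl r hr).1 hx
      refine ⟨⟨r - c, by omega⟩, Subtype.ext ?_⟩
      show m + ((c + (r - c) : ℕ) : ZMod (g + 1)) = _
      rw [Nat.add_sub_cancel' h1]
  rw [todaMinor, if_pos hnd, ← Matrix.det_submatrix_equiv_self (Equiv.ofBijective e he), chain]
  refine Eq.trans ?_ ((det_triMat (fun i => X - C (bT (m + (i : ZMod (g + 1)))))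
    (fun i => -C (aT (m + (i : ZMod (g + 1))))) (fun _ => -1) k c).trans
      (congrArg (continuant _ · c k) (funext fun i => by ring)))
  congr 1
  ext1 i j
  simp only [Matrix.submatrix_apply, Equiv.ofBijective_apply, todaTri, triMat, e]
  have h1 : ∀ i : Fin k, m + ((c + i : ℕ) : ZMod (g + 1)) ≠ m := fun i h => by
    have h2 : ((c + i : ℕ) : ZMod (g + 1)) = ((0 : ℕ) : ZMod (g + 1)) := by
      rw [Nat.cast_zero]; exact add_eq_left.1 h
    have := (natCast_inj_of_le (g := g) (by omega) (by omega)).1 h2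
    omega
  have h2 : ∀ i j : Fin k, (m + ((c + i : ℕ) : ZMod (g + 1)) = m + ((c + j : ℕ) : ZMod (g + 1))) ↔
      (i : ℕ) = j := fun i j => by
    rw [add_right_inj, natCast_inj_of_le (by omega) (by omega)]
    omega
  have h3 : ∀ i j : Fin k,
      (m + ((c + j : ℕ) : ZMod (g + 1)) = m + ((c + i : ℕ) : ZMod (g + 1)) + 1) ↔
      (j : ℕ) = i + 1 := fun i j => by
    rw [natCast_add_eq_succ m (by omega) (by omega)]
    omega
  simp only [h1, h2, h3, ne_eq, not_false_eq_true, and_true]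
  split_ifs <;> ring

theorem natCast_add_notMem_singleton (r : ℕ) (hr : r ≤ g) : m + (r : ZMod (g + 1)) = m ↔ r = 0 := by
  have := natCast_inj_of_le hr (Nat.zero_le g)
  rw [Nat.cast_zero] at this
  rw [add_eq_left, this]

theorem natCast_add_eq_add_one (hg : 1 ≤ g) (r : ℕ) (hr : r ≤ g) :
    m + (r : ZMod (g + 1)) = m + 1 ↔ r = 1 := by
  have := natCast_inj_of_le hr hg
  rw [Nat.cast_one] at this
  rw [add_right_inj, this]

theorem natCast_add_eq_sub_one (r : ℕ) (hr : r ≤ g) : m + (r : ZMod (g + 1)) = m - 1 ↔ r = g := by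
  rw [sub_one_eq, add_right_inj, natCast_inj_of_le hr le_rfl]

theorem one_ne_zero_zmod (hg : 1 ≤ g) : (1 : ZMod (g + 1)) ≠ 0 := by
  have := natCast_inj_of_le hg (Nat.zero_le g)
  rw [Nat.cast_one, Nat.cast_zero] at this
  rw [Ne, this]
  omega

theorem todaMinor_m : todaMinor g m [m] = chain m 1 g := by
  refine todaMinor_eq m _ (by simp) 1 g le_rfl (by omega) fun r hr => ?_
  rw [List.mem_singleton, natCast_add_notMem_singleton m r hr]
  omega

theorem todaMinor_right (hg : 1 ≤ g) : todaMinor g m [m, m + 1] = chain m 2 (g - 1) := by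
  have h := one_ne_zero_zmod hg
  refine todaMinor_eq m _ (by simp [h]) 2 (g - 1) (by omega) (by omega) fun r hr => ?_
  simp only [List.mem_cons, List.not_mem_nil, or_false, natCast_add_notMem_singleton m r hr,
    natCast_add_eq_add_one m hg r hr]
  omega

theorem todaMinor_left (hg : 1 ≤ g) : todaMinor g m [m - 1, m] = chain m 1 (g - 1) := by
  have h := one_ne_zero_zmod hg
  refine todaMinor_eq m _ (by simp [h]) 1 (g - 1) (by omega) (by omega) fun r hr => ?_
  simp only [List.mem_cons, List.not_mem_nil, or_false, natCast_add_notMem_singleton m r hr,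
    natCast_add_eq_sub_one m r hr]
  omega

theorem todaMinor_both (hg : 2 ≤ g) : todaMinor g m [m - 1, m, m + 1] = chain m 2 (g - 2) := by
  have h := one_ne_zero_zmod (g := g) (by omega)
  have h2 : m - 1 ≠ m + 1 := by
    rw [Ne, eq_comm, ← Nat.cast_one (R := ZMod (g + 1)), Nat.cast_one]
    have := natCast_add_eq_sub_one m 1 (by omega)
    rw [Nat.cast_one] at this
    rw [this]
    omega
  refine todaMinor_eq m _ (by simp [h, h2]) 2 (g - 2) (by omega) (by omega) fun r hr => ?_
  simp only [List.mem_cons, List.not_mem_nil, or_false, natCast_add_notMem_singleton m r hr,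
    natCast_add_eq_sub_one m r hr, natCast_add_eq_add_one m (by omega) r hr]
  omega

theorem todaMinor_both_one (m : ZMod (1 + 1)) : todaMinor 1 m [m - 1, m, m + 1] = 0 := by
  rw [todaMinor, if_neg]
  revert m
  decide

theorem prod_aT : ∏ i : ZMod (g + 1), (aT i : OT g) = 1 := by
  have h : (Ideal.Quotient.mk (Ideal.span {todaCasimir g - 1})) (todaCasimir g) = 1 := by
    rw [← sub_eq_zero, ← map_one (Ideal.Quotient.mk (Ideal.span {todaCasimir g - 1})), ← map_sub]
    exact Ideal.Quotient.eq_zero_iff_mem.2 (Ideal.subset_span rfl)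
  rw [todaCasimir, map_prod] at h
  exact h

/-- The position `i ↦ m + i`. -/
noncomputable def posEquiv : Fin (g + 1) ≃ ZMod (g + 1) :=
  Equiv.ofBijective (fun i : Fin (g + 1) => m + ((i : ℕ) : ZMod (g + 1))) <| by
    constructor
    · intro i i' h
      exact Fin.ext ((natCast_inj_of_le (g := g) (by omega) (by omega)).1 (add_left_cancel h))
    · intro x
      obtain ⟨r, hr, rfl⟩ := exists_natCast_add m x
      exact ⟨⟨r, by omega⟩, rfl⟩

theorem posEquiv_apply (i : Fin (g + 1)) : posEquiv m i = m + ((i : ℕ) : ZMod (g + 1)) := rfl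

theorem prod_range_pos {M : Type*} [CommMonoid M] (f : ZMod (g + 1) → M) :
    ∏ i ∈ Finset.range (g + 1), f (m + (i : ZMod (g + 1))) = ∏ i, f i := by
  rw [Finset.prod_range]
  exact Equiv.prod_comp (posEquiv m) f

theorem prod_range_aT : ∏ i ∈ Finset.range (g + 1), (aT (m + (i : ZMod (g + 1))) : OT g) = 1 := by
  rw [prod_range_pos m (fun i => (aT i : OT g)), prod_aT]

/-- `K / 2`, expressed in terms of minors. -/
noncomputable def halfK : (OT g)[X] :=
  (X - C (bT m)) * chain m 1 g - C (aT (m - 1)) * chain m 1 (g - 1) -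
    C (aT m) * chain m 2 (g - 1)

/-- Cyclic neighbours are split into linear neighbours and corners. The entries are kept as sums,
which also covers size two, where a corner coincides with an off-diagonal place. -/
theorem charmatrix_cyclic_entry {R : Type*} [CommRing R] (b : R) (α β : ℕ → R) {k i j : ℕ}
    (hi : i ≤ k + 1) (hj : j ≤ k + 1) :
    (if i = j then X else 0) - C ((if i = j then b else 0) +
        (if j = i + 1 ∨ i = k + 1 ∧ j = 0 then α i else 0) +
        (if i = j + 1 ∨ j = k + 1 ∧ i = 0 then β j else 0)) =
      (if i = j then X - C b else 0) + (if j = i + 1 then -C (α i) else 0) +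
        (if i = j + 1 then -C (β j) else 0) +
        (if i = 0 ∧ j = k + 1 then -C (β (k + 1)) else 0) +
        (if i = k + 1 ∧ j = 0 then -C (α (k + 1)) else 0) := by
  have aux : ∀ (γ : ℕ → R) {i j : ℕ}, i ≤ k + 1 → j ≤ k + 1 →
      C (if j = i + 1 ∨ i = k + 1 ∧ j = 0 then γ i else 0) =
        -(if j = i + 1 then -C (γ i) else 0) -
          (if i = k + 1 ∧ j = 0 then -C (γ (k + 1)) else 0) := by
    intro γ i j hi hj
    by_cases h1 : j = i + 1
    · rw [if_pos (Or.inl h1), if_pos h1, if_neg (by omega)]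
      ring
    · by_cases h2 : i = k + 1 ∧ j = 0
      · rw [if_pos (Or.inr h2), if_neg h1, if_pos h2, h2.1]
        ring
      · rw [if_neg (not_or.2 ⟨h1, h2⟩), if_neg h1, if_neg h2, map_zero]
        ring
  have h0 : (if i = j then X - C b else 0) = (if i = j then X else 0) - C (if i = j then b else 0) := by
    split_ifs <;> simp
  rw [map_add, map_add, aux α hi hj, aux β hj hi, h0]
  simp only [and_comm (a := i = 0)]
  ring

/-- The parameter h sits at a single link, so it cancels in each product α_i β_i = a_i, while ∏ α_i
= h ∏ a_i = h and ∏ β_i = 1/h. As the counting may start at any m, `halfK m` does not depend on m.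
-/
theorem charpoly_todaLax (hg : 1 ≤ g) (h : ℂ) (hh : h ≠ 0) : (todaLax g h).charpoly =
    halfK m - C (algebraMap ℂ (OT g) (h + h⁻¹)) := by
  obtain ⟨k, rfl⟩ : ∃ k, g = k + 1 := ⟨g - 1, by omega⟩
  let α : ℕ → OT (k + 1) := fun i => (if m + (i : ZMod (k + 1 + 1)) = 0 then algebraMap ℂ _ h else 1) * aT (m + (i : ZMod (k + 1 + 1)))
  let β : ℕ → OT (k + 1) := fun i => if m + (i : ZMod (k + 1 + 1)) = 0 then algebraMap ℂ _ h⁻¹ else 1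
  have hαβ : ∀ i, α i * β i = aT (m + (i : ZMod (k + 1 + 1))) := by
    intro i
    simp only [α, β]
    split_ifs
    · rw [mul_right_comm, ← map_mul, mul_inv_cancel₀ hh, map_one, one_mul]
    · ring
  have hα : ∏ i ∈ Finset.range (k + 2), α i = algebraMap ℂ _ h := by
    simp only [α]
    rw [Finset.prod_mul_distrib, prod_range_aT m,
      prod_range_pos m (fun i => if i = 0 then algebraMap ℂ (OT (k + 1)) h else 1)]
    simp
  have hβ : ∏ i ∈ Finset.range (k + 2), β i = algebraMap ℂ _ h⁻¹ := by
    simp only [β]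
    rw [prod_range_pos m (fun i => if i = 0 then algebraMap ℂ (OT (k + 1)) h⁻¹ else 1)]
    simp
  have hM : (Matrix.charmatrix (todaLax (k + 1) h)).submatrix (posEquiv m) (posEquiv m) =
      cyclicMat (fun i => X - C (bT (m + (i : ZMod (k + 1 + 1))))) (fun i => -C (α i)) (fun i => -C (β i))
        (-C (β (k + 1))) (-C (α (k + 1))) k := by
    ext1 i j
    have h2 : ∀ i j : Fin (k + 2),
        (m + ((i : ℕ) : ZMod (k + 1 + 1)) = m + ((j : ℕ) : ZMod (k + 1 + 1))) ↔
        (i : ℕ) = j := fun i j => by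
      rw [add_right_inj, natCast_inj_of_le (by omega) (by omega)]
    have h3 : ∀ i j : Fin (k + 2),
        (m + ((j : ℕ) : ZMod (k + 1 + 1)) = m + ((i : ℕ) : ZMod (k + 1 + 1)) + 1) ↔
        ((j : ℕ) = i + 1 ∨ ((i : ℕ) = k + 1 ∧ (j : ℕ) = 0)) := fun i j =>
      natCast_add_eq_succ m (by omega) (by omega)
    have e1 : ∀ i : ℕ, (if m + (i : ZMod (k + 1 + 1)) = 0 then h • aT (m + (i : ZMod (k + 1 + 1))) else aT (m + (i : ZMod (k + 1 + 1)))) =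
        α i := fun i => by
      simp only [α]
      split_ifs
      · exact Algebra.smul_def (A := OT (k + 1)) h (aT _)
      · rw [one_mul]
    have e2 : ∀ i : ℕ, (if m + (i : ZMod (k + 1 + 1)) = 0 then algebraMap ℂ (OT (k + 1)) h⁻¹ else 1) =
        β i := fun i => rfl
    simp only [Matrix.submatrix_apply, Matrix.charmatrix_apply, Matrix.diagonal_apply, todaLax,
      posEquiv_apply, e1, e2, h2, h3, cyclicMat, triMat, zero_add, Fin.ext_iff, Fin.val_zero,
      Fin.val_last]
    exact charmatrix_cyclic_entry _ α β (by omega) (by omega)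
  have h2 : 1 + (k + 1) = k + 2 := by ring
  rw [Matrix.charpoly, ← Matrix.det_submatrix_equiv_self (posEquiv m), hM, det_cyclicMat]
  have hmul : (fun i => -C (α i) * -C (β i)) =
      fun i : ℕ => (C (aT (m + (i : ZMod (k + 1 + 1)))) : (OT (k + 1))[X]) := by
    funext i
    rw [neg_mul_neg, ← C_mul, hαβ]
  -- The sign of the cofactor cancels the signs of the k + 1 off-diagonal entries; the sign of the
  -- corner remains.
  have hprod : ∀ γ : ℕ → OT (k + 1), (-1) ^ (k + 1) * (-C (γ (k + 1)) *
      ∏ i ∈ Finset.range (k + 1), -C (γ i)) = -C (∏ i ∈ Finset.range (k + 2), γ i) := by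
    intro γ
    have h3 : ((-1) ^ (k + 1) * (-1) ^ (k + 1) : (OT (k + 1))[X]) = 1 := by
      rw [← pow_add, ← two_mul, pow_mul]; simp
    rw [Finset.prod_neg, Finset.card_range, Finset.prod_range_succ _ (k + 1), C_mul, map_prod]
    linear_combination (-C (γ (k + 1)) * ∏ i ∈ Finset.range (k + 1), C (γ i)) * h3
  simp only [hmul]
  rw [hprod, hprod, hα, hβ, continuant_front, neg_mul_neg, ← C_mul, mul_comm (β _), hαβ, halfK,
    sub_one_eq]
  simp only [chain, Nat.add_sub_cancel, map_add, Nat.cast_zero, add_zero, zero_add]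
  ring

end

end PrymToda

namespace PrymToda

open Polynomial

/-! ## Brackets of the minors under the Toda bracket -/

section

variable {R : Type*} [CommRing R] [Algebra ℂ R] {B : R → R → R} (hB : IsBiderivation B)
include hB

theorem IsBiderivation.sub_left (f f' h : R) : B (f - f') h = B f h - B f' h := by
  rw [hB.skew, hB.skew f, hB.skew f']
  have := (hB.ad h).map_sub f f'
  simp only [hB.ad_apply] at this
  rw [this]
  ring

theorem IsBiderivation.sub_right (h f f' : R) : B h (f - f') = B h f - B h f' :=
  (hB.ad h).map_sub f f'

theorem IsBiderivation.add_right (h f f' : R) : B h (f + f') = B h f + B h f' :=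
  (hB.ad h).map_add f f'

theorem IsBiderivation.mul_right (h f f' : R) : B h (f * f') = f * B h f' + f' * B h f :=
  (hB.ad h).leibniz f f'

theorem IsBiderivation.zero_left (h : R) : B 0 h = 0 := by
  rw [hB.skew, neg_eq_zero]
  exact (hB.ad h).map_zero

theorem IsBiderivation.zero_right (h : R) : B h 0 = 0 := (hB.ad h).map_zero

end

section

variable {R : Type*} [CommRing R] [Algebra ℂ R]

local notation "σ" => algebraMap ℂ R

/-- The brackets between the four polynomials of a chain; `κ = 0` for an open chain and `κ = 1`
for a chain whose ends interact. -/
structure ChainRelations (B : R → R → R) (φ₀ φ₁ κ : R) (U V W Z : ℂ → R) : Prop where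
  uu : ∀ s t, B (U s) (U t) = 0
  vv : ∀ s t, B (V s) (V t) = 0
  ww : ∀ s t, B (W s) (W t) = 0
  zz : ∀ s t, B (Z s) (Z t) = 0
  uv : ∀ s t, (σ s - σ t) * B (U s) (V t) =
    (φ₁ * σ t + φ₀) * U s * V t - (φ₁ * σ s + φ₀) * V s * U t
  uw : ∀ s t, (σ s - σ t) * B (U s) (W t) =
    (φ₁ * σ s + φ₀) * W s * U t - (φ₁ * σ t + φ₀) * U s * W t
  uz : ∀ s t, (σ s - σ t) * B (U s) (Z t) = (φ₁ * σ s + φ₀) * (W s * V t - V s * W t)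
  vw : ∀ s t, (σ s - σ t) * B (V s) (W t) =
    (φ₁ * σ s + φ₀) * Z s * U t - (φ₁ * σ t + φ₀) * U s * Z t +
      (1 - κ) * φ₁ * (σ s - σ t) * V s * W t
  vz : ∀ s t, (σ s - σ t) * B (V s) (Z t) =
    (φ₁ * σ s + φ₀) * Z s * V t - (φ₁ * σ t + φ₀) * V s * Z t - κ * φ₁ * (σ s - σ t) * V s * Z t
  wz : ∀ s t, (σ s - σ t) * B (W s) (Z t) =
    (φ₁ * σ t + φ₀) * W s * Z t - (φ₁ * σ s + φ₀) * Z s * W t + κ * φ₁ * (σ s - σ t) * W s * Z t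

/-- The brackets between the four polynomials of a chain and the next `b`. -/
structure ChainRelationsB (B : R → R → R) (φ₀ φ₁ ε b : R) (U V W Z : ℂ → R) : Prop where
  u : ∀ s, B (U s) b = ε * φ₁ * V s
  v : ∀ s, B (V s) b = -(ε * (φ₁ * b + φ₀)) * V s
  w : ∀ s, B (W s) b = ε * φ₁ * Z s
  z : ∀ s, B (Z s) b = -(ε * (φ₁ * b + φ₀)) * Z s

/-- The brackets between the four polynomials of a chain and a later `a`. -/
structure ChainRelationsA (B : R → R → R) (φ₁ ε κ a : R) (U V W Z : ℂ → R) : Prop where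
  u : ∀ s, B (U s) a = 0
  v : ∀ s, B (V s) a = -(ε * φ₁ * a) * V s
  w : ∀ s, B (W s) a = κ * φ₁ * a * W s
  z : ∀ s, B (Z s) a = (κ - ε) * φ₁ * a * Z s

/-- The brackets between the four polynomials of a chain and the `b` in front of it. -/
structure ChainRelationsB₀ (B : R → R → R) (φ₀ φ₁ κ b₀ : R) (U V W Z : ℂ → R) : Prop where
  u : ∀ s, B (U s) b₀ = κ * φ₁ * V s - φ₁ * W s
  v : ∀ s, B (V s) b₀ = -(κ * (φ₁ * b₀ + φ₀)) * V s - φ₁ * Z s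
  w : ∀ s, B (W s) b₀ = (φ₁ * b₀ + φ₀) * W s + κ * φ₁ * Z s
  z : ∀ s, B (Z s) b₀ = (1 - κ) * (φ₁ * b₀ + φ₀) * Z s

variable {B : R → R → R} (hB : IsBiderivation B) {φ₀ φ₁ κ a b : R} {U V W Z : ℂ → R}
include hB

/-- Appending a site multiplies the matrix (U, V; W, Z) by a transfer matrix, and the quadratic
relations survive this. The new value of κ enters through {W, a}: it records whether the appended
link is adjacent to the first one. -/
theorem ChainRelations.step (h : ChainRelations B φ₀ φ₁ 0 U V W Z)
    (hb : ChainRelationsB B φ₀ φ₁ 1 b U V W Z) (ha : ChainRelationsA B φ₁ 1 κ a U V W Z)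
    (hab : B a b = a * (φ₁ * b + φ₀)) :
    ChainRelations B φ₀ φ₁ κ (fun s => (σ s - b) * U s - V s) (fun s => a * U s)
      (fun s => (σ s - b) * W s - Z s) (fun s => a * W s) := by
  have vu : ∀ s t, (σ s - σ t) * B (V s) (U t) =
      (φ₁ * σ s + φ₀) * U t * V s - (φ₁ * σ t + φ₀) * V t * U s := fun s t => by
    rw [hB.skew]; linear_combination h.uv t s
  have zw : ∀ s t, (σ s - σ t) * B (Z s) (W t) =
      (φ₁ * σ s + φ₀) * W t * Z s - (φ₁ * σ t + φ₀) * Z t * W s := fun s t => by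
    rw [hB.skew]; linear_combination h.wz t s
  have hba : B b a = -(a * (φ₁ * b + φ₀)) := by rw [hB.skew, hab]
  have bu : ∀ t, B b (U t) = -(φ₁ * V t) := fun t => by rw [hB.skew, hb.u]; ring
  have bv : ∀ t, B b (V t) = (φ₁ * b + φ₀) * V t := fun t => by rw [hB.skew, hb.v]; ring
  have bw : ∀ t, B b (W t) = -(φ₁ * Z t) := fun t => by rw [hB.skew, hb.w]; ring
  have bz : ∀ t, B b (Z t) = (φ₁ * b + φ₀) * Z t := fun t => by rw [hB.skew, hb.z]; ring
  have au : ∀ t, B a (U t) = 0 := fun t => by rw [hB.skew, ha.u]; ring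
  have aw : ∀ t, B a (W t) = -(κ * φ₁ * a * W t) := fun t => by rw [hB.skew, ha.w]
  have az : ∀ t, B a (Z t) = (1 - κ) * φ₁ * a * Z t := fun t => by rw [hB.skew, ha.z]; ring
  have haa : B a a = 0 := hB.self a
  have hbb : B b b = 0 := hB.self b
  constructor <;> intro s t <;>
    simp only [hB.sub_left, hB.sub_right, hB.leibniz, hB.mul_right, hB.algebraMap_left,
      hB.algebraMap_right, h.uu, h.vv, h.ww, h.zz, hab, hba, bu, bv, bw, bz, au, aw, az, haa,
      hbb, hb.u, hb.v, hb.w, hb.z, ha.u, ha.v, ha.w, ha.z]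
  -- This relation carries no factor s - t. Off the diagonal the factor is inserted and cancelled;
  -- on the diagonal skewness suffices.
  · rcases eq_or_ne s t with rfl | hst
    · linear_combination -(σ s - b) * hB.skew (U s) (V s)
    · refine sub_mul_cancel hst ?_
      linear_combination -(σ s - b) * h.uv s t - (σ t - b) * vu s t
  · ring
  · rcases eq_or_ne s t with rfl | hst
    · linear_combination -(σ s - b) * hB.skew (W s) (Z s)
    · refine sub_mul_cancel hst ?_
      linear_combination -(σ s - b) * h.wz s t - (σ t - b) * zw s t
  · ring
  · linear_combination -a * vu s t
  · linear_combination (σ s - b) * (σ t - b) * h.uw s t - (σ s - b) * h.uz s t -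
      (σ t - b) * h.vw s t + h.vz s t
  · linear_combination (σ s - b) * a * h.uw s t - a * h.vw s t
  · linear_combination (σ t - b) * a * h.uw s t - a * h.uz s t
  · linear_combination a ^ 2 * h.uw s t
  · linear_combination -a * zw s t

theorem ChainRelationsB.step {κ' b' : R} (hb : ChainRelationsB B φ₀ φ₁ κ b' U V W Z)
    (hκ : κ = 0) (hbb : B b b' = -(κ' * φ₁ * a)) (hab : B a b' = -(κ' * a * (φ₁ * b' + φ₀))) :
    ChainRelationsB B φ₀ φ₁ κ' b' (fun s => (σ s - b) * U s - V s) (fun s => a * U s)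
      (fun s => (σ s - b) * W s - Z s) (fun s => a * W s) := by
  subst hκ
  constructor <;> intro s <;>
    simp only [hB.sub_left, hB.leibniz, hB.algebraMap_left, hbb, hab, hb.u, hb.v, hb.w, hb.z] <;>
    ring

theorem ChainRelationsA.step {ε ε' a' : R} (ha : ChainRelationsA B φ₁ ε κ a' U V W Z)
    (hε : ε = 0) (hba : B b a' = 0) (haa : B a a' = -(ε' * φ₁ * a * a')) :
    ChainRelationsA B φ₁ ε' κ a' (fun s => (σ s - b) * U s - V s) (fun s => a * U s)
      (fun s => (σ s - b) * W s - Z s) (fun s => a * W s) := by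
  subst hε
  constructor <;> intro s <;>
    simp only [hB.sub_left, hB.leibniz, hB.algebraMap_left, hba, haa, ha.u, ha.v, ha.w, ha.z] <;>
    ring

theorem ChainRelationsB₀.step {κ' b₀ : R} (hb : ChainRelationsB₀ B φ₀ φ₁ κ b₀ U V W Z)
    (hκ : κ = 0) (hbb : B b b₀ = -(κ' * φ₁ * a)) (hab : B a b₀ = -(κ' * a * (φ₁ * b₀ + φ₀))) :
    ChainRelationsB₀ B φ₀ φ₁ κ' b₀ (fun s => (σ s - b) * U s - V s) (fun s => a * U s)
      (fun s => (σ s - b) * W s - Z s) (fun s => a * W s) := by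
  subst hκ
  constructor <;> intro s <;>
    simp only [hB.sub_left, hB.leibniz, hB.algebraMap_left, hbb, hab, hb.u, hb.v, hb.w, hb.z] <;>
    ring

end

section

variable {g : ℕ} {φ : ℂ[X]}

theorem isBiderivation_todaBracket : IsBiderivation (todaBracket g φ) :=
  isBiderivation_levelBracket _ _ (todaPi_skew g φ) (todaCasimir_bracket g φ)

local notation "σ" => algebraMap ℂ (OT g)

theorem todaBracket_a_a (i j : ZMod (g + 1)) : todaBracket g φ (aT i) (aT j) =
    σ (φ.coeff 1) * aT i * aT j * ((if i = j + 1 then 1 else 0) - (if j = i + 1 then 1 else 0)) := by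
  rw [aT, aT, todaBracket_mk, polyBracket_X, todaPi]
  simp only [map_mul, map_sub, kron, apply_ite (Ideal.Quotient.mk _), map_one, map_zero,
    eq_comm (a := i + 1)]
  rw [mul_assoc, mul_assoc, mul_assoc]
  rfl

theorem todaBracket_a_b (i j : ZMod (g + 1)) : todaBracket g φ (aT i) (bT j) =
    aT i * (σ (φ.coeff 1) * bT j + σ (φ.coeff 0)) *
      ((if i = j then 1 else 0) - (if j = i + 1 then 1 else 0)) := by
  rw [aT, bT, todaBracket_mk, polyBracket_X, todaPi]
  simp only [map_mul, map_sub, map_add, kron, apply_ite (Ideal.Quotient.mk _), map_one, map_zero,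
    eq_comm (a := i + 1)]
  rfl

theorem todaBracket_b_b (i j : ZMod (g + 1)) : todaBracket g φ (bT i) (bT j) =
    σ (φ.coeff 1) * ((if i = j + 1 then aT j else 0) - (if j = i + 1 then aT i else 0)) := by
  rw [bT, bT, todaBracket_mk, polyBracket_X, todaPi]
  simp only [map_mul, map_sub, kron, mul_ite, mul_one, mul_zero, apply_ite (Ideal.Quotient.mk _),
    map_zero, eq_comm (a := i + 1)]
  rfl

variable (m : ZMod (g + 1))

/-- The coordinates at the position `i`, counted from `m`. -/
noncomputable def aPos (i : ℕ) : OT g := aT (m + (i : ZMod (g + 1)))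
noncomputable def bPos (i : ℕ) : OT g := bT (m + (i : ZMod (g + 1)))

theorem todaBracket_aPos_aPos {i j : ℕ} (hi : i ≤ g) (hj : j ≤ g) :
    todaBracket g φ (aPos m i) (aPos m j) = σ (φ.coeff 1) * aPos m i * aPos m j *
      ((if i = j + 1 ∨ j = g ∧ i = 0 then 1 else 0) -
        (if j = i + 1 ∨ i = g ∧ j = 0 then 1 else 0)) := by
  rw [aPos, aPos, todaBracket_a_a]
  simp only [natCast_add_eq_succ m hi hj, natCast_add_eq_succ m hj hi]

theorem todaBracket_aPos_bPos {i j : ℕ} (hi : i ≤ g) (hj : j ≤ g) :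
    todaBracket g φ (aPos m i) (bPos m j) =
      aPos m i * (σ (φ.coeff 1) * bPos m j + σ (φ.coeff 0)) *
      ((if i = j then 1 else 0) - (if j = i + 1 ∨ i = g ∧ j = 0 then 1 else 0)) := by
  rw [aPos, bPos, todaBracket_a_b]
  simp only [natCast_add_eq_succ m hi hj, add_right_inj, natCast_inj_of_le hi hj]

theorem todaBracket_bPos_bPos {i j : ℕ} (hi : i ≤ g) (hj : j ≤ g) :
    todaBracket g φ (bPos m i) (bPos m j) = σ (φ.coeff 1) *
      ((if i = j + 1 ∨ j = g ∧ i = 0 then aPos m j else 0) -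
        (if j = i + 1 ∨ i = g ∧ j = 0 then aPos m i else 0)) := by
  rw [bPos, bPos, todaBracket_b_b]
  simp only [natCast_add_eq_succ m hi hj, natCast_add_eq_succ m hj hi, aPos]

/-- The four chains that end at the position `j + 1`. -/
noncomputable def chainU (j : ℕ) (s : ℂ) : OT g := evalAt (chain m 1 (j + 1)) s
-- The coefficient is the link between the last two sites when j + 1 ≥ 2, and at j + 1 = g it is
-- a_{m-1}, the link from the last site back to m. In general it is the link that leaves the chain
-- at its end.
noncomputable def chainV (j : ℕ) (s : ℂ) : OT g := aPos m (j + 1) * evalAt (chain m 1 j) s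
noncomputable def chainW (j : ℕ) (s : ℂ) : OT g := aPos m 0 * evalAt (chain m 2 j) s
-- The value 0 at j = 0 stands for a continuant of length -1. It agrees with the convention
-- Δ_{m-1,m,m+1} = 0 for n = 2.
noncomputable def chainZ (j : ℕ) (s : ℂ) : OT g := match j with
  | 0 => 0
  | j + 1 => aPos m 0 * aPos m (j + 2) * evalAt (chain m 2 j) s

theorem chainU_succ (j : ℕ) : chainU m (j + 1) =
    fun s => (σ s - bPos m (j + 2)) * chainU m j s - chainV m j s := by
  funext s
  simp only [chainU, chainV, chain, continuant, evalAt_sub, evalAt_mul, evalAt_X, evalAt_C, aPos,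
    bPos, add_comm 1 j]

theorem chainV_succ (j : ℕ) : chainV m (j + 1) = fun s => aPos m (j + 2) * chainU m j s := rfl

theorem chainW_succ (j : ℕ) : chainW m (j + 1) =
    fun s => (σ s - bPos m (j + 2)) * chainW m j s - chainZ m j s := by
  funext s
  rcases j with - | j
  · simp [chainW, chainZ, chain, continuant, bPos, mul_comm]
  · simp only [chainW, chainZ, chain, continuant, evalAt_sub, evalAt_mul, evalAt_X, evalAt_C, aPos,
      bPos, add_comm 2 j]
    ring

theorem chainZ_succ (j : ℕ) : chainZ m (j + 1) = fun s => aPos m (j + 2) * chainW m j s := by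
  funext s
  simp only [chainZ, chainW]
  ring

set_option maxHeartbeats 1000000 in
-- The induction must also carry the brackets with the sites not yet reached and with b at the
-- position 0. A coordinate interacts with the end of the chain only at the position j + 2, and with
-- its beginning only at the position g, across the cut.
theorem chain_relations (j : ℕ) (hj : j + 1 ≤ g) :
    ChainRelations (todaBracket g φ) (σ (φ.coeff 0)) (σ (φ.coeff 1)) (if j + 1 = g then 1 else 0)
      (chainU m j) (chainV m j) (chainW m j) (chainZ m j) ∧
    (∀ i, j + 1 < i → i ≤ g → ChainRelationsB (todaBracket g φ) (σ (φ.coeff 0)) (σ (φ.coeff 1))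
      (if i = j + 2 then 1 else 0) (bPos m i)
      (chainU m j) (chainV m j) (chainW m j) (chainZ m j)) ∧
    (∀ i, j + 1 < i → i ≤ g → ChainRelationsA (todaBracket g φ) (σ (φ.coeff 1))
      (if i = j + 2 then 1 else 0) (if i = g then 1 else 0) (aPos m i)
      (chainU m j) (chainV m j) (chainW m j) (chainZ m j)) ∧
    ChainRelationsB₀ (todaBracket g φ) (σ (φ.coeff 0)) (σ (φ.coeff 1)) (if j + 1 = g then 1 else 0)
      (bPos m 0) (chainU m j) (chainV m j) (chainW m j) (chainZ m j) := by
  have hB := isBiderivation_todaBracket (g := g) (φ := φ)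
  have aa := fun i j => todaBracket_aPos_aPos (φ := φ) m (i := i) (j := j)
  have ab := fun i j => todaBracket_aPos_bPos (φ := φ) m (i := i) (j := j)
  have bb := fun i j => todaBracket_bPos_bPos (φ := φ) m (i := i) (j := j)
  have hself : ∀ f, todaBracket g φ f f = 0 := hB.self
  induction j with
  | zero =>
    have hU : chainU m 0 = fun s => σ s - bPos m 1 := by
      funext s; simp [chainU, chain, continuant, bPos]
    have hV : chainV m 0 = fun _ => aPos m 1 := by
      funext s; simp [chainV, chain, continuant]
    have hW : chainW m 0 = fun _ => aPos m 0 := by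
      funext s; simp [chainW, chain, continuant]
    have hZ : chainZ m 0 = fun _ => 0 := rfl
    rw [hU, hV, hW, hZ]
    -- For g = 1 the chain of one site is already closed, so positions 0 and 1 are neighbours on
    -- both sides; the case distinctions separate this.
    refine ⟨?_, fun i hi hi' => ?_, fun i hi hi' => ?_, ?_⟩
    · constructor <;> intro s t <;>
        try simp only [hB.sub_left, hB.sub_right, hB.algebraMap_left, hB.algebraMap_right, hself,
          hB.zero_right]
      · ring
      · rw [hB.skew (bPos m 1), ab 1 1 (by omega) (by omega)]
        split_ifs <;> first | (exfalso; omega) | ring1 | (exfalso; grind)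
      · rw [hB.skew (bPos m 1), ab 0 1 (by omega) (by omega)]
        split_ifs <;> first | (exfalso; omega) | ring1
      · ring
      · rw [aa 1 0 (by omega) (by omega)]
        split_ifs <;> first | (exfalso; omega) | ring1 | (exfalso; grind)
      · ring
      · ring
    · constructor <;> intro s <;>
        simp only [hB.sub_left, hB.algebraMap_left, hB.zero_left, bb 1 i (by omega) hi',
          ab 1 i (by omega) hi', ab 0 i (by omega) hi'] <;>
        split_ifs <;> first | (exfalso; omega) | ring1 | (exfalso; grind)
    · constructor <;> intro s <;>
        simp only [hB.sub_left, hB.algebraMap_left, hB.zero_left, hB.skew (bPos m 1),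
          ab i 1 hi' (by omega), aa 1 i (by omega) hi', aa 0 i (by omega) hi'] <;>
        split_ifs <;> first | (exfalso; omega) | ring1 | (exfalso; grind)
    · constructor <;> intro s <;>
        simp only [hB.sub_left, hB.algebraMap_left, hB.zero_left, bb 1 0 (by omega) (by omega),
          ab 1 0 (by omega) (by omega), ab 0 0 (by omega) (by omega)] <;>
        split_ifs <;> first | (exfalso; omega) | ring1 | (exfalso; grind)
  | succ j ih =>
    obtain ⟨h1, h2, h3, h4⟩ := ih (by omega)
    rw [chainU_succ, chainV_succ, chainW_succ, chainZ_succ]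
    refine ⟨?_, fun i hi hi' => ?_, fun i hi hi' => ?_, ?_⟩
    · rw [if_neg (by omega)] at h1
      refine h1.step hB ?_ ?_ ?_
      · have := h2 (j + 2) (by omega) (by omega)
        rwa [if_pos rfl] at this
      · have := h3 (j + 2) (by omega) (by omega)
        rwa [if_pos rfl] at this
      · rw [ab _ _ (by omega) (by omega)]
        split_ifs <;> first | (exfalso; omega) | ring1 | (exfalso; grind)
    · refine (h2 i (by omega) hi').step hB (if_neg (by omega)) ?_ ?_
      · rw [bb _ _ (by omega) hi']
        split_ifs <;> first | (exfalso; omega) | ring1 | (exfalso; grind)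
      · rw [ab _ _ (by omega) hi']
        split_ifs <;> first | (exfalso; omega) | ring1
    · refine (h3 i (by omega) hi').step hB (if_neg (by omega)) ?_ ?_
      · rw [hB.skew, ab _ _ hi' (by omega)]
        split_ifs <;> first | (exfalso; omega) | ring1 | (exfalso; grind)
      · rw [aa _ _ (by omega) hi']
        split_ifs <;> first | (exfalso; omega) | ring1 | (exfalso; grind)
    · refine h4.step hB (if_neg (by omega)) ?_ ?_
      · rw [bb _ _ (by omega) (by omega)]
        split_ifs <;> first | (exfalso; omega) | ring1 | (exfalso; grind)
      · rw [ab _ _ (by omega) (by omega)]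
        split_ifs <;> first | (exfalso; omega) | ring1 | (exfalso; grind)

end

end PrymToda

namespace PrymToda

open Polynomial

/-! ## A criterion for Poisson maps to the Mumford system -/

section

variable {g : ℕ} {A : Type*} [CommRing A] [Algebra ℂ A] {BM : OM g → OM g → OM g}
  {BA : A → A → A} (hM : IsBiderivation BM) (hA : IsBiderivation BA) (ψ : OM g →ₐ[ℂ] A)

/-- The defect of `ψ` from being a Poisson map. -/
noncomputable def poissonDefect (f : OM g) : OM g →ₗ[ℂ] A :=
  ψ.toLinearMap ∘ₗ (hM.ad f).toLinearMap - (hA.ad (ψ f)).toLinearMap ∘ₗ ψ.toLinearMap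

theorem poissonDefect_apply (f f' : OM g) :
    poissonDefect hM hA ψ f f' = ψ (BM f f') - BA (ψ f) (ψ f') := rfl

theorem poissonDefect_mul (f f' f'' : OM g) : poissonDefect hM hA ψ f (f' * f'') =
    ψ f' * poissonDefect hM hA ψ f f'' + ψ f'' * poissonDefect hM hA ψ f f' := by
  simp only [poissonDefect_apply, map_mul, hM.mul_right, hA.mul_right, map_add]
  ring

theorem poissonDefect_skew (f f' : OM g) :
    poissonDefect hM hA ψ f f' = -poissonDefect hM hA ψ f' f := by
  rw [poissonDefect_apply, poissonDefect_apply, hM.skew, hA.skew, map_neg]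
  ring

include hM hA in
-- The defect is skew and a derivation along ψ in each argument, so it is determined by its values
-- on u, v and H. Three rounds make one argument arbitrary and remove the condition that the points
-- are distinct.
theorem isPoissonMap_of_uvh
    (huu : ∀ s t, s ≠ t → ψ (BM (uAt g s) (uAt g t)) = BA (ψ (uAt g s)) (ψ (uAt g t)))
    (huv : ∀ s t, s ≠ t → ψ (BM (uAt g s) (vAt g t)) = BA (ψ (uAt g s)) (ψ (vAt g t)))
    (hvv : ∀ s t, s ≠ t → ψ (BM (vAt g s) (vAt g t)) = BA (ψ (vAt g s)) (ψ (vAt g t)))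
    (huh : ∀ s t, s ≠ t → ψ (BM (uAt g s) (hAt g t)) = BA (ψ (uAt g s)) (ψ (hAt g t)))
    (hvh : ∀ s t, s ≠ t → ψ (BM (vAt g s) (hAt g t)) = BA (ψ (vAt g s)) (ψ (hAt g t)))
    (hhh : ∀ s t, s ≠ t → ψ (BM (hAt g s) (hAt g t)) = BA (ψ (hAt g s)) (ψ (hAt g t))) :
    IsPoissonMap BA BM ψ := by
  let D := poissonDefect hM hA ψ
  have key : ∀ f (F : Finset ℂ), (∀ s ∉ F, D (uAt g s) f = 0) → (∀ s ∉ F, D (vAt g s) f = 0) →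
      (∀ s ∉ F, D (hAt g s) f = 0) → ∀ f', D f f' = 0 := by
    intro f F h1 h2 h3
    refine derivation_along_ext ψ (D f) (poissonDefect_mul hM hA ψ f) F (fun s hs => ?_)
      (fun s hs => ?_) fun s hs => ?_
    · exact (poissonDefect_skew hM hA ψ _ _).trans (by rw [neg_eq_zero]; exact h1 s hs)
    · exact (poissonDefect_skew hM hA ψ _ _).trans (by rw [neg_eq_zero]; exact h2 s hs)
    · exact (poissonDefect_skew hM hA ψ _ _).trans (by rw [neg_eq_zero]; exact h3 s hs)
  have hu : ∀ t f', D (uAt g t) f' = 0 := by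
    intro t
    refine key _ {t} (fun s hs => ?_) (fun s hs => ?_) fun s hs => ?_ <;>
      have hst : s ≠ t := by simpa using hs
    · exact sub_eq_zero.2 (huu s t hst)
    · exact (poissonDefect_skew hM hA ψ _ _).trans
        (by rw [neg_eq_zero]; exact sub_eq_zero.2 (huv t s hst.symm))
    · exact (poissonDefect_skew hM hA ψ _ _).trans
        (by rw [neg_eq_zero]; exact sub_eq_zero.2 (huh t s hst.symm))
  have hv : ∀ t f', D (vAt g t) f' = 0 := by
    intro t
    refine key _ {t} (fun s _ => hu s _) (fun s hs => ?_) fun s hs => ?_ <;>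
      have hst : s ≠ t := by simpa using hs
    · exact sub_eq_zero.2 (hvv s t hst)
    · exact (poissonDefect_skew hM hA ψ _ _).trans
        (by rw [neg_eq_zero]; exact sub_eq_zero.2 (hvh t s hst.symm))
  have hh : ∀ t f', D (hAt g t) f' = 0 := by
    intro t
    refine key _ {t} (fun s _ => hu s _) (fun s _ => hv s _) fun s hs => ?_
    have hst : s ≠ t := by simpa using hs
    exact sub_eq_zero.2 (hhh s t hst)
  intro f f'
  exact sub_eq_zero.1 (key f ∅ (fun s _ => hu s _) (fun s _ => hv s _) (fun s _ => hh s _) f')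

end

/-! ## The maps `Φ_m` -/

section

variable {g : ℕ} (m : ZMod (g + 1))

/-- The point with all coordinates equal to 1 lies on the hypersurface. -/
instance : Nontrivial (OT g) := by
  let e : OT g →ₐ[ℂ] ℂ := Ideal.Quotient.liftₐ (Ideal.span {todaCasimir g - 1})
    (MvPolynomial.aeval fun _ => (1 : ℂ)) (by
      intro f hf
      obtain ⟨k, rfl⟩ := Ideal.mem_span_singleton'.1 hf
      simp [todaCasimir])
  exact e.toRingHom.domain_nontrivial

theorem chain_monic (c : ℕ) : ∀ k, (chain m c k).Monic ∧ (chain m c k).natDegree = k := by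
  intro k
  induction k using Nat.twoStepInduction with
  | zero => exact ⟨monic_one, natDegree_one⟩
  | one => exact ⟨monic_X_sub_C _, natDegree_X_sub_C _⟩
  | more k h1 h2 =>
    set b : OT g := bT (m + ((c + k + 1 : ℕ) : ZMod (g + 1)))
    set a : OT g := aT (m + ((c + k : ℕ) : ZMod (g + 1)))
    have e : chain m c (k + 2) = (X - C b) * chain m c (k + 1) - C a * chain m c k := rfl
    have hm : ((X - C b) * chain m c (k + 1)).Monic := (monic_X_sub_C b).mul h2.1
    have hn : ((X - C b) * chain m c (k + 1)).natDegree = k + 2 := by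
      rw [(monic_X_sub_C b).natDegree_mul h2.1, natDegree_X_sub_C, h2.2]
      ring
    have hlt : (C a * chain m c k).degree < ((X - C b) * chain m c (k + 1)).degree := by
      rw [degree_eq_natDegree hm.ne_zero, hn]
      refine lt_of_le_of_lt degree_le_natDegree ?_
      have := natDegree_C_mul_le a (chain m c k)
      exact_mod_cast (by omega)
    rw [e]
    exact ⟨hm.sub_of_left hlt, by rw [natDegree_sub_eq_left_of_natDegree_lt (by
      have := natDegree_C_mul_le a (chain m c k)
      omega), hn]⟩

theorem uPhi_eq : uPhi g m = chain m 1 g := todaMinor_m m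

theorem vPhi_eq (hg : 1 ≤ g) : vPhi g m =
    C (aT m) * chain m 2 (g - 1) - C (aT (m - 1)) * chain m 1 (g - 1) := by
  rw [vPhi, todaMinor_left m hg, todaMinor_right m hg]

theorem natDegree_C_mul_chain (a : OT g) (c k : ℕ) : (C a * chain m c k).natDegree ≤ k :=
  (natDegree_C_mul_le _ _).trans (chain_monic m c k).2.le

/-- `Δ_{m-1,m,m+1}` has degree at most `g`. -/
theorem natDegree_todaMinor_both (hg : 1 ≤ g) :
    (todaMinor g m [m - 1, m, m + 1]).natDegree ≤ g := by
  rcases Nat.lt_or_ge 1 g with h | h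
  · rw [todaMinor_both m h, (chain_monic m 2 _).2]
    omega
  · obtain rfl : g = 1 := by omega
    rw [todaMinor_both_one, natDegree_zero]
    omega

theorem wPhi_eq (hg : 1 ≤ g) : ∃ R : (OT g)[X], R.natDegree ≤ g ∧
    wPhi g m = (X - C (bT m)) ^ 2 * chain m 1 g + R := by
  refine ⟨4 * C (aT m * aT (m - 1)) * todaMinor g m [m - 1, m, m + 1] -
    2 * (X - C (bT m)) * (C (aT (m - 1)) * todaMinor g m [m - 1, m] +
        C (aT m) * todaMinor g m [m, m + 1]), ?_, ?_⟩
  · rw [todaMinor_left m hg, todaMinor_right m hg]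
    have e4 : (4 : (OT g)[X]) = C 4 := (map_ofNat C 4).symm
    have e2 : (2 : (OT g)[X]) = C 2 := (map_ofNat C 2).symm
    rw [e4, e2, ← C_mul, mul_assoc (C 2)]
    refine natDegree_sub_le' (natDegree_C_mul_le' _ _ _ (natDegree_todaMinor_both m hg))
      (natDegree_C_mul_le' _ _ _ (natDegree_mul_le' (k := 1) (l := g - 1) ?_ ?_ (by omega)))
    · exact (natDegree_X_sub_C _).le
    · exact natDegree_add_le_of_degree_le (natDegree_C_mul_chain _ _ _ _)
        (natDegree_C_mul_chain _ _ _ _)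
  · rw [wPhi, todaMinor_m]
    ring

/-- The comorphism only sees the coordinate coefficients. That the remaining ones take their
prescribed constant values shows that the formula for u lands in the phase space. -/
theorem map_uM : (uM g).map (phiT g m).toRingHom = uPhi g m := by
  refine Polynomial.ext fun i => ?_
  rw [coeff_map]
  rcases Nat.lt_or_ge i g with h | h
  · rw [show i = ((⟨i, h⟩ : Fin g) : ℕ) from rfl, coeff_uM]
    exact MvPolynomial.aeval_X _ _
  · rw [coeff_uM_of_le g h, uPhi_eq]
    refine ((phiT g m).commutes _).trans ?_
    split_ifs with h1
    · have := (chain_monic m 1 g).1.coeff_natDegree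
      rw [(chain_monic m 1 g).2] at this
      rw [h1, this, map_one]
    · rw [coeff_eq_zero_of_natDegree_lt (by rw [(chain_monic m 1 g).2]; omega), map_zero]

theorem map_vM (hg : 1 ≤ g) : (vM g).map (phiT g m).toRingHom = vPhi g m := by
  refine Polynomial.ext fun i => ?_
  rw [coeff_map]
  rcases Nat.lt_or_ge i g with h | h
  · rw [show i = ((⟨i, h⟩ : Fin g) : ℕ) from rfl, coeff_vM]
    exact MvPolynomial.aeval_X _ _
  · rw [coeff_vM_of_le g h, map_zero, map_zero, coeff_eq_zero_of_natDegree_lt]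
    rw [vPhi_eq m hg]
    exact lt_of_le_of_lt (natDegree_sub_le' (natDegree_C_mul_chain _ _ _ _)
      (natDegree_C_mul_chain _ _ _ _)) (by omega)

theorem map_wM (hg : 1 ≤ g) : (wM g).map (phiT g m).toRingHom = wPhi g m := by
  refine Polynomial.ext fun i => ?_
  rw [coeff_map]
  rcases Nat.lt_or_ge i (g + 2) with h | h
  · rw [show i = ((⟨i, h⟩ : Fin (g + 2)) : ℕ) from rfl, coeff_wM]
    exact MvPolynomial.aeval_X _ _
  · obtain ⟨R, hR, e⟩ := wPhi_eq m hg
    have hm : ((X - C (bT m)) ^ 2 * chain m 1 g).Monic :=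
      ((monic_X_sub_C _).pow 2).mul (chain_monic m 1 g).1
    have hd : ((X - C (bT m)) ^ 2 * chain m 1 g).natDegree = g + 2 := by
      rw [((monic_X_sub_C _).pow 2).natDegree_mul (chain_monic m 1 g).1,
        (monic_X_sub_C _).natDegree_pow, natDegree_X_sub_C, (chain_monic m 1 g).2]
      ring
    rw [coeff_wM_of_le g h, e, coeff_add, coeff_eq_zero_of_natDegree_lt (p := R) (by omega)]
    refine ((phiT g m).commutes _).trans ?_
    split_ifs with h1
    · have := hm.coeff_natDegree
      rw [hd] at this
      rw [h1, this, map_one, add_zero]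
    · rw [coeff_eq_zero_of_natDegree_lt (by rw [hd]; omega), map_zero, add_zero]

local notation "σ" => algebraMap ℂ (OT g)

theorem aPos_zero : aPos m 0 = aT m := by rw [aPos, Nat.cast_zero, add_zero]

theorem bPos_zero : bPos m 0 = bT m := by rw [bPos, Nat.cast_zero, add_zero]

theorem aPos_g : aPos m g = aT (m - 1) := by rw [aPos, sub_one_eq]

theorem phiT_uAt (hg : 1 ≤ g) (s : ℂ) : phiT g m (uAt g s) = chainU m (g - 1) s := by
  rw [uAt, ← evalAt_map, map_uM, uPhi_eq, chainU, Nat.sub_add_cancel hg]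

theorem phiT_vAt (hg : 1 ≤ g) (s : ℂ) :
    phiT g m (vAt g s) = chainW m (g - 1) s - chainV m (g - 1) s := by
  rw [vAt, ← evalAt_map, map_vM m hg, vPhi_eq m hg, chainW, chainV, Nat.sub_add_cancel hg,
    aPos_zero, aPos_g]
  simp

theorem evalAt_todaMinor_both (hg : 1 ≤ g) (s : ℂ) :
    aT m * aT (m - 1) * evalAt (todaMinor g m [m - 1, m, m + 1]) s = chainZ m (g - 1) s := by
  rcases Nat.lt_or_ge 1 g with h | h
  · obtain ⟨k, rfl⟩ : ∃ k, g = k + 2 := ⟨g - 2, by omega⟩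
    rw [todaMinor_both m h, show k + 2 - 1 = k + 1 from rfl, chainZ, aPos_zero, aPos_g]
    rfl
  · obtain rfl : g = 1 := by omega
    rw [todaMinor_both_one, evalAt_zero, mul_zero]
    rfl

theorem phiT_wAt (hg : 1 ≤ g) (s : ℂ) :
    phiT g m (wAt g s) = (σ s - bPos m 0) ^ 2 * chainU m (g - 1) s -
      2 * (σ s - bPos m 0) * (chainV m (g - 1) s + chainW m (g - 1) s) +
      4 * chainZ m (g - 1) s := by
  have e4 : evalAt (4 : (OT g)[X]) s = 4 := evalAt_ofNat 4 s
  have e2 : evalAt (2 : (OT g)[X]) s = 2 := evalAt_ofNat 2 s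
  rw [wAt, ← evalAt_map, map_wM m hg, wPhi, todaMinor_m, todaMinor_left m hg,
    todaMinor_right m hg, ← evalAt_todaMinor_both m hg, chainU, chainW, chainV,
    Nat.sub_add_cancel hg, aPos_zero, aPos_g, bPos_zero]
  simp only [evalAt_add, evalAt_sub, evalAt_mul, evalAt_pow, evalAt_X, evalAt_C, e4, e2]
  ring

theorem evalAt_halfK (hg : 1 ≤ g) (s : ℂ) : evalAt (halfK m) s =
    (σ s - bPos m 0) * chainU m (g - 1) s - chainV m (g - 1) s - chainW m (g - 1) s := by
  rw [halfK, chainU, chainV, chainW, Nat.sub_add_cancel hg, bPos_zero, aPos_g, aPos_zero]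
  simp

/-- The determinant of a product of transfer matrices: each appended site contributes the factor a.
-/
theorem chain_wronskian (j : ℕ) (s : ℂ) : chainU m j s * chainZ m j s -
    chainV m j s * chainW m j s = -∏ i ∈ Finset.range (j + 2), aPos m i := by
  induction j with
  | zero => simp [chainU, chainV, chainW, chainZ, chain, continuant, Finset.prod_range_succ]; ring
  | succ j ih =>
    rw [chainU_succ, chainV_succ, chainW_succ, chainZ_succ, Finset.prod_range_succ]
    linear_combination aPos m (j + 2) * ih

/-- Completing the square gives uw + v² = ((x - b_m) U - V - W)² + 4 (UZ - VW), and the last bracket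
is -∏ a_i = -1. -/
theorem phiT_hAt (hg : 1 ≤ g) (s : ℂ) : phiT g m (hAt g s) = evalAt (halfK m) s ^ 2 - 4 := by
  have h := chain_wronskian m (g - 1) s
  have h1 : ∏ i ∈ Finset.range (g - 1 + 2), aPos m i = 1 := by
    rw [show g - 1 + 2 = g + 1 by omega]
    exact prod_range_aT m
  rw [h1] at h
  rw [hAt_eq, map_add, map_mul, map_pow, phiT_uAt m hg, phiT_vAt m hg, phiT_wAt m hg,
    evalAt_halfK m hg]
  linear_combination 4 * h

theorem halfK_monic (hg : 1 ≤ g) : (halfK m).Monic ∧ (halfK m).natDegree = g + 1 := by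
  have hm : ((X - C (bT m)) * chain m 1 g).Monic := (monic_X_sub_C _).mul (chain_monic m 1 g).1
  have hd : ((X - C (bT m)) * chain m 1 g).natDegree = g + 1 := by
    rw [(monic_X_sub_C _).natDegree_mul (chain_monic m 1 g).1, natDegree_X_sub_C,
      (chain_monic m 1 g).2, add_comm]
  have hr : (C (aT (m - 1)) * chain m 1 (g - 1) + C (aT m) * chain m 2 (g - 1)).natDegree ≤ g - 1 :=
    natDegree_add_le_of_degree_le (natDegree_C_mul_chain _ _ _ _) (natDegree_C_mul_chain _ _ _ _)
  rw [halfK, sub_sub]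
  have hlt : (C (aT (m - 1)) * chain m 1 (g - 1) + C (aT m) * chain m 2 (g - 1)).degree <
      ((X - C (bT m)) * chain m 1 g).degree := by
    rw [degree_eq_natDegree hm.ne_zero, hd]
    exact lt_of_le_of_lt degree_le_natDegree (by exact_mod_cast (by omega))
  exact ⟨hm.sub_of_left hlt, by rw [natDegree_sub_eq_left_of_natDegree_lt (by omega), hd]⟩

/-- The constant -4 has degree below n, so K/2 is the square root of the pulled back H; hence r
becomes -4. -/
theorem map_pM (hg : 1 ≤ g) : (pM g).map (phiT g m).toRingHom = halfK m := by
  have hp := pM_monic g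
  refine sqrt_unique (g + 1) ((momentumM g).map (phiT g m).toRingHom) _ _ (hp.map _) ?_ ?_
    (halfK_monic m hg).1 (halfK_monic m hg).2 ?_
  · rw [hp.natDegree_map, natDegree_pM]
  · rw [← Polynomial.map_pow, ← Polynomial.map_sub]
    exact lt_of_le_of_lt degree_map_le (degree_rM g)
  · have e : (momentumM g).map (phiT g m).toRingHom - halfK m ^ 2 = C (-4) := by
      refine eq_of_evalAt ∅ fun s _ => ?_
      rw [evalAt_sub, evalAt_map, evalAt_pow, evalAt_C]
      exact sub_eq_of_eq_add ((phiT_hAt m hg s).trans (by ring))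
    rw [e]
    exact lt_of_le_of_lt degree_C_le (by exact_mod_cast Nat.succ_pos g)

theorem phiT_pAt (hg : 1 ≤ g) (s : ℂ) : phiT g m (pAt g s) =
    (σ s - bPos m 0) * chainU m (g - 1) s - chainV m (g - 1) s - chainW m (g - 1) s := by
  rw [pAt, ← evalAt_map, map_pM m hg, evalAt_halfK m hg]

theorem phiT_halfAlpha (hg : 1 ≤ g) : phiT g m (halfAlpha g) = -bPos m 0 := by
  have h1 := congrArg (phiT g m) (coeff_pM_g hg)
  have h2 : phiT g m ((pM g).coeff g) = (halfK m).coeff g := by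
    rw [← map_pM m hg, coeff_map]; rfl
  have h3 : phiT g m ((uM g).coeff (g - 1)) = (chain m 1 g).coeff (g - 1) := by
    rw [← uPhi_eq, ← map_uM m, coeff_map]; rfl
  have h4 := (chain_monic m 1 g).1.coeff_natDegree
  rw [(chain_monic m 1 g).2] at h4
  rw [map_add, h2, h3, halfK, coeff_sub, coeff_sub,
    coeff_eq_zero_of_natDegree_lt (lt_of_le_of_lt (natDegree_C_mul_chain _ _ _ _) (by omega)),
    coeff_eq_zero_of_natDegree_lt (lt_of_le_of_lt (natDegree_C_mul_chain _ _ _ _) (by omega)),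
    sub_mul, coeff_sub, coeff_C_mul, h4] at h1
  obtain ⟨k, rfl⟩ : ∃ k, g = k + 1 := ⟨g - 1, by omega⟩
  rw [coeff_X_mul, Nat.add_sub_cancel] at h1
  rw [bPos_zero]
  linear_combination -h1

end

end PrymToda

namespace PrymToda

open Polynomial

/-! ## `Φ_m` is a Poisson map -/

section

variable {g : ℕ} (m : ZMod (g + 1)) {φ : ℂ[X]} (hφ : φ.natDegree ≤ 1) (hg : 1 ≤ g)

local notation "σ" => algebraMap ℂ (OT g)
local notation "ph" => phAt (OT g) φ

theorem two_isUnit {A : Type*} [CommRing A] [Algebra ℂ A] : IsUnit (2 : A) := by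
  have h := (IsUnit.mk0 (2 : ℂ) two_ne_zero).map (algebraMap ℂ A)
  rwa [map_ofNat] at h

include hg in
theorem closed_chain_relations :
    ChainRelations (todaBracket g φ) (σ (φ.coeff 0)) (σ (φ.coeff 1)) 1
      (chainU m (g - 1)) (chainV m (g - 1)) (chainW m (g - 1)) (chainZ m (g - 1)) ∧
    ChainRelationsB₀ (todaBracket g φ) (σ (φ.coeff 0)) (σ (φ.coeff 1)) 1
      (bPos m 0) (chainU m (g - 1)) (chainV m (g - 1)) (chainW m (g - 1)) (chainZ m (g - 1)) := by
  have h := chain_relations (φ := φ) m (g - 1) (by omega)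
  rw [if_pos (Nat.sub_add_cancel hg)] at h
  exact ⟨h.1, h.2.2.2⟩

include hφ hg

/-- With u = U, v = W - V, p = (x - b_m) U - V - W and d = -b_m, the required identities are linear
combinations of the relations of the closed chain; {w, ·} is never computed directly. -/
theorem isPoissonMap_phiT : IsPoissonMap (todaBracket g φ) (quadBracket g φ) (phiT g m) := by
  have hB := isBiderivation_todaBracket (g := g) (φ := φ)
  have hM := isBiderivation_quadBracket (g := g) hφ
  obtain ⟨h, hb⟩ := closed_chain_relations (φ := φ) m hg
  have vu : ∀ s t, (σ s - σ t) * todaBracket g φ (chainV m (g - 1) s) (chainU m (g - 1) t) =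
      (σ (φ.coeff 1) * σ s + σ (φ.coeff 0)) * chainU m (g - 1) t * chainV m (g - 1) s -
      (σ (φ.coeff 1) * σ t + σ (φ.coeff 0)) * chainV m (g - 1) t * chainU m (g - 1) s :=
    fun s t => by rw [hB.skew]; linear_combination h.uv t s
  have wu : ∀ s t, (σ s - σ t) * todaBracket g φ (chainW m (g - 1) s) (chainU m (g - 1) t) =
      (σ (φ.coeff 1) * σ t + σ (φ.coeff 0)) * chainW m (g - 1) t * chainU m (g - 1) s -
      (σ (φ.coeff 1) * σ s + σ (φ.coeff 0)) * chainU m (g - 1) t * chainW m (g - 1) s :=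
    fun s t => by rw [hB.skew]; linear_combination h.uw t s
  have wv : ∀ s t, (σ s - σ t) * todaBracket g φ (chainW m (g - 1) s) (chainV m (g - 1) t) =
      (σ (φ.coeff 1) * σ t + σ (φ.coeff 0)) * chainZ m (g - 1) t * chainU m (g - 1) s -
      (σ (φ.coeff 1) * σ s + σ (φ.coeff 0)) * chainU m (g - 1) t * chainZ m (g - 1) s :=
    fun s t => by rw [hB.skew]; linear_combination h.vw t s
  have b0u : ∀ s, todaBracket g φ (bPos m 0) (chainU m (g - 1) s) =
      σ (φ.coeff 1) * (chainW m (g - 1) s - chainV m (g - 1) s) :=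
    fun s => by rw [hB.skew, hb.u]; ring
  have b0v : ∀ s, todaBracket g φ (bPos m 0) (chainV m (g - 1) s) =
      (σ (φ.coeff 1) * bPos m 0 + σ (φ.coeff 0)) * chainV m (g - 1) s +
        σ (φ.coeff 1) * chainZ m (g - 1) s :=
    fun s => by rw [hB.skew, hb.v]; ring
  have b0w : ∀ s, todaBracket g φ (bPos m 0) (chainW m (g - 1) s) =
      -(σ (φ.coeff 1) * bPos m 0 + σ (φ.coeff 0)) * chainW m (g - 1) s -
        σ (φ.coeff 1) * chainZ m (g - 1) s :=
    fun s => by rw [hB.skew, hb.w]; ring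
  have b00 : todaBracket g φ (bPos m 0) (bPos m 0) = 0 := hB.self _
  have hr4 : ∀ f, todaBracket g φ f 4 = 0 := fun f => by
    have := hB.algebraMap_right f 4
    rwa [map_ofNat] at this
  -- On both sides H is p² up to a Casimir, namely r and -4. Brackets with H therefore carry the
  -- common factor 2p and reduce to brackets with p.
  have hph : ∀ f t, phiT g m (quadBracket g φ f (hAt g t)) =
      2 * phiT g m (pAt g t) * phiT g m (quadBracket g φ f (pAt g t)) := fun f t => by
    have := congrArg (phiT g m) (qad_h hφ hg f t)
    rwa [map_mul, map_mul, map_ofNat] at this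
  have hbh : ∀ f t, todaBracket g φ f (phiT g m (hAt g t)) =
      2 * phiT g m (pAt g t) * todaBracket g φ f (phiT g m (pAt g t)) := fun f t => by
    have hp : phiT g m (hAt g t) = phiT g m (pAt g t) * phiT g m (pAt g t) - 4 := by
      rw [phiT_hAt m hg, pAt, ← evalAt_map, map_pM m hg, pow_two]
    rw [hp, hB.sub_right, hB.mul_right, hr4]
    ring
  have h2 : ∀ a : OT g, 2 * a = 0 → a = 0 := fun a => two_isUnit.mul_right_eq_zero.1
  refine isPoissonMap_of_uvh hM hB _ (fun s t hst => ?_) (fun s t hst => ?_) (fun s t hst => ?_)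
    (fun s t hst => ?_) (fun s t hst => ?_) fun s t hst => ?_
  · have e := qad_u_u hφ hg s t
    rw [qad_apply] at e
    rw [e, phiT_uAt m hg, phiT_uAt m hg, h.uu, map_zero]
  · refine sub_mul_cancel hst ?_
    have e := congrArg (phiT g m) (qad_u_v hφ hg s t)
    simp only [qad_apply, map_mul, map_sub, map_add, AlgHom.commutes, alphaPhiAt,
      phiT_uAt m hg, phiT_pAt m hg, phiT_halfAlpha m hg, phAt_eq hφ] at e
    refine e.trans ?_
    rw [phiT_uAt m hg, phiT_vAt m hg, hB.sub_right]
    linear_combination h.uv s t - h.uw s t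
  · have e := qad_v_v hφ hg s t
    rw [qad_apply] at e
    refine sub_mul_cancel hst ?_
    rw [e, phiT_vAt m hg, phiT_vAt m hg, map_zero]
    simp only [hB.sub_left, hB.sub_right, h.vv, h.ww]
    linear_combination h.vw s t + wv s t
  · rw [hph, hbh]
    congr 1
    refine sub_eq_zero.1 (h2 _ (sub_mul_cancel hst ?_))
    have e := congrArg (phiT g m) (qad_u_p hφ hg s t)
    simp only [qad_apply, map_mul, map_sub, map_add, map_ofNat, AlgHom.commutes,
      phiT_uAt m hg, phiT_vAt m hg, phAt_eq hφ] at e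
    simp only [phiT_uAt m hg, phiT_pAt m hg, hB.sub_right, hB.mul_right, hB.algebraMap_right, h.uu,
      hb.u]
    linear_combination e + 2 * h.uv s t + 2 * h.uw s t
  · rw [hph, hbh]
    congr 1
    refine sub_eq_zero.1 (h2 _ (sub_mul_cancel hst ?_))
    have e := congrArg (phiT g m) (qad_v_p hφ hg s t)
    simp only [qad_apply, map_mul, map_sub, map_add, map_ofNat, AlgHom.commutes,
      phiT_uAt m hg, phiT_wAt m hg, phiT_halfAlpha m hg, phAt_eq hφ] at e
    simp only [phiT_vAt m hg, phiT_pAt m hg, hB.sub_left, hB.sub_right, hB.mul_right,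
      hB.algebraMap_right, h.vv, h.ww, hb.v, hb.w]
    linear_combination e - 2 * (σ t - bPos m 0) * (wu s t - vu s t) + 2 * wv s t - 2 * h.vw s t
  · rw [hph, hbh, hM.skew, hB.skew, map_neg, hph, hbh]
    have e : quadBracket g φ (pAt g t) (pAt g s) = 0 := qad_p_p hφ hg t s
    -- The coefficients of K are in involution for the Toda bracket.
    have e' : todaBracket g φ (phiT g m (pAt g t)) (phiT g m (pAt g s)) = 0 := by
      refine sub_mul_cancel hst.symm ?_
      simp only [phiT_pAt m hg, hB.sub_left, hB.sub_right, hB.mul_right, hB.leibniz,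
        hB.algebraMap_left, hB.algebraMap_right, h.uu, h.vv, h.ww, hb.u, hb.v, hb.w, b0u, b0v, b0w,
        b00]
      linear_combination -(σ t - bPos m 0) * (h.uv t s + h.uw t s) -
        (σ s - bPos m 0) * (vu t s + wu t s) + h.vw t s + wv t s
    rw [e, e', map_zero]

end

end PrymToda

namespace PrymToda

open Polynomial

/-! ## Newton's identities for the traces of the powers of a matrix -/

section

variable {R n : Type*} [CommRing R] [Fintype n] [DecidableEq n] (M : Matrix n n R)

/-- Each permutation term of det(x - M) is differentiated factor by factor. Only diagonal factors
depend on x, and the terms with the i-th one removed sum to the i-th diagonal entry of the adjugate.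
-/
theorem derivative_charpoly : derivative M.charpoly = (M.charmatrix.adjugate).trace := by
  have h : ∀ i, M.charmatrix.adjugate i i = ∑ τ : Equiv.Perm n, ((Equiv.Perm.sign τ : ℤ) : R[X]) *
      ((∏ j ∈ Finset.univ.erase i, M.charmatrix (τ j) j) * derivative (M.charmatrix (τ i) i)) := by
    intro i
    rw [← Matrix.transpose_transpose M.charmatrix, ← Matrix.adjugate_transpose,
      Matrix.transpose_apply, Matrix.adjugate_apply, ← Matrix.det_transpose, Matrix.det_apply']
    refine Finset.sum_congr rfl fun τ _ => ?_
    rw [← Finset.mul_prod_erase _ _ (Finset.mem_univ i), mul_comm (Matrix.transpose _ _ _)]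
    congr 2
    · refine Finset.prod_congr rfl fun j hj => ?_
      rw [Matrix.transpose_apply, Matrix.updateRow_ne (Finset.ne_of_mem_erase hj),
        Matrix.transpose_apply, Matrix.transpose_transpose]
    · rw [Matrix.transpose_apply, Matrix.updateRow_self, Matrix.transpose_transpose,
        Matrix.charmatrix_apply, Matrix.diagonal_apply, Pi.single_apply]
      split_ifs <;> simp
  rw [Matrix.trace, Matrix.charpoly, Matrix.det_apply', derivative_sum]
  simp only [Matrix.diag_apply, h]
  rw [Finset.sum_comm]
  refine Finset.sum_congr rfl fun τ _ => ?_
  rw [derivative_mul, derivative_intCast, zero_mul, zero_add, derivative_prod_finset, Finset.mul_sum]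

/-- Comparing coefficients in (x - M) adj(x - M) = χ(x) gives A_j = χ_{j+1} + M A_{j+1}; this is
iterated N times. -/
theorem coeff_matPolyEquiv_adjugate (j : ℕ) : ∀ N,
    (matPolyEquiv M.charmatrix.adjugate).coeff j =
      ∑ i ∈ Finset.range N, M.charpoly.coeff (j + 1 + i) • M ^ i +
        M ^ N * (matPolyEquiv M.charmatrix.adjugate).coeff (j + N) := by
  have h1 : ∀ j, (matPolyEquiv M.charmatrix.adjugate).coeff j =
      M.charpoly.coeff (j + 1) • 1 + M * (matPolyEquiv M.charmatrix.adjugate).coeff (j + 1) := by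
    intro j
    have e : (X - C M) * matPolyEquiv M.charmatrix.adjugate =
        matPolyEquiv (M.charpoly • (1 : Matrix n n R[X])) := by
      rw [← Matrix.matPolyEquiv_charmatrix, ← map_mul, Matrix.mul_adjugate, Matrix.charpoly]
    have e2 := congrArg (fun P => coeff P (j + 1)) e
    simp only [matPolyEquiv_smul_one, sub_mul, coeff_sub, coeff_X_mul, coeff_C_mul, coeff_map] at e2
    rw [sub_eq_iff_eq_add] at e2
    rw [e2, Algebra.algebraMap_eq_smul_one]
  intro N
  induction N with
  | zero => simp
  | succ N ih =>
    rw [ih, h1 (j + N), Finset.sum_range_succ, mul_add, ← mul_assoc, ← pow_succ, mul_smul_comm,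
      mul_one, add_assoc (∑ i ∈ _, _), add_right_comm j N 1, add_right_comm j 1 N, add_assoc j N 1]

theorem newton_of_lt (j : ℕ) (hj : j < Fintype.card n) :
    ((j + 1 : ℕ) : R) * M.charpoly.coeff (j + 1) =
      ∑ i ∈ Finset.range (Fintype.card n - j), M.charpoly.coeff (j + 1 + i) * (M ^ i).trace := by
  nontriviality R
  set A := matPolyEquiv M.charmatrix.adjugate with hA
  have h1 : (A.coeff j).trace = ((j + 1 : ℕ) : R) * M.charpoly.coeff (j + 1) := by
    have h2 : (A.coeff j).trace = (M.charmatrix.adjugate.trace).coeff j := by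
      rw [Matrix.trace, Matrix.trace, finsetSum_coeff]
      exact Finset.sum_congr rfl fun i _ => by rw [Matrix.diag_apply, hA, matPolyEquiv_coeff_apply]; rfl
    rw [h2, ← derivative_charpoly, coeff_derivative]
    push_cast
    ring
  -- N is so large that the tail vanishes; the superfluous summands vanish because they involve
  -- coefficients of χ above its degree.
  set N := Fintype.card n - j + A.natDegree + 1 with hN
  have h3 := coeff_matPolyEquiv_adjugate M j N
  rw [← hA, coeff_eq_zero_of_natDegree_lt (p := A) (n := j + N) (by omega), mul_zero,
    add_zero] at h3
  rw [← h1, h3, Matrix.trace_sum]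
  simp only [Matrix.trace_smul, smul_eq_mul]
  refine (Finset.sum_subset (Finset.range_subset_range.2 (by omega)) fun i _ hi => ?_).symm
  rw [Finset.mem_range, not_lt] at hi
  rw [coeff_eq_zero_of_natDegree_lt (by rw [Matrix.charpoly_natDegree_eq_dim]; omega), zero_mul]

theorem newton_card :
    ∑ i ∈ Finset.range (Fintype.card n + 1), M.charpoly.coeff i * (M ^ i).trace = 0 := by
  nontriviality R
  have h := congrArg Matrix.trace (Matrix.aeval_self_charpoly M)
  rw [aeval_eq_sum_range, Matrix.charpoly_natDegree_eq_dim, Matrix.trace_sum,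
    Matrix.trace_zero] at h
  simpa only [Matrix.trace_smul, smul_eq_mul] using h

/-- Newton's identities. -/
theorem trace_pow_eq (k : ℕ) (hk : k ≤ Fintype.card n) : (M ^ k).trace =
    ((Fintype.card n - k : ℕ) : R) * M.charpoly.coeff (Fintype.card n - k) -
      ∑ i ∈ Finset.range k, M.charpoly.coeff (Fintype.card n - k + i) * (M ^ i).trace := by
  nontriviality R
  have hlead : M.charpoly.coeff (Fintype.card n) = 1 := by
    have := (Matrix.charpoly_monic M).coeff_natDegree
    rwa [Matrix.charpoly_natDegree_eq_dim] at this
  rcases hk.eq_or_lt with rfl | hk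
  · have h := newton_card M
    rw [Finset.sum_range_succ, hlead] at h
    simp only [Nat.sub_self, zero_add]
    push_cast
    linear_combination h
  · obtain ⟨j, hj⟩ : ∃ j, Fintype.card n = k + j + 1 := ⟨Fintype.card n - k - 1, by omega⟩
    have h := newton_of_lt M j (by omega)
    rw [show Fintype.card n - j = k + 1 by omega, Finset.sum_range_succ,
      show j + 1 + k = Fintype.card n by omega, hlead] at h
    rw [show Fintype.card n - k = j + 1 by omega]
    linear_combination -h

end

end PrymToda

namespace PrymToda

open Polynomial

/-! ## The Mumford vector fields are Hamiltonian -/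

section

variable {g : ℕ} {φ : ℂ[X]}

local notation "σ" => algebraMap ℂ (OM g)

theorem mumfordLax_u (s t : ℂ) : (σ s - σ t) * evalAt₂ (mumfordLax g 1 0) s t =
    2 * (uAt g s * vAt g t - vAt g s * uAt g t) := by
  have h : mumfordLax g 1 0 = divDiff (atX (uM g) * atX' (vM g) + atX (-vM g) * atX' (uM g) -
      (atX' (uM g) * atX (vM g) + atX' (-vM g) * atX (uM g))) := by
    simp [mumfordLax, laxM, Matrix.mul_apply, Fin.sum_univ_two]
  rw [h, evalAt₂_divDiff]
  · simp only [evalAt₂_add, evalAt₂_sub, evalAt₂_mul, evalAt₂_atX, evalAt₂_atX', evalAt_neg,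
      uAt, vAt]
    ring
  · intro s
    simp only [evalAt₂_add, evalAt₂_sub, evalAt₂_mul, evalAt₂_atX, evalAt₂_atX', evalAt_neg]
    ring

theorem mumfordLax_v (s t : ℂ) : (σ s - σ t) * evalAt₂ (mumfordLax g 0 0) s t =
    wAt g s * uAt g t - wAt g t * uAt g s -
      (σ s - σ t) * (σ s + σ t + 2 * halfAlpha g) * uAt g s * uAt g t := by
  have h : mumfordLax g 0 0 = divDiff (atX (vM g) * atX' (vM g) + atX (wM g) * atX' (uM g) -
      (atX' (vM g) * atX (vM g) + (atX' (wM g) + (varX - varX') * (alphaSum g * atX' (uM g))) *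
        atX (uM g))) := by
    simp [mumfordLax, laxM, Matrix.mul_apply, Fin.sum_univ_two]
  rw [h, evalAt₂_divDiff]
  · simp only [evalAt₂_add, evalAt₂_sub, evalAt₂_mul, evalAt₂_atX, evalAt₂_atX', evalAt₂_varX,
      evalAt₂_varX', evalAt₂_alphaSum, uAt, wAt]
    ring
  · intro s
    simp only [evalAt₂_add, evalAt₂_sub, evalAt₂_mul, evalAt₂_atX, evalAt₂_atX', evalAt₂_varX,
      evalAt₂_varX']
    ring

theorem mumfordLax_w (s t : ℂ) : (σ s - σ t) * evalAt₂ (mumfordLax g 0 1) s t =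
    2 * (vAt g s * wAt g t - wAt g s * vAt g t) +
      2 * (σ s - σ t) * (σ s + σ t + 2 * halfAlpha g) * vAt g s * uAt g t := by
  have h : mumfordLax g 0 1 = divDiff (atX (vM g) * (atX' (wM g) +
        (varX - varX') * (alphaSum g * atX' (uM g))) + atX (wM g) * atX' (-vM g) -
      (atX' (vM g) * atX (wM g) + (atX' (wM g) + (varX - varX') * (alphaSum g * atX' (uM g))) *
        atX (-vM g))) := by
    simp [mumfordLax, laxM, Matrix.mul_apply, Fin.sum_univ_two]
  rw [h, evalAt₂_divDiff]
  · simp only [evalAt₂_add, evalAt₂_sub, evalAt₂_mul, evalAt₂_atX, evalAt₂_atX', evalAt₂_varX,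
      evalAt₂_varX', evalAt₂_alphaSum, evalAt_neg, uAt, vAt, wAt]
    ring
  · intro s
    simp only [evalAt₂_add, evalAt₂_sub, evalAt₂_mul, evalAt₂_atX, evalAt₂_atX', evalAt₂_varX,
      evalAt₂_varX', evalAt_neg]
    ring

variable (hφ : φ.natDegree ≤ 1) (hg : 1 ≤ g)
include hφ

theorem hasGenFun_two_pM (P : (OM g)[X]) (G : (OM g)[X][X])
    (h : ∀ s t, (σ s - σ t) * (2 * qad hφ (evalAt P s) (pAt g t)) =
      phAt (OM g) φ t * ((σ s - σ t) * evalAt₂ G s t)) :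
    HasGenFun (quadBracket g φ) P (2 * pM g) (atX' (liftC φ) * G) := by
  refine (isBiderivation_quadBracket hφ).hasGenFun_of_eval _ _ _ fun s t hst => ?_
  refine sub_mul_cancel hst ?_
  have h2 : evalAt (2 : (OM g)[X]) t = 2 := evalAt_ofNat 2 t
  have e : quadBracket g φ (evalAt P s) (evalAt (2 * pM g) t) =
      2 * qad hφ (evalAt P s) (pAt g t) := by
    rw [evalAt_mul, h2, ← qad_apply hφ, two_mul, map_add, ← two_mul]
    rfl
  rw [e, h, evalAt₂_mul, evalAt₂_atX', evalAt_liftC, phAt]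
  ring

include hg in
/-- The Mumford fields are Hamiltonian: `2 {f, p(y)} = φ(y) X_y f`. -/
theorem quadBracket_two_pM (f : OM g) (j : ℕ) :
    quadBracket g φ f ((2 * pM g).coeff j) = (liftC φ * mumfordField g f).coeff j := by
  have hB := isBiderivation_quadBracket (g := g) hφ
  let D : OM g →ₗ[ℂ] OM g :=
    { toFun := fun f => quadBracket g φ f ((2 * pM g).coeff j) -
        (liftC φ * mumfordField g f).coeff j
      map_add' := fun f f' => by
        rw [hB.add_left, map_add, mul_add, coeff_add]
        ring
      map_smul' := fun c f => by
        rw [hB.smul_left, Derivation.map_smul, mul_smul_comm, coeff_smul, RingHom.id_apply,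
          smul_sub] }
  have hD : ∀ f, D f = quadBracket g φ f ((2 * pM g).coeff j) -
        (liftC φ * mumfordField g f).coeff j := fun f => rfl
  have h1 := hasGenFun_two_pM hφ (uM g) (mumfordLax g 1 0) fun s t => by
    rw [mumfordLax_u]; exact qad_u_p hφ hg s t
  have h2 := hasGenFun_two_pM hφ (vM g) (mumfordLax g 0 0) fun s t => by
    rw [mumfordLax_v]; exact qad_v_p hφ hg s t
  have h3 := hasGenFun_two_pM hφ (wM g) (mumfordLax g 0 1) fun s t => by
    rw [mumfordLax_w]; exact qad_w_p hφ hg s t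
  have e : ∀ (G : (OM g)[X][X]) (i : ℕ), ((atX' (liftC φ) * G).coeff i).coeff j =
      (liftC φ * G.coeff i).coeff j := fun G i => by rw [atX', coeff_C_mul]
  -- For fixed j both sides are derivations in f, so the coordinates suffice.
  refine sub_eq_zero.1 (derivation_along_ext_coords (AlgHom.id ℂ _) D (fun f f' => ?_) ?_ f)
  · simp only [hD, hB.leibniz, Derivation.leibniz, AlgHom.id_apply, smul_eq_C_mul, mul_add,
      coeff_add, mul_left_comm (liftC φ) (C _), coeff_C_mul]
    ring
  · rintro (i | i | i) <;> rw [hD, sub_eq_zero, mumfordField, MvPolynomial.mkDerivation_X, ← e]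
    · rw [← h1, coeff_uM]
    · rw [← h2, coeff_vM]
    · rw [← h3, coeff_wM]

end

/-! ## The coefficients of `p` are polynomials in the coefficients of `H` -/

/-- The square root can already be constructed over the subalgebra generated by the coefficients of
H; by uniqueness it is p. -/
theorem coeff_pM_mem (g j : ℕ) :
    (pM g).coeff j ∈ Algebra.adjoin ℂ (Set.range (momentumM g).coeff) := by
  set S := Algebra.adjoin ℂ (Set.range (momentumM g).coeff) with hS
  have hinj : Function.Injective S.val := Subtype.val_injective
  have hl : momentumM g ∈ lifts (S.val : S →+* OM g) := by
    rw [lifts_iff_coeff_lifts]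
    intro n
    exact ⟨⟨_, Algebra.subset_adjoin ⟨n, rfl⟩⟩, rfl⟩
  obtain ⟨F, hF, hFd, hFm⟩ := lifts_and_natDegree_eq_and_monic hl (momentumM_monic g).1
  obtain ⟨q, hq, hqn, hqF⟩ := exists_sqrt (g + 1) F hFm (hFd.trans (momentumM_monic g).2)
  have e : pM g = q.map (S.val : S →+* OM g) := by
    refine sqrt_unique (g + 1) (momentumM g) _ _ (pM_monic g) (natDegree_pM g) (degree_rM g)
      (hq.map _) ?_ ?_
    · rw [hq.natDegree_map, hqn]
    · rw [← hF, ← Polynomial.map_pow, ← Polynomial.map_sub]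
      exact lt_of_le_of_lt degree_map_le hqF
  rw [e, coeff_map]
  exact (q.coeff j).2

/-! ## The Hamiltonians of the Toda lattice -/

section

variable {g : ℕ} (hg : 1 ≤ g)

include hg in
theorem charpoly_todaLax_coeff (m : ZMod (g + 1)) (h : ℂ) (hh : h ≠ 0) (j : ℕ) :
    (todaLax g h).charpoly.coeff j = phiT g m ((pM g).coeff j) -
      if j = 0 then algebraMap ℂ (OT g) (h + h⁻¹) else 0 := by
  rw [charpoly_todaLax m hg h hh, ← map_pM m hg, coeff_sub, coeff_map, coeff_C]
  rfl

include hg in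
theorem momentumT_coeff (m : ZMod (g + 1)) (h : ℂ) (hh : h ≠ 0) (j : ℕ) :
    (momentumT g h).coeff j = phiT g m ((2 * pM g).coeff j) := by
  rw [momentumT, charpoly_todaLax m hg h hh, sub_add_cancel, ← map_pM m hg, two_mul, two_mul,
    coeff_add, coeff_add, coeff_map, map_add]
  rfl

include hg in
-- Newton's identities by strong induction. Only the constant coefficient of the characteristic
-- polynomial contains h, and it matters only for k = n, where it is multiplied by tr 1 = n. The
-- polynomial q is the same for all m and h.
theorem exists_trace_todaLax_pow (k : ℕ) : k ≤ g + 1 →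
    ∃ q ∈ Algebra.adjoin ℂ (Set.range (pM g).coeff), ∀ (m : ZMod (g + 1)) (h : ℂ), h ≠ 0 →
      (todaLax g h ^ k).trace = phiT g m q +
        if k = g + 1 then ((g + 1 : ℕ) : OT g) * algebraMap ℂ (OT g) (h + h⁻¹) else 0 := by
  induction k using Nat.strong_induction_on with
  | _ k ih =>
    intro hk
    choose! t ht1 ht2 using ih
    have hcard : Fintype.card (ZMod (g + 1)) = g + 1 := ZMod.card _
    refine ⟨((g + 1 - k : ℕ) : OM g) * (pM g).coeff (g + 1 - k) -
      ∑ i ∈ Finset.range k, (pM g).coeff (g + 1 - k + i) * (if i = 0 then ((g + 1 : ℕ) : OM g) else t i),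
      ?_, ?_⟩
    · have hp : ∀ j, (pM g).coeff j ∈ Algebra.adjoin ℂ (Set.range (pM g).coeff) :=
        fun j => Algebra.subset_adjoin ⟨j, rfl⟩
      refine sub_mem (mul_mem (natCast_mem _ _) (hp _)) (sum_mem fun i hi => mul_mem (hp _) ?_)
      split_ifs
      · exact natCast_mem _ _
      · exact ht1 i (Finset.mem_range.1 hi) (by have := Finset.mem_range.1 hi; omega)
    · intro m h hh
      have hT : ∀ i ∈ Finset.range k, (todaLax g h ^ i).trace =
          phiT g m (if i = 0 then ((g + 1 : ℕ) : OM g) else t i) := by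
        intro i hi
        have hi := Finset.mem_range.1 hi
        split_ifs with h0
        · rw [h0, pow_zero, Matrix.trace_one, hcard, map_natCast]
        · rw [ht2 i hi (by omega) m h hh, if_neg (by omega), add_zero]
      rw [trace_pow_eq _ k (by omega), hcard, map_sub, map_mul, map_natCast, map_sum]
      have hterm : ∀ i ∈ Finset.range k, (todaLax g h).charpoly.coeff (g + 1 - k + i) *
          (todaLax g h ^ i).trace = phiT g m ((pM g).coeff (g + 1 - k + i) *
            (if i = 0 then ((g + 1 : ℕ) : OM g) else t i)) -
          if i = 0 then (if k = g + 1 then ((g + 1 : ℕ) : OT g) * algebraMap ℂ (OT g) (h + h⁻¹)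
            else 0) else 0 := by
        intro i hi
        rw [hT i hi, charpoly_todaLax_coeff hg m h hh, map_mul, sub_mul]
        congr 1
        rcases Nat.eq_zero_or_pos i with rfl | h0
        · rw [if_pos rfl, if_pos rfl, map_natCast]
          by_cases hkg : k = g + 1
          · rw [if_pos (by omega), if_pos hkg, mul_comm]
          · rw [if_neg (by omega), if_neg hkg, zero_mul]
        · rw [if_neg (by omega), zero_mul, if_neg (by omega)]
      rw [Finset.sum_congr rfl hterm, Finset.sum_sub_distrib, charpoly_todaLax_coeff hg m h hh]
      by_cases hkg : k = g + 1
      · subst hkg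
        rw [Finset.sum_ite_eq' _ 0, if_pos (Finset.mem_range.2 (by omega))]
        simp only [Nat.sub_self, Nat.cast_zero, zero_mul, if_true]
        ring
      · simp only [if_neg hkg, ite_self, Finset.sum_const_zero]
        rw [if_neg (by omega)]
        ring

include hg in
theorem exists_todaHam (i : ℕ) (hi : i ≤ g) :
    ∃ q ∈ Algebra.adjoin ℂ (Set.range (pM g).coeff), ∀ (m : ZMod (g + 1)) (h : ℂ), h ≠ 0 →
      todaHam g h i = phiT g m q := by
  obtain ⟨q, hq, e⟩ := exists_trace_todaLax_pow hg (i + 1) (by omega)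
  refine ⟨(1 / (i + 1) : ℂ) • q, Subalgebra.smul_mem _ hq _, fun m h hh => ?_⟩
  have hne : ((i : ℂ) + 1) ≠ 0 := Nat.cast_add_one_ne_zero i
  rw [todaHam, e m h hh, map_smul, smul_add, add_sub_assoc, add_eq_left, sub_eq_zero]
  by_cases h1 : i = g
  · subst h1
    rw [if_pos rfl, if_pos rfl, ← nsmul_eq_mul, ← Nat.cast_smul_eq_nsmul ℂ, smul_smul]
    push_cast
    rw [one_div_mul_cancel hne, one_smul]
  · rw [if_neg (by omega), if_neg h1, smul_zero]

include hg in
-- For φ = 1 the coefficients satisfy 2{·, p_k} = Y_k, and the general case follows from the Leibniz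
-- rule; the factors it produces lie in the algebra generated by the coefficients of H.
theorem exists_field_combination (q : OM g)
    (hq : q ∈ Algebra.adjoin ℂ (Set.range (pM g).coeff)) : ∃ c : Fin (g + 1) → OM g,
      (∀ j, c j ∈ Algebra.adjoin ℂ (Set.range (momentumM g).coeff)) ∧
      ∀ f, quadBracket g 1 f q = ∑ j, c j * (mumfordField g f).coeff j := by
  have hφ : (1 : ℂ[X]).natDegree ≤ 1 := by simp
  have hB := isBiderivation_quadBracket (g := g) hφ
  have hpH : Algebra.adjoin ℂ (Set.range (pM g).coeff) ≤
      Algebra.adjoin ℂ (Set.range (momentumM g).coeff) :=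
    Algebra.adjoin_le (by rintro _ ⟨j, rfl⟩; exact coeff_pM_mem g j)
  induction hq using Algebra.adjoin_induction with
  | mem x hx =>
    obtain ⟨k, rfl⟩ := hx
    rcases Nat.lt_or_ge k (g + 1) with hk | hk
    · refine ⟨fun j => if j = ⟨k, hk⟩ then algebraMap ℂ (OM g) (1 / 2) else 0, fun j => ?_,
        fun f => ?_⟩
      · dsimp only
        split_ifs
        · exact Subalgebra.algebraMap_mem _ _
        · exact zero_mem _
      · simp only [ite_mul, zero_mul, Finset.sum_ite_eq', Finset.mem_univ, if_true]
        have h1 := quadBracket_two_pM hφ hg f k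
        rw [two_mul, coeff_add, hB.add_right, ← two_mul, liftC, Polynomial.map_one, one_mul] at h1
        rw [← h1, ← mul_assoc, ← map_ofNat (algebraMap ℂ (OM g)) 2, ← map_mul]
        norm_num
    · refine ⟨0, fun j => zero_mem _, fun f => ?_⟩
      have h1 : (pM g).coeff k = algebraMap ℂ (OM g) (if k = g + 1 then 1 else 0) := by
        split_ifs with h
        · have := (pM_monic g).coeff_natDegree
          rw [natDegree_pM] at this
          rw [h, this, map_one]
        · rw [map_zero, coeff_eq_zero_of_natDegree_lt (by rw [natDegree_pM]; omega)]
      rw [h1, hB.algebraMap_right]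
      simp
  | algebraMap z => exact ⟨0, fun j => zero_mem _, fun f => by rw [hB.algebraMap_right]; simp⟩
  | add x y _ _ hx hy =>
    obtain ⟨c, hc, hc'⟩ := hx
    obtain ⟨d, hd, hd'⟩ := hy
    refine ⟨fun j => c j + d j, fun j => add_mem (hc j) (hd j), fun f => ?_⟩
    rw [hB.add_right, hc', hd', ← Finset.sum_add_distrib]
    exact Finset.sum_congr rfl fun j _ => by ring
  | mul x y hx0 hy0 hx hy =>
    obtain ⟨c, hc, hc'⟩ := hx
    obtain ⟨d, hd, hd'⟩ := hy
    refine ⟨fun j => x * d j + y * c j, fun j => add_mem (mul_mem (hpH hx0) (hd j))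
      (mul_mem (hpH hy0) (hc j)), fun f => ?_⟩
    rw [hB.mul_right, hc', hd', Finset.mul_sum, Finset.mul_sum, ← Finset.sum_add_distrib]
    exact Finset.sum_congr rfl fun j _ => by ring

theorem toda_flow {φ : ℂ[X]} (hφ : φ.natDegree ≤ 1) (hg : 1 ≤ g) (m : ZMod (g + 1)) (h : ℂ)
    (hh : h ≠ 0) (f : OM g) (j : ℕ) :
    todaBracket g φ (phiT g m f) ((momentumT g h).coeff j) =
      phiT g m ((liftC φ * mumfordField g f).coeff j) := by
  rw [momentumT_coeff hg m h hh, ← quadBracket_two_pM hφ hg, isPoissonMap_phiT m hφ hg]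

include hg in
theorem toda_fields (i : ℕ) (hi : i ≤ g) : ∃ c : Fin (g + 1) → OM g,
    (∀ j, c j ∈ Algebra.adjoin ℂ (Set.range (momentumM g).coeff)) ∧
    ∀ (m : ZMod (g + 1)) (h : ℂ), h ≠ 0 → ∀ f : OM g,
      todaBracket g 1 (phiT g m f) (todaHam g h i) =
        phiT g m (∑ j, c j * (mumfordField g f).coeff j) := by
  obtain ⟨q, hq, e⟩ := exists_todaHam hg i hi
  obtain ⟨c, hc, hc'⟩ := exists_field_combination hg q hq
  refine ⟨c, hc, fun m h hh f => ?_⟩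
  rw [e m h hh, ← hc', isPoissonMap_phiT m (by simp) hg]

end

end PrymToda

namespace PrymToda

open Polynomial

/-! ## The involution of the Mumford system -/

section

variable {g : ℕ}

local notation "σ" => algebraMap ℂ (OM g)
local notation "θ" => involutionM g

theorem evalAt_comp_neg {A : Type*} [CommRing A] [Algebra ℂ A] (P : A[X]) (s : ℂ) :
    evalAt (P.comp (-X)) s = evalAt P (-s) := by
  rw [evalAt, evalAt, eval_comp, eval_neg, eval_X, map_neg]

theorem coeff_comp_neg {A : Type*} [CommRing A] (P : A[X]) (i : ℕ) :
    (P.comp (-X)).coeff i = (-1) ^ i * P.coeff i := by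
  have h : (-X : A[X]) = C (-1) * X := by simp
  rw [h, comp_C_mul_X_coeff, mul_comm]

theorem evalAt_of_coeff_sign {A A' : Type*} [CommRing A] [Algebra ℂ A] [CommRing A'] [Algebra ℂ A']
    (ψ ψ' : A →ₐ[ℂ] A') (P : A[X]) (e : A')
    (h : ∀ i, ψ (P.coeff i) = e * ((-1) ^ i * ψ' (P.coeff i))) (s : ℂ) :
    ψ (evalAt P s) = e * ψ' (evalAt P (-s)) := by
  have h1 : P.map ψ.toRingHom = C e * (P.map ψ'.toRingHom).comp (-X) := by
    refine Polynomial.ext fun i => ?_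
    rw [coeff_map, coeff_C_mul, coeff_comp_neg, coeff_map]
    exact h i
  rw [← evalAt_map, h1, evalAt_mul, evalAt_C, evalAt_comp_neg, evalAt_map]

theorem neg_one_pow_mul_self {A : Type*} [CommRing A] (k : ℕ) : ((-1 : A) ^ k) * (-1) ^ k = 1 := by
  rw [← mul_pow]; simp

theorem involutionM_coeff_u (i : ℕ) : θ ((uM g).coeff i) = (-1) ^ g * ((-1) ^ i * (uM g).coeff i) := by
  rcases Nat.lt_or_ge i g with h | h
  · rw [show i = ((⟨i, h⟩ : Fin g) : ℕ) from rfl, coeff_uM, involutionM, MvPolynomial.aeval_X]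
    dsimp only
    rw [pow_add, mul_assoc]
  · rw [coeff_uM_of_le g h, AlgHom.commutes]
    split_ifs with h1
    · rw [h1, map_one, mul_one, neg_one_pow_mul_self]
    · rw [map_zero, mul_zero, mul_zero]

theorem involutionM_coeff_v (i : ℕ) :
    θ ((vM g).coeff i) = -(-1) ^ g * ((-1) ^ i * (vM g).coeff i) := by
  rcases Nat.lt_or_ge i g with h | h
  · rw [show i = ((⟨i, h⟩ : Fin g) : ℕ) from rfl, coeff_vM, involutionM, MvPolynomial.aeval_X]
    dsimp only
    rw [pow_add, pow_add]
    ring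
  · rw [coeff_vM_of_le g h, AlgHom.commutes, map_zero, mul_zero, mul_zero]

theorem involutionM_coeff_w (i : ℕ) :
    θ ((wM g).coeff i) = (-1) ^ g * ((-1) ^ i * (wM g).coeff i) := by
  rcases Nat.lt_or_ge i (g + 2) with h | h
  · rw [show i = ((⟨i, h⟩ : Fin (g + 2)) : ℕ) from rfl, coeff_wM, involutionM,
      MvPolynomial.aeval_X]
    dsimp only
    rw [pow_add, mul_assoc]
  · rw [coeff_wM_of_le g h, AlgHom.commutes]
    split_ifs with h1
    · rw [h1, map_one, mul_one, pow_add, ← mul_assoc, neg_one_pow_mul_self]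
      ring
    · rw [map_zero, mul_zero, mul_zero]

theorem involutionM_uAt (s : ℂ) : θ (uAt g s) = (-1) ^ g * uAt g (-s) :=
  evalAt_of_coeff_sign _ (AlgHom.id ℂ _) _ _ involutionM_coeff_u s

theorem involutionM_vAt (s : ℂ) : θ (vAt g s) = -(-1) ^ g * vAt g (-s) :=
  evalAt_of_coeff_sign _ (AlgHom.id ℂ _) _ _ involutionM_coeff_v s

theorem involutionM_wAt (s : ℂ) : θ (wAt g s) = (-1) ^ g * wAt g (-s) :=
  evalAt_of_coeff_sign _ (AlgHom.id ℂ _) _ _ involutionM_coeff_w s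

theorem involutionM_hAt (s : ℂ) : θ (hAt g s) = hAt g (-s) := by
  rw [hAt_eq, hAt_eq, map_add, map_mul, map_pow, involutionM_uAt, involutionM_vAt, involutionM_wAt]
  linear_combination (uAt g (-s) * wAt g (-s) + vAt g (-s) ^ 2) *
    neg_one_pow_mul_self (A := OM g) g

/-- H(x) goes to H(-x), whose monic square root is ±p(-x); the sign (-1)^(g+1) is forced by the
degree g + 1. -/
theorem map_pM_involutionM : (pM g).map (involutionM g).toRingHom =
    C (-(-1) ^ g) * (pM g).comp (-X) := by
  have hm : (C (-(-1) ^ g) * (pM g).comp (-X)).Monic ∧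
      (C (-(-1) ^ g) * (pM g).comp (-X)).natDegree = g + 1 := by
    have h := (pM_monic g).neg_one_pow_natDegree_mul_comp_neg_X
    have e : C (-(-1) ^ g) * (pM g).comp (-X) =
        (-1) ^ (pM g).natDegree * (pM g).comp (-X) := by
      rw [natDegree_pM]
      simp only [map_neg, map_pow, map_one, pow_succ]
      ring
    rw [e]
    refine ⟨h, ?_⟩
    have e2 : ((-1 : (OM g)[X]) ^ (pM g).natDegree) = C ((-1) ^ (pM g).natDegree) := by simp
    have hu : IsUnit ((-1 : OM g) ^ (pM g).natDegree) := (isUnit_one.neg).pow _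
    rw [e2, natDegree_C_mul_of_isUnit hu, natDegree_comp, natDegree_neg, natDegree_X, mul_one,
      natDegree_pM]
  refine sqrt_unique (g + 1) ((momentumM g).map (involutionM g).toRingHom) _ _
    ((pM_monic g).map _) ?_ ?_ hm.1 hm.2 ?_
  · rw [(pM_monic g).natDegree_map, natDegree_pM]
  · rw [← Polynomial.map_pow, ← Polynomial.map_sub]
    exact lt_of_le_of_lt degree_map_le (degree_rM g)
  · have e : (momentumM g).map (involutionM g).toRingHom -
        (C (-(-1) ^ g) * (pM g).comp (-X)) ^ 2 = (rM g).comp (-X) := by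
      refine eq_of_evalAt ∅ fun s _ => ?_
      have h1 := involutionM_hAt (g := g) s
      rw [hAt, ← evalAt_map] at h1
      rw [evalAt_sub, h1, evalAt_pow, evalAt_mul, evalAt_C, evalAt_comp_neg, evalAt_comp_neg, rM,
        evalAt_sub, evalAt_pow, hAt]
      linear_combination -evalAt (pM g) (-s) ^ 2 * neg_one_pow_mul_self (A := OM g) g
    rw [e]
    have h := degree_rM g
    rw [degree_lt_iff_coeff_zero] at h ⊢
    intro N hN
    rw [coeff_comp_neg, h N hN, mul_zero]

theorem involutionM_pAt (s : ℂ) : θ (pAt g s) = -(-1) ^ g * pAt g (-s) := by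
  rw [pAt, ← evalAt_map, map_pM_involutionM, evalAt_mul, evalAt_C, evalAt_comp_neg, pAt]

theorem involutionM_halfAlpha (hg : 1 ≤ g) : θ (halfAlpha g) = -halfAlpha g := by
  obtain ⟨k, rfl⟩ : ∃ k, g = k + 1 := ⟨g - 1, by omega⟩
  have h := neg_one_pow_mul_self (A := OM (k + 1)) k
  rw [halfAlpha, map_smul, alphaConst, map_sub, involutionM_coeff_u, involutionM_coeff_w,
    ← smul_neg, Nat.add_sub_cancel]
  congr 1
  simp only [pow_succ]
  linear_combination ((uM (k + 1)).coeff k - (wM (k + 1)).coeff (k + 1 + 1)) * h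

theorem coeff_zero_of_odd {φ : ℂ[X]} (h : φ.comp (-X) = -φ) : φ.coeff 0 = 0 := by
  have h1 := congrArg (fun P => P.coeff 0) h
  simp only [coeff_comp_neg, coeff_neg, pow_zero, one_mul] at h1
  linear_combination (1 / 2 : ℂ) * h1

variable {φ : ℂ[X]} (hφ : φ.natDegree ≤ 1) (h0 : φ.coeff 0 = 0) (hg : 1 ≤ g)
include hφ h0 hg

/-- For odd φ both φ and α^φ change sign under x ↦ -x, d ↦ -d, which compensates the sign of the
denominator x - x' and the signs of u, v and p. -/
theorem isPoissonMap_involutionM :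
    IsPoissonMap (quadBracket g φ) (quadBracket g φ) (involutionM g) := by
  have hM := isBiderivation_quadBracket (g := g) hφ
  have hε := neg_one_pow_mul_self (A := OM g) g
  have hsgn : ∀ f f' : OM g, quadBracket g φ ((-1) ^ g * f) f' = (-1) ^ g * quadBracket g φ f f' := by
    intro f f'
    have := hM.algebraMap_left f' ((-1) ^ g)
    rw [map_pow, map_neg, map_one] at this
    rw [hM.leibniz, this]
    ring
  have hneg1 : ∀ f f' : OM g, quadBracket g φ (-f) f' = -quadBracket g φ f f' := by
    intro f f'
    have := hM.sub_left 0 f f'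
    rwa [zero_sub, hM.zero_left, zero_sub] at this
  have hsgn' : ∀ f f' : OM g, quadBracket g φ f ((-1) ^ g * f') = (-1) ^ g * quadBracket g φ f f' := by
    intro f f'
    rw [hM.skew, hsgn, hM.skew f f']
    ring
  have hsgnn : ∀ f f' : OM g,
      quadBracket g φ (-(-1) ^ g * f) f' = -(-1) ^ g * quadBracket g φ f f' := by
    intro f f'
    rw [neg_mul, hneg1, hsgn, neg_mul]
  have hsgnn' : ∀ f f' : OM g,
      quadBracket g φ f (-(-1) ^ g * f') = -(-1) ^ g * quadBracket g φ f f' := by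
    intro f f'
    rw [hM.skew, hsgnn, hM.skew f f']
    ring
  have hzero : σ (φ.coeff 0) = 0 := by rw [h0, map_zero]
  refine isPoissonMap_of_uvh hM hM _ (fun s t hst => ?_) (fun s t hst => ?_) (fun s t hst => ?_)
    (fun s t hst => ?_) (fun s t hst => ?_) fun s t hst => ?_
  · have e := qad_u_u hφ hg s t
    have e' := qad_u_u hφ hg (-s) (-t)
    rw [qad_apply] at e e'
    rw [e, involutionM_uAt, involutionM_uAt, hsgn, hsgn', e']
    simp
  · refine sub_mul_cancel hst ?_
    have e := congrArg θ (qad_u_v hφ hg s t)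
    have e' := qad_u_v hφ hg (-s) (-t)
    simp only [qad_apply, map_mul, map_sub, map_add, map_neg, AlgHom.commutes, alphaPhiAt,
      phAt_eq hφ, involutionM_uAt, involutionM_pAt, involutionM_halfAlpha hg, hzero, map_zero] at e e'
    refine e.trans ?_
    rw [involutionM_uAt, involutionM_vAt, hsgn, hsgnn']
    linear_combination -((-1) ^ g * (-1) ^ g) * e'
  · have e := qad_v_v hφ hg s t
    have e' := qad_v_v hφ hg (-s) (-t)
    rw [qad_apply] at e e'
    rw [e, involutionM_vAt, involutionM_vAt, hsgnn, hsgnn', e']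
    simp
  · refine sub_mul_cancel hst ?_
    have e := congrArg θ (qad_u_h hφ hg s t)
    have e' := qad_u_h hφ hg (-s) (-t)
    simp only [evalAt_fieldU, qad_apply, map_mul, map_sub, map_add, map_neg, map_ofNat,
      AlgHom.commutes, phAt_eq hφ, involutionM_uAt, involutionM_vAt, involutionM_pAt, hzero, map_zero] at e e'
    refine e.trans ?_
    rw [involutionM_uAt, involutionM_hAt, hsgn]
    linear_combination (-1) ^ g * e' + (-1) ^ g * pAt g (-t) * σ (φ.coeff 1) * σ t *
      (2 * (uAt g (-s) * vAt g (-t) - vAt g (-s) * uAt g (-t))) * hε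
  · refine sub_mul_cancel hst ?_
    have e := congrArg θ (qad_v_h hφ hg s t)
    have e' := qad_v_h hφ hg (-s) (-t)
    simp only [evalAt_fieldV, qad_apply, map_mul, map_sub, map_add, map_neg, map_ofNat,
      AlgHom.commutes, phAt_eq hφ, involutionM_uAt, involutionM_wAt, involutionM_pAt,
      involutionM_halfAlpha hg, hzero, map_zero] at e e'
    refine e.trans ?_
    rw [involutionM_vAt, involutionM_hAt, hsgnn]
    linear_combination -(-1) ^ g * e' - (-1) ^ g * pAt g (-t) * σ (φ.coeff 1) * σ t *
      (wAt g (-s) * uAt g (-t) - wAt g (-t) * uAt g (-s) -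
        (σ s - σ t) * (σ s + σ t - 2 * halfAlpha g) * uAt g (-s) * uAt g (-t)) * hε
  -- The values of H commute since those of p do and r is Casimir, so both sides are zero.
  · have e : ∀ s t, quadBracket g φ (hAt g s) (hAt g t) = 0 := by
      intro s t
      have e1 := qad_h hφ hg (hAt g s) t
      have e2 := qad_h hφ hg (pAt g t) s
      rw [qad_p_p hφ hg, mul_zero] at e2
      rw [qad_skew hφ (hAt g s) (pAt g t), e2, neg_zero, mul_zero] at e1
      exact e1
    rw [e, involutionM_hAt, involutionM_hAt, e, map_zero]

end

end PrymToda

namespace PrymToda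

open Polynomial

/-! ## Restriction of a bracket to the fixed points of an involution -/

section

variable {S T : Type*} {e : T → S} (he : Function.Injective e)
  (ρ : MvPolynomial S ℂ →ₐ[ℂ] MvPolynomial T ℂ) (θ : MvPolynomial S ℂ →ₐ[ℂ] MvPolynomial S ℂ)
  (hρ : ∀ t, ρ (MvPolynomial.X (e t)) = MvPolynomial.X t)
  (hρ' : ∀ s, (∀ t, e t ≠ s) → ρ (MvPolynomial.X s) = 0)
  (hθ : ∀ t, θ (MvPolynomial.X (e t)) = MvPolynomial.X (e t))
  (hθ' : ∀ s, (∀ t, e t ≠ s) → θ (MvPolynomial.X s) = -MvPolynomial.X s)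

include hρ' hθ hθ' in
theorem restrict_involution (F : MvPolynomial S ℂ) : ρ (θ F) = ρ F := by
  have h : ρ.comp θ = ρ := by
    refine MvPolynomial.algHom_ext fun s => ?_
    rw [AlgHom.comp_apply]
    by_cases hs : ∃ t, e t = s
    · obtain ⟨t, rfl⟩ := hs
      rw [hθ]
    · rw [not_exists] at hs
      rw [hθ' s hs, map_neg, hρ' s hs, neg_zero]
  exact DFunLike.congr_fun h F

include he hρ hρ' in
theorem restrict_pderiv (t : T) (F : MvPolynomial S ℂ) :
    ρ (MvPolynomial.pderiv (e t) F) = MvPolynomial.pderiv t (ρ F) := by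
  classical
  induction F using MvPolynomial.induction_on with
  | C a =>
    have h : ρ (MvPolynomial.C a) = MvPolynomial.C a := ρ.commutes a
    rw [h, MvPolynomial.pderiv_C, MvPolynomial.pderiv_C, map_zero]
  | add p q hp hq => rw [map_add, map_add, map_add, map_add, hp, hq]
  | mul_X p s hp =>
    rw [Derivation.leibniz, map_mul, Derivation.leibniz, smul_eq_mul, smul_eq_mul, smul_eq_mul,
      smul_eq_mul, map_add, map_mul, map_mul, hp]
    congr 2
    by_cases hs : ∃ t', e t' = s
    · obtain ⟨t', rfl⟩ := hs
      rw [hρ, MvPolynomial.pderiv_X, MvPolynomial.pderiv_X, Pi.single_apply, Pi.single_apply,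
        apply_ite ρ, map_one, map_zero]
      simp only [he.eq_iff]
    · rw [not_exists] at hs
      rw [hρ' s hs, MvPolynomial.pderiv_X_of_ne (fun h => hs t h.symm), map_zero, map_zero]

include hθ hθ' in
theorem involution_pderiv (s : S) (hs : ∀ t, e t ≠ s) (F : MvPolynomial S ℂ) :
    θ (MvPolynomial.pderiv s F) = -MvPolynomial.pderiv s (θ F) := by
  classical
  induction F using MvPolynomial.induction_on with
  | C a =>
    have h : θ (MvPolynomial.C a) = MvPolynomial.C a := θ.commutes a
    rw [h, MvPolynomial.pderiv_C, map_zero, neg_zero]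
  | add p q hp hq => rw [map_add, map_add, map_add, map_add, hp, hq, neg_add]
  | mul_X p s' hp =>
    have h : θ (MvPolynomial.pderiv s (MvPolynomial.X s')) =
        -MvPolynomial.pderiv s (θ (MvPolynomial.X s')) := by
      by_cases hs' : ∃ t', e t' = s'
      · obtain ⟨t', rfl⟩ := hs'
        rw [hθ, MvPolynomial.pderiv_X_of_ne (hs t'), map_zero, neg_zero]
      · rw [not_exists] at hs'
        rw [hθ' s' hs', map_neg, neg_neg, MvPolynomial.pderiv_X, Pi.single_apply, apply_ite θ,
          map_one, map_zero]
    rw [Derivation.leibniz, map_mul, Derivation.leibniz, smul_eq_mul, smul_eq_mul, smul_eq_mul,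
      smul_eq_mul, map_add, map_mul, map_mul, hp, h]
    ring

include hρ' hθ hθ' in
-- The derivative of an invariant function along an anti-invariant coordinate is anti-invariant,
-- hence zero on the fixed locus.
theorem restrict_pderiv_eq_zero (s : S) (hs : ∀ t, e t ≠ s) (F : MvPolynomial S ℂ)
    (hF : θ F = F) : ρ (MvPolynomial.pderiv s F) = 0 := by
  have h := congrArg ρ (involution_pderiv θ hθ hθ' s hs F)
  rw [restrict_involution ρ θ hρ' hθ hθ', hF, map_neg] at h
  exact two_isUnit.mul_right_eq_zero.1 (by linear_combination h)

include he hρ hρ' hθ hθ' in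
-- Only the derivatives along the fixed locus survive, and these commute with restriction.
-- Invariance of the bracket itself plays no role here.
theorem restrict_polyBracket [Fintype S] [Fintype T] (π : S → S → MvPolynomial S ℂ)
    (F G : MvPolynomial S ℂ) (hF : θ F = F) (hG : θ G = G) :
    ρ (polyBracket π F G) = polyBracket (fun t t' => ρ (π (e t) (e t'))) (ρ F) (ρ G) := by
  classical
  have key : ∀ f : S → MvPolynomial T ℂ, (∀ s, (∀ t, e t ≠ s) → f s = 0) →
      ∑ s, f s = ∑ t, f (e t) := by
    intro f hf
    refine Eq.trans ?_ (Finset.sum_map Finset.univ ⟨e, he⟩ f)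
    refine (Finset.sum_subset (Finset.subset_univ _) fun s _ hs => hf s fun t ht => hs ?_).symm
    exact Finset.mem_map.2 ⟨t, Finset.mem_univ _, ht⟩
  unfold polyBracket
  simp only [map_sum, map_mul]
  rw [key]
  · refine Finset.sum_congr rfl fun t _ => ?_
    rw [key]
    · exact Finset.sum_congr rfl fun t' _ => by
        rw [restrict_pderiv he ρ hρ hρ', restrict_pderiv he ρ hρ hρ']
    · intro s hs
      rw [restrict_pderiv_eq_zero ρ θ hρ' hθ hθ' s hs G hG, mul_zero]
  · intro s hs
    refine Finset.sum_eq_zero fun s' _ => ?_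
    rw [restrict_pderiv_eq_zero ρ θ hρ' hθ hθ' s hs F hF, mul_zero, zero_mul]

end

/-! ## The bracket on the Prym phase space -/

section

variable {g : ℕ}

local notation "ρ" => restrictP g
local notation "θ" => involutionM g

theorem restrictP_X (a : PVar g) : ρ (MvPolynomial.X a.1) = MvPolynomial.X a := by
  rw [restrictP, MvPolynomial.aeval_X, dif_pos a.2]

theorem not_isPrymVar {s : MVar g} (h : ∀ a : PVar g, a.1 ≠ s) : ¬ IsPrymVar g s :=
  fun hs => h ⟨s, hs⟩ rfl

theorem restrictP_X_of_ne (s : MVar g) (h : ∀ a : PVar g, a.1 ≠ s) :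
    ρ (MvPolynomial.X s) = 0 := by
  rw [restrictP, MvPolynomial.aeval_X, dif_neg (not_isPrymVar h)]

theorem involutionM_X (a : PVar g) : θ (MvPolynomial.X a.1) = MvPolynomial.X a.1 := by
  obtain ⟨s, hs⟩ := a
  rw [involutionM, MvPolynomial.aeval_X]
  rcases s with i | i | i <;> dsimp only [IsPrymVar] at hs ⊢
  · rw [Even.neg_one_pow (Nat.even_iff.2 (by omega)), one_mul]
  · rw [Even.neg_one_pow (Nat.even_iff.2 (by omega)), one_mul]
  · rw [Even.neg_one_pow (Nat.even_iff.2 (by omega)), one_mul]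

theorem involutionM_X_of_ne (s : MVar g) (h : ∀ a : PVar g, a.1 ≠ s) :
    θ (MvPolynomial.X s) = -MvPolynomial.X s := by
  have hs := not_isPrymVar h
  rw [involutionM, MvPolynomial.aeval_X]
  rcases s with i | i | i <;> dsimp only [IsPrymVar] at hs ⊢
  · rw [Odd.neg_one_pow (Nat.odd_iff.2 (by omega)), neg_one_mul]
  · rw [Odd.neg_one_pow (Nat.odd_iff.2 (by omega)), neg_one_mul]
  · rw [Odd.neg_one_pow (Nat.odd_iff.2 (by omega)), neg_one_mul]

theorem restrictP_involutionM (F : OM g) : ρ (θ F) = ρ F :=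
  restrict_involution ρ θ restrictP_X_of_ne involutionM_X involutionM_X_of_ne F

/-- The extension of functions from the Prym phase space that depends only on its coordinates. -/
noncomputable def extendP (g : ℕ) : OP g →ₐ[ℂ] OM g :=
  MvPolynomial.aeval fun a => MvPolynomial.X a.1

local notation "ι" => extendP g

theorem extendP_X (a : PVar g) : ι (MvPolynomial.X a) = MvPolynomial.X a.1 :=
  MvPolynomial.aeval_X _ _

theorem restrictP_extendP (f : OP g) : ρ (ι f) = f := by
  have h : (restrictP g).comp ι = AlgHom.id ℂ _ := by
    refine MvPolynomial.algHom_ext fun a => ?_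
    rw [AlgHom.comp_apply, extendP_X, restrictP_X, AlgHom.id_apply]
  exact DFunLike.congr_fun h f

theorem involutionM_extendP (f : OP g) : θ (ι f) = ι f := by
  have h : (involutionM g).comp ι = ι := by
    refine MvPolynomial.algHom_ext fun a => ?_
    rw [AlgHom.comp_apply, extendP_X, involutionM_X]
  exact DFunLike.congr_fun h f

theorem involutionM_involutionM (F : OM g) : θ (θ F) = F := by
  have h : (involutionM g).comp θ = AlgHom.id ℂ _ := by
    refine MvPolynomial.algHom_ext fun s => ?_
    rw [AlgHom.comp_apply, AlgHom.id_apply]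
    by_cases hs : ∃ a : PVar g, a.1 = s
    · obtain ⟨a, rfl⟩ := hs
      rw [involutionM_X, involutionM_X]
    · rw [not_exists] at hs
      rw [involutionM_X_of_ne s hs, map_neg, involutionM_X_of_ne s hs, neg_neg]
  exact DFunLike.congr_fun h F

noncomputable instance : Fintype (PVar g) := Fintype.ofFinite _

/-- The bracket on the Prym phase space induced by the quadratic bracket. -/
noncomputable def prymBracket (g : ℕ) (φ : ℂ[X]) : OP g → OP g → OP g :=
  polyBracket fun a b => restrictP g (quadPi g φ a.1 b.1)

variable {φ : ℂ[X]}

theorem inducesOnPrym_prymBracket : InducesOnPrym g (quadBracket g φ) (prymBracket g φ) :=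
  fun F G hF hG => restrict_polyBracket Subtype.val_injective ρ θ restrictP_X restrictP_X_of_ne
    involutionM_X involutionM_X_of_ne _ F G hF hG

theorem isBiderivation_prymBracket (hφ : φ.natDegree ≤ 1) : IsBiderivation (prymBracket g φ) :=
  isBiderivation_polyBracket _ fun a b => by rw [quadPi_skew hφ, map_neg]

theorem prymBracket_eq (f f' : OP g) : prymBracket g φ f f' = ρ (quadBracket g φ (ι f) (ι f')) := by
  rw [inducesOnPrym_prymBracket _ _ (involutionM_extendP f) (involutionM_extendP f'),
    restrictP_extendP, restrictP_extendP]

/-- Every function on P is the restriction of an invariant function, its extension by `extendP`, so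
an induced bracket has no freedom. -/
theorem eq_prymBracket (B : OP g → OP g → OP g) (hB : InducesOnPrym g (quadBracket g φ) B) :
    B = prymBracket g φ := by
  funext f f'
  rw [prymBracket_eq, hB _ _ (involutionM_extendP f) (involutionM_extendP f'),
    restrictP_extendP, restrictP_extendP]

variable (hφ : φ.natDegree ≤ 1) (h0 : φ.coeff 0 = 0) (hg : 1 ≤ g)
include hφ h0 hg

/-- It suffices that one of the two functions is invariant. -/
theorem restrictP_quadBracket (F G : OM g) (hF : θ F = F) :
    ρ (quadBracket g φ F G) = prymBracket g φ (ρ F) (ρ G) := by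
  have hB := isBiderivation_quadBracket (g := g) hφ
  -- G is symmetrized. As the involution is Poisson and fixes F, both summands G and θ G contribute
  -- the same restricted bracket.
  have h1 := inducesOnPrym_prymBracket (φ := φ) F (G + θ G) hF
    (by rw [map_add, involutionM_involutionM, add_comm])
  have h2 : ρ (quadBracket g φ F (θ G)) = ρ (quadBracket g φ F G) := by
    rw [← restrictP_involutionM (quadBracket g φ F G), isPoissonMap_involutionM hφ h0 hg, hF]
  rw [hB.add_right, map_add, h2, map_add, restrictP_involutionM,
    (isBiderivation_prymBracket hφ).add_right] at h1
  refine two_isUnit.mul_left_cancel ?_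
  linear_combination h1

/-- The inner bracket of two extended functions need not be an extended function, so the version
with a single function known to be invariant is used to restrict the Jacobi identity. -/
theorem isPoissonBracket_prymBracket : IsPoissonBracket (prymBracket g φ) where
  add_left := (isBiderivation_prymBracket hφ).add_left
  smul_left := (isBiderivation_prymBracket hφ).smul_left
  skew := (isBiderivation_prymBracket hφ).skew
  leibniz := (isBiderivation_prymBracket hφ).leibniz
  jacobi f f' f'' := by
    have h : ∀ f f' f'' : OP g, prymBracket g φ f (prymBracket g φ f' f'') =
        ρ (quadBracket g φ (ι f) (quadBracket g φ (ι f') (ι f''))) := by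
      intro f f' f''
      rw [restrictP_quadBracket hφ h0 hg _ _ (involutionM_extendP f), restrictP_extendP,
        prymBracket_eq f' f'']
    rw [h, h, h, ← map_add, ← map_add, (isPoissonBracket_quadBracket hφ hg).jacobi, map_zero]

end

end PrymToda

namespace PrymToda

open Polynomial

/-! ## The restriction of `Φ_m` to the KM phase space -/

section

variable {g : ℕ}

/-- The change of sign of the `b_i` on the ambient space of `T_n`. -/
noncomputable def negB (g : ℕ) : MvPolynomial (TVar g) ℂ →ₐ[ℂ] MvPolynomial (TVar g) ℂ :=
  MvPolynomial.aeval (Sum.elim (fun i => MvPolynomial.X (.inl i)) fun i => -MvPolynomial.X (.inr i))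

theorem negB_casimir : negB g (todaCasimir g) = todaCasimir g := by
  simp [negB, todaCasimir]

/-- The involution `b ↦ -b` of `T_n`. -/
noncomputable def involutionT (g : ℕ) : OT g →ₐ[ℂ] OT g :=
  Ideal.Quotient.liftₐ (Ideal.span {todaCasimir g - 1})
    ((Ideal.Quotient.mkₐ ℂ (Ideal.span {todaCasimir g - 1})).comp (negB g)) (by
    intro f hf
    obtain ⟨k, rfl⟩ := Ideal.mem_span_singleton'.1 hf
    rw [AlgHom.comp_apply, map_mul, map_sub, map_one, negB_casimir, map_mul]
    exact mul_eq_zero_of_right _ (Ideal.Quotient.eq_zero_iff_mem.2 (Ideal.subset_span rfl)))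

theorem involutionT_mk (f : MvPolynomial (TVar g) ℂ) :
    involutionT g (Ideal.Quotient.mk _ f) = Ideal.Quotient.mk _ (negB g f) := rfl

theorem involutionT_aPos (m : ZMod (g + 1)) (i : ℕ) : involutionT g (aPos m i) = aPos m i := by
  rw [aPos, aT, involutionT_mk, negB, MvPolynomial.aeval_X]
  rfl

theorem involutionT_bPos (m : ZMod (g + 1)) (i : ℕ) : involutionT g (bPos m i) = -bPos m i := by
  rw [bPos, bT, involutionT_mk, negB, MvPolynomial.aeval_X, Sum.elim_inr, map_neg]

/-- The restriction `a_i ↦ a_i`, `b_i ↦ 0` of the ambient spaces. -/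
noncomputable def restrictA (g : ℕ) : MvPolynomial (TVar g) ℂ →ₐ[ℂ] MvPolynomial (ZMod (g + 1)) ℂ :=
  MvPolynomial.aeval (Sum.elim MvPolynomial.X fun _ => 0)

theorem restrictK_mk (f : MvPolynomial (TVar g) ℂ) :
    restrictK g (Ideal.Quotient.mk _ f) = Ideal.Quotient.mk _ (restrictA g f) := by
  have h : (restrictK g).comp (Ideal.Quotient.mkₐ ℂ (Ideal.span {todaCasimir g - 1})) =
      (Ideal.Quotient.mkₐ ℂ (Ideal.span {kmCasimir g - 1})).comp (restrictA g) := by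
    refine MvPolynomial.algHom_ext fun s => ?_
    rw [AlgHom.comp_apply, AlgHom.comp_apply, restrictA, MvPolynomial.aeval_X]
    refine (MvPolynomial.aeval_X _ _).trans ?_
    rcases s with i | i
    · rfl
    · exact (map_zero _).symm
  exact DFunLike.congr_fun h f

theorem restrictK_involutionT (F : OT g) : restrictK g (involutionT g F) = restrictK g F := by
  obtain ⟨f, rfl⟩ := Ideal.Quotient.mk_surjective F
  rw [involutionT_mk, restrictK_mk, restrictK_mk]
  congr 1
  have h : (restrictA g).comp (negB g) = restrictA g := by
    refine MvPolynomial.algHom_ext fun s => ?_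
    rcases s with i | i <;> simp [negB, restrictA]
  exact DFunLike.congr_fun h f

theorem restrictA_todaPi (φ : ℂ[X]) (i j : ZMod (g + 1)) :
    restrictA g (todaPi g φ (.inl i) (.inl j)) = MvPolynomial.C (φ.coeff 1) * kmPi g i j := by
  have h : ∀ z : ℂ, restrictA g (MvPolynomial.C z) = MvPolynomial.C z := (restrictA g).commutes
  have h2 : ∀ i : ZMod (g + 1), restrictA g (MvPolynomial.X (.inl i)) = MvPolynomial.X i := fun i =>
    MvPolynomial.aeval_X _ _
  simp only [todaPi, kmPi, map_mul, map_sub, kron, apply_ite (restrictA g), map_one, map_zero, h,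
    h2]

/-- The restriction principle is applied on the ambient affine space of T_n, to the involution b ↦
-b. Only the brackets of the a_i enter, and these involve φ through φ₁ alone. -/
theorem restrictK_todaBracket {φ : ℂ[X]} (F G : OT g) (hF : involutionT g F = F)
    (hG : involutionT g G = G) :
    restrictK g (todaBracket g φ F G) = φ.coeff 1 • kmBracket g (restrictK g F) (restrictK g G) := by
  -- An invariant class modulo the ideal is represented by an invariant polynomial, the average of
  -- any representative.
  have lift : ∀ F : OT g, involutionT g F = F → ∃ f : MvPolynomial (TVar g) ℂ, negB g f = f ∧
      Ideal.Quotient.mk _ f = F := by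
    intro F hF
    obtain ⟨f, rfl⟩ := Ideal.Quotient.mk_surjective F
    have h : (negB g).comp (negB g) = AlgHom.id ℂ _ := by
      refine MvPolynomial.algHom_ext fun s => ?_
      rcases s with i | i <;> simp [negB]
    refine ⟨MvPolynomial.C (1 / 2) * (f + negB g f), ?_, ?_⟩
    · have h1 : negB g (MvPolynomial.C (1 / 2)) = MvPolynomial.C (1 / 2) := (negB g).commutes _
      have h2 : negB g (negB g f) = f := DFunLike.congr_fun h f
      rw [map_mul, map_add, h1, h2, add_comm f]
    · rw [map_mul, map_add, ← involutionT_mk, hF, ← two_mul, ← mul_assoc,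
        ← map_ofNat (Ideal.Quotient.mk (Ideal.span {todaCasimir g - 1})) 2, ← map_mul]
      have h3 : (MvPolynomial.C (1 / 2) * 2 : MvPolynomial (TVar g) ℂ) = 1 := by
        rw [← map_ofNat (MvPolynomial.C) 2, ← map_mul]
        norm_num
      rw [h3, map_one, one_mul]
  obtain ⟨f, hf, rfl⟩ := lift F hF
  obtain ⟨f', hf', rfl⟩ := lift G hG
  have hne : ∀ s : TVar g, (∀ i, Sum.inl i ≠ s) → ∃ i, s = Sum.inr i := by
    rintro (i | i) h
    · exact absurd rfl (h i)
    · exact ⟨i, rfl⟩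
  rw [todaBracket_mk, restrictK_mk, restrictK_mk, restrictK_mk, kmBracket_mk,
    restrict_polyBracket (e := Sum.inl) Sum.inl_injective (restrictA g) (negB g) _ _ _ _ _ _ _ hf hf']
  · simp only [restrictA_todaPi]
    rw [← Ideal.Quotient.mkₐ_eq_mk ℂ, ← map_smul]
    congr 1
    rw [MvPolynomial.smul_eq_C_mul]
    simp only [polyBracket, Finset.mul_sum, mul_assoc]
  · exact fun i => MvPolynomial.aeval_X _ _
  · intro s hs
    obtain ⟨i, rfl⟩ := hne s hs
    exact MvPolynomial.aeval_X _ _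
  · exact fun i => MvPolynomial.aeval_X _ _
  · intro s hs
    obtain ⟨i, rfl⟩ := hne s hs
    exact MvPolynomial.aeval_X _ _

theorem algHom_ext_uvw {A : Type*} [CommRing A] [Algebra ℂ A] (ψ ψ' : OM g →ₐ[ℂ] A)
    (hu : ∀ s, ψ (uAt g s) = ψ' (uAt g s)) (hv : ∀ s, ψ (vAt g s) = ψ' (vAt g s))
    (hw : ∀ s, ψ (wAt g s) = ψ' (wAt g s)) : ψ = ψ' := by
  have key : ∀ P : (OM g)[X], (∀ s, ψ (evalAt P s) = ψ' (evalAt P s)) →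
      ∀ i, ψ (P.coeff i) = ψ' (P.coeff i) := by
    intro P h i
    have h1 : P.map ψ.toRingHom = P.map ψ'.toRingHom :=
      eq_of_evalAt ∅ fun s _ => by rw [evalAt_map, evalAt_map, h]
    have h2 := congrArg (fun Q => coeff Q i) h1
    rw [coeff_map, coeff_map] at h2
    exact h2
  refine MvPolynomial.algHom_ext fun s => ?_
  rcases s with i | i | i
  · rw [← coeff_uM]; exact key _ hu i
  · rw [← coeff_vM]; exact key _ hv i
  · rw [← coeff_wM]; exact key _ hw i

variable (m : ZMod (g + 1))

/-- Changing the signs of b and of x changes the sign of every diagonal entry x - b and of no a, so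
each continuant acquires the parity of its length. -/
theorem involutionT_chain (j : ℕ) (s : ℂ) :
    involutionT g (chainU m j s) = -(-1) ^ j * chainU m j (-s) ∧
    involutionT g (chainV m j s) = (-1) ^ j * chainV m j (-s) ∧
    involutionT g (chainW m j s) = (-1) ^ j * chainW m j (-s) ∧
    involutionT g (chainZ m j s) = -(-1) ^ j * chainZ m j (-s) := by
  induction j with
  | zero =>
    refine ⟨?_, ?_, ?_, ?_⟩
    · have h : ∀ s, chainU m 0 s = algebraMap ℂ (OT g) s - bPos m 1 := fun s => by
        simp [chainU, chain, continuant, bPos]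
      rw [h, h, map_sub, AlgHom.commutes, involutionT_bPos, map_neg]
      ring
    · have h : ∀ s, chainV m 0 s = aPos m 1 := fun s => by simp [chainV, chain, continuant]
      rw [h, h, involutionT_aPos]
      ring
    · have h : ∀ s, chainW m 0 s = aPos m 0 := fun s => by simp [chainW, chain, continuant]
      rw [h, h, involutionT_aPos]
      ring
    · have h : ∀ s, chainZ m 0 s = 0 := fun s => rfl
      rw [h, h, map_zero, mul_zero]
  | succ j ih =>
    obtain ⟨h1, h2, h3, h4⟩ := ih
    rw [chainU_succ, chainV_succ, chainW_succ, chainZ_succ]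
    simp only [map_sub, map_mul, map_neg, AlgHom.commutes, involutionT_bPos, involutionT_aPos, h1, h2, h3, h4,
      pow_succ]
    refine ⟨?_, ?_, ?_, ?_⟩ <;> ring

variable (hg : 1 ≤ g)
include hg

theorem involutionT_phiT (F : OM g) :
    involutionT g (phiT g m F) = phiT g m (involutionM g F) := by
  have h : (involutionT g).comp (phiT g m) = (phiT g m).comp (involutionM g) := by
    have hp : ((-1 : OT g) ^ g) = -(-1) ^ (g - 1) := by
      obtain ⟨k, rfl⟩ : ∃ k, g = k + 1 := ⟨g - 1, by omega⟩
      rw [Nat.add_sub_cancel, pow_succ]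
      ring
    refine algHom_ext_uvw _ _ (fun s => ?_) (fun s => ?_) fun s => ?_
    · rw [AlgHom.comp_apply, AlgHom.comp_apply, involutionM_uAt, map_mul, map_pow, map_neg, map_one,
        phiT_uAt m hg, phiT_uAt m hg, (involutionT_chain m _ s).1, hp]
    · rw [AlgHom.comp_apply, AlgHom.comp_apply, involutionM_vAt, map_mul, map_neg, map_pow, map_neg,
        map_one, phiT_vAt m hg, phiT_vAt m hg, map_sub, (involutionT_chain m _ s).2.1,
        (involutionT_chain m _ s).2.2.1, hp]
      ring
    · rw [AlgHom.comp_apply, AlgHom.comp_apply, involutionM_wAt, map_mul, map_pow, map_neg, map_one,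
        phiT_wAt m hg, phiT_wAt m hg]
      simp only [map_add, map_sub, map_mul, map_pow, map_ofNat, map_neg, AlgHom.commutes,
        involutionT_bPos, (involutionT_chain m _ s).1, (involutionT_chain m _ s).2.1,
        (involutionT_chain m _ s).2.2.1, (involutionT_chain m _ s).2.2.2, hp]
      ring
  exact DFunLike.congr_fun h F

/-- By equivariance a coordinate that is zero on P pulls back to a function that is odd in b, hence
zero on K_n. In other words Φ_m maps K_n to P. -/
theorem phiK_restrictP (f : OM g) : phiK g m (restrictP g f) = restrictK g (phiT g m f) := by
  have h : (phiK g m).comp (restrictP g) = (restrictK g).comp (phiT g m) := by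
    refine MvPolynomial.algHom_ext fun s => ?_
    rw [AlgHom.comp_apply, AlgHom.comp_apply]
    by_cases hs : ∃ a : PVar g, a.1 = s
    · obtain ⟨a, rfl⟩ := hs
      rw [restrictP_X, phiK, MvPolynomial.aeval_X]
    · rw [not_exists] at hs
      have h1 := restrictK_involutionT (phiT g m (MvPolynomial.X s))
      rw [involutionT_phiT m hg, involutionM_X_of_ne s hs, map_neg, map_neg] at h1
      rw [restrictP_X_of_ne s hs, map_zero]
      exact (two_isUnit.mul_right_eq_zero.1 (by linear_combination -h1)).symm
  exact DFunLike.congr_fun h f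

theorem isPoissonMap_phiK {φ : ℂ[X]} (hφ : φ.natDegree ≤ 1) :
    IsPoissonMap (fun f f' => φ.coeff 1 • kmBracket g f f') (prymBracket g φ) (phiK g m) := by
  intro f f'
  have h : ∀ f : OP g, phiK g m f = restrictK g (phiT g m (extendP g f)) := fun f => by
    rw [← phiK_restrictP m hg, restrictP_extendP]
  have h1 : ∀ f : OP g, involutionT g (phiT g m (extendP g f)) = phiT g m (extendP g f) :=
    fun f => by rw [involutionT_phiT m hg, involutionM_extendP]
  rw [prymBracket_eq, phiK_restrictP m hg, isPoissonMap_phiT m hφ hg,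
    restrictK_todaBracket _ _ (h1 f) (h1 f'), ← h, ← h]

end

end PrymToda

namespace PrymToda

open Polynomial

/-! ## The Prym vector fields -/

section

variable {A A' : Type*} [CommRing A] [Algebra ℂ A] [CommRing A'] [Algebra ℂ A']

/-- The remainder modulo x² - x'² is a x + b with a, b depending on x'. Its vanishing at x = x' and
at x = -x' gives first 2b = 0 and then a = 0. -/
theorem evalAt₂_divDiffSq (F : A[X][X]) (h1 : ∀ s, evalAt₂ F s s = 0)
    (h2 : ∀ s, evalAt₂ F (-s) s = 0) (s t : ℂ) :
    (algebraMap ℂ A s ^ 2 - algebraMap ℂ A t ^ 2) * evalAt₂ (divDiffSq F) s t = evalAt₂ F s t := by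
  nontriviality A
  have hm : (X ^ 2 - C (X ^ 2) : A[X][X]).Monic := monic_X_pow_sub_C _ two_ne_zero
  set M : A[X][X] := X ^ 2 - C (X ^ 2) with hM
  have hMe : ∀ s t, evalAt₂ M s t = algebraMap ℂ A s ^ 2 - algebraMap ℂ A t ^ 2 := fun s t => by
    simp [hM, evalAt₂]
  have hdm : F %ₘ M + M * divDiffSq F = F := modByMonic_add_div F M
  have hd : (F %ₘ M).degree ≤ 1 := by
    have h := degree_modByMonic_lt F hm
    rw [hM, degree_X_pow_sub_C two_pos] at h
    exact Order.le_of_lt_succ h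
  obtain ⟨a, b, hR⟩ : ∃ a b, F %ₘ M = C a * X + C b := ⟨_, _, eq_X_add_C_of_degree_le_one hd⟩
  have hRe : ∀ s t, evalAt₂ (F %ₘ M) s t = evalAt a t * algebraMap ℂ A s + evalAt b t :=
    fun s t => by rw [hR]; simp [evalAt₂]
  have hs : ∀ s t, s ^ 2 = t ^ 2 → evalAt₂ F s t = 0 →
      evalAt a t * algebraMap ℂ A s + evalAt b t = 0 := by
    intro s t hst h
    rw [← hdm, evalAt₂_add, evalAt₂_mul, hMe, hRe, ← map_pow, ← map_pow, hst, sub_self, zero_mul,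
      add_zero] at h
    exact h
  have h3 : ∀ s, evalAt a s * algebraMap ℂ A s + evalAt b s = 0 := fun s => hs s s rfl (h1 s)
  have h4 : ∀ s, evalAt a s * algebraMap ℂ A (-s) + evalAt b s = 0 :=
    fun s => hs (-s) s (by ring) (h2 s)
  have hb : b = 0 := eq_zero_of_evalAt ∅ b fun s _ => by
    have h := h4 s
    rw [map_neg] at h
    exact two_isUnit.mul_right_eq_zero.1 (by linear_combination h3 s + h)
  have ha : a = 0 := eq_zero_of_evalAt {0} a fun s hs => by
    have h := h3 s
    rw [hb, evalAt_zero, add_zero] at h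
    have hu : IsUnit (algebraMap ℂ A s) := (IsUnit.mk0 s (by simpa using hs)).map _
    exact hu.mul_left_eq_zero.1 h
  have h := congrArg (fun G => evalAt₂ G s t) hdm
  simp only [evalAt₂_add, evalAt₂_mul, hMe, hRe, ha, hb, evalAt_zero] at h
  linear_combination h

theorem evalAt₂_map (ψ : A →ₐ[ℂ] A') (F : A[X][X]) (s t : ℂ) :
    evalAt₂ (F.map (mapRingHom ψ.toRingHom)) s t = ψ (evalAt₂ F s t) := by
  have h : (C (algebraMap ℂ A' s) : A'[X]) =
      mapRingHom ψ.toRingHom (C (algebraMap ℂ A s)) := by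
    rw [coe_mapRingHom, map_C]
    exact congrArg C (ψ.commutes s).symm
  rw [evalAt₂, h, eval_map_apply, coe_mapRingHom, evalAt_map, evalAt₂]

theorem evalAt₂_comp_neg (F : A[X][X]) (s t : ℂ) :
    evalAt₂ (F.comp (-X)) s t = evalAt₂ F (-s) t := by
  rw [evalAt₂, evalAt₂, eval_comp, eval_neg, eval_X, map_neg, map_neg]

end

section

variable {g : ℕ}

local notation "σ" => algebraMap ℂ (OP g)
local notation "ρ" => restrictP g

theorem restrictP_uAt (s : ℂ) : ρ (uAt g s) = evalAt (uP g) s := (evalAt_map _ _ _).symm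

theorem restrictP_vAt (s : ℂ) : ρ (vAt g s) = evalAt (vP g) s := (evalAt_map _ _ _).symm

theorem restrictP_wAt (s : ℂ) : ρ (wAt g s) = evalAt (wP g) s := (evalAt_map _ _ _).symm

theorem evalAt_uP_neg (s : ℂ) : evalAt (uP g) (-s) = (-1) ^ g * evalAt (uP g) s := by
  have h := restrictP_involutionM (uAt g s)
  rw [involutionM_uAt, map_mul, map_pow, map_neg, map_one, restrictP_uAt, restrictP_uAt] at h
  linear_combination (-1) ^ g * h - evalAt (uP g) (-s) * neg_one_pow_mul_self (A := OP g) g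

theorem evalAt_vP_neg (s : ℂ) : evalAt (vP g) (-s) = -(-1) ^ g * evalAt (vP g) s := by
  have h := restrictP_involutionM (vAt g s)
  rw [involutionM_vAt, map_mul, map_neg, map_pow, map_neg, map_one, restrictP_vAt, restrictP_vAt] at h
  linear_combination -(-1) ^ g * h - evalAt (vP g) (-s) * neg_one_pow_mul_self (A := OP g) g

theorem evalAt_wP_neg (s : ℂ) : evalAt (wP g) (-s) = (-1) ^ g * evalAt (wP g) s := by
  have h := restrictP_involutionM (wAt g s)
  rw [involutionM_wAt, map_mul, map_pow, map_neg, map_one, restrictP_wAt, restrictP_wAt] at h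
  linear_combination (-1) ^ g * h - evalAt (wP g) (-s) * neg_one_pow_mul_self (A := OP g) g

theorem restrictP_halfAlpha (hg : 1 ≤ g) : ρ (halfAlpha g) = 0 := by
  have h := restrictP_involutionM (halfAlpha g)
  rw [involutionM_halfAlpha hg, map_neg] at h
  exact two_isUnit.mul_right_eq_zero.1 (by linear_combination -h)

theorem prymLax_u (s t : ℂ) : (σ s ^ 2 - σ t ^ 2) * evalAt₂ (prymLax g 1 0) s t =
    2 * (σ t * evalAt (uP g) s * evalAt (vP g) t - σ s * evalAt (vP g) s * evalAt (uP g) t) := by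
  have h : prymLax g 1 0 = divDiffSq (atX (uP g) * (varX' * atX' (vP g)) +
      atX (-vP g) * (varX * atX' (uP g)) -
      (varX * atX' (uP g) * atX (vP g) + -(varX' * atX' (vP g)) * atX (uP g))) := by
    simp [prymLax, laxM, Matrix.mul_apply, Matrix.vecMul, dotProduct, Fin.sum_univ_two]
  rw [h, evalAt₂_divDiffSq]
  · simp only [evalAt₂_add, evalAt₂_sub, evalAt₂_mul, evalAt₂_neg, evalAt₂_atX, evalAt₂_atX',
      evalAt₂_varX, evalAt₂_varX', evalAt_neg]
    ring
  · intro s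
    simp only [evalAt₂_add, evalAt₂_sub, evalAt₂_mul, evalAt₂_neg, evalAt₂_atX, evalAt₂_atX',
      evalAt₂_varX, evalAt₂_varX', evalAt_neg]
    ring
  · intro s
    simp only [evalAt₂_add, evalAt₂_sub, evalAt₂_mul, evalAt₂_neg, evalAt₂_atX, evalAt₂_atX',
      evalAt₂_varX, evalAt₂_varX', evalAt_neg, evalAt_uP_neg, evalAt_vP_neg, map_neg]
    ring

theorem prymLax_v (s t : ℂ) : (σ s ^ 2 - σ t ^ 2) * evalAt₂ (prymLax g 0 0) s t =
    σ s * (evalAt (wP g) s * evalAt (uP g) t - evalAt (wP g) t * evalAt (uP g) s) -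
      σ s * (σ s ^ 2 - σ t ^ 2) * evalAt (uP g) s * evalAt (uP g) t := by
  have h : prymLax g 0 0 = divDiffSq (atX (vP g) * (varX' * atX' (vP g)) +
      atX (wP g) * (varX * atX' (uP g)) -
      (varX' * atX' (vP g) * atX (vP g) +
        (varX * atX' (wP g) + varX * (varX ^ 2 - varX' ^ 2) * atX' (uP g)) * atX (uP g))) := by
    simp [prymLax, laxM, Matrix.mul_apply, Matrix.vecMul, dotProduct, Fin.sum_univ_two]
  rw [h, evalAt₂_divDiffSq]
  · simp only [evalAt₂_add, evalAt₂_sub, evalAt₂_mul, evalAt₂_pow, evalAt₂_atX, evalAt₂_atX',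
      evalAt₂_varX, evalAt₂_varX']
    ring
  · intro s
    simp only [evalAt₂_add, evalAt₂_sub, evalAt₂_mul, evalAt₂_pow, evalAt₂_atX, evalAt₂_atX',
      evalAt₂_varX, evalAt₂_varX']
    ring
  · intro s
    simp only [evalAt₂_add, evalAt₂_sub, evalAt₂_mul, evalAt₂_pow, evalAt₂_atX, evalAt₂_atX',
      evalAt₂_varX, evalAt₂_varX', evalAt_uP_neg, evalAt_vP_neg, evalAt_wP_neg, map_neg]
    ring

theorem prymLax_w (s t : ℂ) : (σ s ^ 2 - σ t ^ 2) * evalAt₂ (prymLax g 0 1) s t =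
    2 * (σ s * evalAt (vP g) s * evalAt (wP g) t - σ t * evalAt (wP g) s * evalAt (vP g) t) +
      2 * σ s * (σ s ^ 2 - σ t ^ 2) * evalAt (vP g) s * evalAt (uP g) t := by
  have h : prymLax g 0 1 = divDiffSq (atX (vP g) *
        (varX * atX' (wP g) + varX * (varX ^ 2 - varX' ^ 2) * atX' (uP g)) +
      atX (wP g) * -(varX' * atX' (vP g)) -
      (varX' * atX' (vP g) * atX (wP g) +
        (varX * atX' (wP g) + varX * (varX ^ 2 - varX' ^ 2) * atX' (uP g)) * atX (-vP g))) := by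
    simp [prymLax, laxM, Matrix.mul_apply, Matrix.vecMul, dotProduct, Fin.sum_univ_two]
  rw [h, evalAt₂_divDiffSq]
  · simp only [evalAt₂_add, evalAt₂_sub, evalAt₂_mul, evalAt₂_neg, evalAt₂_pow, evalAt₂_atX,
      evalAt₂_atX', evalAt₂_varX, evalAt₂_varX', evalAt_neg]
    ring
  · intro s
    simp only [evalAt₂_add, evalAt₂_sub, evalAt₂_mul, evalAt₂_neg, evalAt₂_pow, evalAt₂_atX,
      evalAt₂_atX', evalAt₂_varX, evalAt₂_varX', evalAt_neg]
    ring
  · intro s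
    simp only [evalAt₂_add, evalAt₂_sub, evalAt₂_mul, evalAt₂_neg, evalAt₂_pow, evalAt₂_atX,
      evalAt₂_atX', evalAt₂_varX, evalAt₂_varX', evalAt_neg, evalAt_vP_neg, evalAt_wP_neg, map_neg]
    ring

/-- `G` is the part of parity `(-1) ^ k` in the first variable of the restriction of `F`. -/
theorem coeff_parity_part (F : (OM g)[X][X]) (G : (OP g)[X][X]) (k : ℕ)
    (h : ∀ s t, (σ s ^ 2 - σ t ^ 2) * (2 * evalAt₂ G s t) =
      (σ s ^ 2 - σ t ^ 2) * (ρ (evalAt₂ F s t) + (-1) ^ k * ρ (evalAt₂ F (-s) t)))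
    (i : ℕ) (hi : i % 2 = k % 2) : G.coeff i = (F.coeff i).map (restrictP g).toRingHom := by
  set F' := F.map (mapRingHom (restrictP g).toRingHom) with hF'
  have e : (2 : (OP g)[X][X]) * G = F' + (-1) ^ k * F'.comp (-X) := by
    refine eq_of_evalAt₂ (fun s => {s, -s}) fun s t hst => ?_
    have hst : s ^ 2 ≠ t ^ 2 := fun h => by
      rcases sq_eq_sq_iff_eq_or_eq_neg.1 h with h | h <;> simp [h] at hst
    refine sub_mul_cancel hst ?_
    have h2 : evalAt₂ (2 : (OP g)[X][X]) s t = 2 := evalAt₂_ofNat 2 s t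
    rw [map_pow, map_pow, evalAt₂_mul, h2, h, evalAt₂_add, evalAt₂_mul, evalAt₂_pow, evalAt₂_neg,
      evalAt₂_one, evalAt₂_comp_neg, evalAt₂_map, evalAt₂_map]
  have e2 := congrArg (fun Q => coeff Q i) e
  have hC : ((-1 : (OP g)[X][X]) ^ k) = C ((-1) ^ k) := by simp
  have hp : ∀ {R : Type} [CommRing R], ((-1 : R) ^ k) * (-1) ^ i = 1 := by
    intro R _
    have he : Even (k + i) := Nat.even_iff.2 (by omega)
    rw [← pow_add, he.neg_one_pow]
  simp only [two_mul, coeff_add, hC, coeff_C_mul, coeff_comp_neg] at e2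
  rw [← mul_assoc, hp, one_mul, ← two_mul, ← two_mul, hF', coeff_map] at e2
  exact two_isUnit.mul_left_cancel e2

/-- In 1/(x - y) = (x + y)/(x² - y²) the two summands separate the terms by their parity in x. The
part of the Mumford field with the parity of u is the Prym field. -/
theorem coeff_prymLax_u (i : ℕ) (hi : i % 2 = g % 2) :
    (prymLax g 1 0).coeff i = ((mumfordLax g 1 0).coeff i).map (restrictP g).toRingHom := by
  refine coeff_parity_part _ _ g (fun s t => ?_) i hi
  have h1 := congrArg ρ (mumfordLax_u (g := g) s t)
  have h2 := congrArg ρ (mumfordLax_u (g := g) (-s) t)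
  simp only [map_mul, map_sub, map_ofNat, AlgHom.commutes, restrictP_uAt, restrictP_vAt,
    evalAt_uP_neg, evalAt_vP_neg, map_neg] at h1 h2
  have hε := neg_one_pow_mul_self (A := OP g) g
  linear_combination 2 * prymLax_u (g := g) s t - (σ s + σ t) * h1 +
    (-1) ^ g * (σ s - σ t) * h2 +
    2 * (σ s - σ t) * (evalAt (uP g) s * evalAt (vP g) t + evalAt (vP g) s * evalAt (uP g) t) * hε

variable (hg : 1 ≤ g)
include hg

theorem coeff_prymLax_v (i : ℕ) (hi : i % 2 ≠ g % 2) :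
    (prymLax g 0 0).coeff i = ((mumfordLax g 0 0).coeff i).map (restrictP g).toRingHom := by
  refine coeff_parity_part _ _ (g + 1) (fun s t => ?_) i (by omega)
  have h1 := congrArg ρ (mumfordLax_v (g := g) s t)
  have h2 := congrArg ρ (mumfordLax_v (g := g) (-s) t)
  simp only [map_mul, map_sub, map_add, map_ofNat, AlgHom.commutes, restrictP_halfAlpha hg, restrictP_uAt,
    restrictP_wAt, evalAt_uP_neg, evalAt_wP_neg, map_neg] at h1 h2
  have hε := neg_one_pow_mul_self (A := OP g) g
  rw [pow_succ]
  linear_combination 2 * prymLax_v (g := g) s t - (σ s + σ t) * h1 -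
    (-1) ^ g * (σ s - σ t) * h2 - (σ s - σ t) * (evalAt (wP g) s * evalAt (uP g) t -
      evalAt (wP g) t * evalAt (uP g) s -
      (σ s ^ 2 - σ t ^ 2) * evalAt (uP g) s * evalAt (uP g) t) * hε

theorem coeff_prymLax_w (i : ℕ) (hi : i % 2 = g % 2) :
    (prymLax g 0 1).coeff i = ((mumfordLax g 0 1).coeff i).map (restrictP g).toRingHom := by
  refine coeff_parity_part _ _ g (fun s t => ?_) i hi
  have h1 := congrArg ρ (mumfordLax_w (g := g) s t)
  have h2 := congrArg ρ (mumfordLax_w (g := g) (-s) t)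
  simp only [map_mul, map_sub, map_add, map_ofNat, AlgHom.commutes, restrictP_halfAlpha hg, restrictP_uAt,
    restrictP_vAt, restrictP_wAt, evalAt_vP_neg, evalAt_wP_neg, map_neg] at h1 h2
  have hε := neg_one_pow_mul_self (A := OP g) g
  linear_combination 2 * prymLax_w (g := g) s t - (σ s + σ t) * h1 +
    (-1) ^ g * (σ s - σ t) * h2 - 2 * (σ s - σ t) * (evalAt (vP g) s * evalAt (wP g) t +
      evalAt (wP g) s * evalAt (vP g) t +
      (σ s ^ 2 - σ t ^ 2) * evalAt (vP g) s * evalAt (uP g) t) * hε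

/-- The Prym fields are the restrictions of the Mumford fields. -/
theorem prymField_eq (f : OP g) :
    prymField g f = (mumfordField g (extendP g f)).map (restrictP g).toRingHom := by
  induction f using MvPolynomial.induction_on with
  | C a =>
    rw [← MvPolynomial.algebraMap_eq, Derivation.map_algebraMap, AlgHom.commutes,
      Derivation.map_algebraMap, Polynomial.map_zero]
  | add p q hp hq => rw [map_add, map_add, map_add, hp, hq, Polynomial.map_add]
  | mul_X p a hp =>
    have hX : prymField g (MvPolynomial.X a) =
        (mumfordField g (extendP g (MvPolynomial.X a))).map (restrictP g).toRingHom := by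
      rw [extendP_X, prymField, mumfordField, MvPolynomial.mkDerivation_X,
        MvPolynomial.mkDerivation_X]
      obtain ⟨s, hs⟩ := a
      rcases s with i | i | i
      · exact coeff_prymLax_u i hs
      · exact coeff_prymLax_v hg i hs
      · exact coeff_prymLax_w hg i hs
    have hr : ∀ f, (restrictP g).toRingHom (extendP g f) = f := restrictP_extendP
    rw [Derivation.leibniz, hp, hX, map_mul, Derivation.leibniz, smul_eq_C_mul, smul_eq_C_mul,
      smul_eq_C_mul, smul_eq_C_mul, Polynomial.map_add, Polynomial.map_mul, Polynomial.map_mul,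
      map_C, map_C, hr, hr]

/-- Not every coefficient of p is invariant under the involution; it is enough that the extension of
f is. -/
theorem prymBracket_X_two_pM (f : OP g) (j : ℕ) :
    prymBracket g X f (ρ ((2 * pM g).coeff j)) = (X * prymField g f).coeff j := by
  have h0 : (X : ℂ[X]).coeff 0 = 0 := coeff_X_zero
  have h := restrictP_quadBracket natDegree_X_le h0 hg (extendP g f) ((2 * pM g).coeff j)
    (involutionM_extendP f)
  rw [restrictP_extendP, quadBracket_two_pM natDegree_X_le hg] at h
  have hX : (liftC X : (OM g)[X]) = X := map_X _
  have hX' : (X : (OP g)[X]) = (X : (OM g)[X]).map (restrictP g).toRingHom := (map_X _).symm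
  rw [← h, prymField_eq hg, hX, hX', ← Polynomial.map_mul, coeff_map]
  rfl

theorem isPoissonMap_phiK_X (m : ZMod (g + 1)) (f f' : OP g) :
    phiK g m (prymBracket g X f f') = kmBracket g (phiK g m f) (phiK g m f') := by
  have h := isPoissonMap_phiK m hg (φ := X) natDegree_X_le f f'
  simpa only [coeff_X_one, one_smul] using h

theorem prym_flow (m : ZMod (g + 1)) (h : ℂ) (hh : h ≠ 0) (f : OP g) (j : ℕ) :
    kmBracket g (phiK g m f) (restrictK g ((momentumT g h).coeff j)) =
      phiK g m ((X * prymField g f).coeff j) := by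
  rw [momentumT_coeff hg m h hh, ← phiK_restrictP m hg, ← isPoissonMap_phiK_X hg,
    prymBracket_X_two_pM hg]

omit hg in
theorem map_momentumM_restrictP : (momentumM g).map (restrictP g).toRingHom = momentumP g := by
  rw [momentumM, momentumP, Polynomial.map_add, Polynomial.map_mul, Polynomial.map_pow, uP, vP, wP]

omit hg in
theorem restrictP_mem {q : OM g} (hq : q ∈ Algebra.adjoin ℂ (Set.range (pM g).coeff)) :
    ρ q ∈ Algebra.adjoin ℂ (Set.range (momentumP g).coeff) := by
  have h : Algebra.adjoin ℂ (Set.range (pM g).coeff) ≤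
      (Algebra.adjoin ℂ (Set.range (momentumP g).coeff)).comap (restrictP g) := by
    refine Algebra.adjoin_le ?_
    rintro _ ⟨j, rfl⟩
    have h1 : Algebra.adjoin ℂ (Set.range (momentumM g).coeff) ≤
        (Algebra.adjoin ℂ (Set.range (momentumP g).coeff)).comap (restrictP g) := by
      refine Algebra.adjoin_le ?_
      rintro _ ⟨k, rfl⟩
      refine Algebra.subset_adjoin ⟨k, ?_⟩
      rw [← map_momentumM_restrictP, coeff_map]
      rfl
    exact h1 (coeff_pM_mem g j)
  exact h hq

/-- The factor y in 2{f, p(y)} = y X_y f shifts the index: p_0 restricts to a Casimir and 2{·,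
p_{k+1}} = Y_k. The Leibniz rule does the rest. -/
theorem exists_prymField_combination (q : OM g)
    (hq : q ∈ Algebra.adjoin ℂ (Set.range (pM g).coeff)) : ∃ c : Fin (g + 1) → OP g,
      (∀ j, c j ∈ Algebra.adjoin ℂ (Set.range (momentumP g).coeff)) ∧
      ∀ f, prymBracket g X f (ρ q) = ∑ j, c j * (prymField g f).coeff j := by
  have hB := isBiderivation_prymBracket (g := g) (φ := X) natDegree_X_le
  induction hq using Algebra.adjoin_induction with
  | mem x hx =>
    obtain ⟨k, rfl⟩ := hx
    have h1 : ∀ f, 2 * prymBracket g X f (ρ ((pM g).coeff k)) = (X * prymField g f).coeff k := by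
      intro f
      rw [← prymBracket_X_two_pM hg, two_mul (pM g), coeff_add, map_add, hB.add_right, two_mul]
    rcases Nat.eq_zero_or_pos k with rfl | hk0
    · refine ⟨0, fun j => zero_mem _, fun f => ?_⟩
      have h2 := h1 f
      rw [coeff_X_mul_zero] at h2
      rw [two_isUnit.mul_right_eq_zero.1 h2]
      simp
    obtain ⟨k, rfl⟩ : ∃ l, k = l + 1 := ⟨k - 1, by omega⟩
    rcases Nat.lt_or_ge k (g + 1) with hk | hk
    · refine ⟨fun j => if j = ⟨k, hk⟩ then algebraMap ℂ (OP g) (1 / 2) else 0, fun j => ?_,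
        fun f => ?_⟩
      · dsimp only
        split_ifs
        · exact Subalgebra.algebraMap_mem _ _
        · exact zero_mem _
      · simp only [ite_mul, zero_mul, Finset.sum_ite_eq', Finset.mem_univ, if_true]
        have h2 := h1 f
        rw [coeff_X_mul] at h2
        rw [← h2, ← mul_assoc, ← map_ofNat (algebraMap ℂ (OP g)) 2, ← map_mul]
        norm_num
    · refine ⟨0, fun j => zero_mem _, fun f => ?_⟩
      rw [coeff_eq_zero_of_natDegree_lt (by rw [natDegree_pM]; omega), map_zero, hB.zero_right]
      simp
  | algebraMap z =>
    exact ⟨0, fun j => zero_mem _, fun f => by rw [AlgHom.commutes, hB.algebraMap_right]; simp⟩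
  | add x y _ _ hx hy =>
    obtain ⟨c, hc, hc'⟩ := hx
    obtain ⟨d, hd, hd'⟩ := hy
    refine ⟨fun j => c j + d j, fun j => add_mem (hc j) (hd j), fun f => ?_⟩
    rw [map_add, hB.add_right, hc', hd', ← Finset.sum_add_distrib]
    exact Finset.sum_congr rfl fun j _ => by ring
  | mul x y hx0 hy0 hx hy =>
    obtain ⟨c, hc, hc'⟩ := hx
    obtain ⟨d, hd, hd'⟩ := hy
    refine ⟨fun j => ρ x * d j + ρ y * c j, fun j => add_mem (mul_mem (restrictP_mem hx0) (hd j))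
      (mul_mem (restrictP_mem hy0) (hc j)), fun f => ?_⟩
    rw [map_mul, hB.mul_right, hc', hd', Finset.mul_sum, Finset.mul_sum, ← Finset.sum_add_distrib]
    exact Finset.sum_congr rfl fun j _ => by ring

theorem prym_fields (i : ℕ) (hi : i ≤ g) : ∃ c : Fin (g + 1) → OP g,
    (∀ j, c j ∈ Algebra.adjoin ℂ (Set.range (momentumP g).coeff)) ∧
    ∀ (m : ZMod (g + 1)) (h : ℂ), h ≠ 0 → ∀ f : OP g,
      kmBracket g (phiK g m f) (restrictK g (todaHam g h i)) =
        phiK g m (∑ j, c j * (prymField g f).coeff j) := by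
  obtain ⟨q, hq, e⟩ := exists_todaHam hg i hi
  obtain ⟨c, hc, hc'⟩ := exists_prymField_combination hg q hq
  refine ⟨c, hc, fun m h hh f => ?_⟩
  rw [e m h hh, ← phiK_restrictP m hg, ← isPoissonMap_phiK_X hg, hc']

end

end PrymToda

/-! ### From Toda to Mumford and from KM to Prym. -/

theorem mainTheorem8 (g : ℕ) (hg : 1 ≤ g) (φ : ℂ[X]) (hφ : φ.natDegree ≤ 1) :
    -- (i)
    (SatisfiesQuadFormulas g φ (quadBracket g φ) ∧
      IsPoissonBracket (quadBracket g φ) ∧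
      (∀ m : ZMod (g + 1),
        ((uM g).map (phiT g m).toRingHom = uPhi g m ∧
          (vM g).map (phiT g m).toRingHom = vPhi g m ∧
          (wM g).map (phiT g m).toRingHom = wPhi g m) ∧
        IsPoissonMap (todaBracket g φ) (quadBracket g φ) (phiT g m) ∧
        ∀ h : ℂ, h ≠ 0 → ∀ (f : OM g) (j : ℕ),
          todaBracket g φ (phiT g m f) ((momentumT g h).coeff j) =
            phiT g m ((liftC φ * mumfordField g f).coeff j)) ∧
      (∀ i ≤ g, ∃ c : Fin (g + 1) → OM g,
        (∀ j, c j ∈ Algebra.adjoin ℂ (Set.range (momentumM g).coeff)) ∧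
        ∀ (m : ZMod (g + 1)) (h : ℂ), h ≠ 0 → ∀ f : OM g,
          todaBracket g 1 (phiT g m f) (todaHam g h i) =
            phiT g m (∑ j, c j * (mumfordField g f).coeff j))) ∧
    -- (ii)
    (φ.comp (-Polynomial.X) = -φ →
      (∃ BP : OP g → OP g → OP g,
        IsPoissonBracket BP ∧ InducesOnPrym g (quadBracket g φ) BP ∧
        (∀ BP' : OP g → OP g → OP g, InducesOnPrym g (quadBracket g φ) BP' → BP' = BP) ∧
        ∀ m : ZMod (g + 1),
          IsPoissonMap (fun f f' => φ.coeff 1 • kmBracket g f f') BP (phiK g m)) ∧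
      (∀ m : ZMod (g + 1),
        (∀ f : OM g, phiK g m (restrictP g f) = restrictK g (phiT g m f)) ∧
        ∀ h : ℂ, h ≠ 0 → ∀ (f : OP g) (j : ℕ),
          kmBracket g (phiK g m f) (restrictK g ((momentumT g h).coeff j)) =
            phiK g m ((Polynomial.X * prymField g f).coeff j)) ∧
      (∀ i ≤ g, ∃ c : Fin (g + 1) → OP g,
        (∀ j, c j ∈ Algebra.adjoin ℂ (Set.range (momentumP g).coeff)) ∧
        ∀ (m : ZMod (g + 1)) (h : ℂ), h ≠ 0 → ∀ f : OP g,
          kmBracket g (phiK g m f) (restrictK g (todaHam g h i)) =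
            phiK g m (∑ j, c j * (prymField g f).coeff j))) :=
  ⟨⟨satisfiesQuadFormulas hg hφ, isPoissonBracket_quadBracket hφ hg,
    fun m => ⟨⟨map_uM m, map_vM m hg, map_wM m hg⟩, isPoissonMap_phiT m hφ hg,
      fun h hh f j => toda_flow hφ hg m h hh f j⟩,
    toda_fields hg⟩,
  fun hodd => ⟨⟨prymBracket g φ,
      isPoissonBracket_prymBracket hφ (coeff_zero_of_odd hodd) hg, inducesOnPrym_prymBracket,
      eq_prymBracket, fun m => isPoissonMap_phiK m hg hφ⟩,
    fun m => ⟨phiK_restrictP m hg, fun h hh f j => prym_flow hg m h hh f j⟩, prym_fields hg⟩⟩
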